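/- **Ribbon graphs.** A ribbon graph $\Gamma$ is a finite set of half-edges with a permutation $\sigma$, whose cycles are the vertices with the cyclic ordering of their half-edges, and an involution $\alpha$, whose 2-cycles are the internal edges and whose fixed points are the external edges. Its faces are the cycles of $\sigma\alpha$; a face is broken if it contains an external edge. If $\Gamma$ is connected with $V$ vertices, $I$ internal edges and $F$ faces, its genus $g$ is given by $2-2g=V-I+F$; it is planar if $g=0$, and a planar graph is regular if it has exactly one broken face. Two connected ribbon graphs are isomorphic if there is a bijection of the half-edges that commutes with the involutions and carries $\sigma$ either to $\sigma'$ or to $\sigma'^{-1}$ (a homeomorphism of ribbon surfaces, which may reverse the orientation). A 1PI ribbon Feynman graph (of the Grosse–Wulkenhaar $\Phi^4$ model) is a connected ribbon graph with all vertices of valence $4$ and at least one internal edge, which stays connected when any one internal edge is cut into two external edges. **Subgraphs and shrinking.** A subgraph $\gamma\subset\Gamma$ is a set of internal edges of $\Gamma$ together with the vertices hooked to them; the other half-edges at these vertices are its external edges. Let $\underline\Gamma$ be the set of subgraphs $\gamma$ of $\Gamma$, with edge set neither empty nor full, all of whose connected components are 1PI, planar regular, and have $2$ or $4$ external edges. The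 cograph $\Gamma/\gamma$ is obtained by replacing each component of $\gamma$ with $4$ external edges by a vertex, whose half-edges are these external edges in the cyclic order in which they occur along the broken face of the component, and each component with $2$ external edges by an edge (merging with the adjacent edges into a single edge). If $\Gamma$ has no external edges, those $\gamma$ for which this would leave a closed line without vertices are not included in $\underline\Gamma$. **Theorem.** Let $K$ be a field and let $\mathcal H^\star$ be the free commutative unital $K$-algebra on the isomorphism classes of 1PI ribbon Feynman graphs, where a disjoint union of such graphs is identified with the product of its components and the empty graph with $1$. For every 1PI ribbon Feynman graph $\Gamma$ and $\gamma\in\underline\Gamma$, the components of $\gamma$ and the cograph $\Gamma/\gamma$ are 1PI ribbon Feynman graphs. There are well-defined algebra homomorphisms $\Delta:\mathcal H^\star\to\mathcal H^\star\otimes\mathcal H^\star$, $\varepsilon:\mathcal H^\star\to K$ and $S:\mathcal H^\star\to\mathcal H^\star$ given on each 1PI ribbon Feynman graph $\Gamma$ by $$\Delta\Gamma=\Gamma\otimes1+1\otimes\Gamma+\sum_{\gamma\in\underline\Gamma}\gamma\otimes\Gamma/\gamma,\qquad \varepsilon(\Gamma)=0,\qquad S(\Gamma)=-\Gamma-\sum_{\gamma\in\underline\Gamma}S(\gamma)\,\Gamma/\gamma,$$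 the last one recursively in the number of internal edges. The quadruple $(\mathcal H^\star,\Delta,\varepsilon,S)$ is a Hopf algebra: $\Delta$ is coassociative, $\varepsilon$ is a counit for $\Delta$, $\Delta$ and $\varepsilon$ are unital algebra homomorphisms, and $m(S\otimes\mathrm{id})\Delta=u\varepsilon=m(\mathrm{id}\otimes S)\Delta$. -/

import Mathlib

open scoped TensorProduct

noncomputable section

/-! ### First-return permutations -/

namespace FirstReturn

variable {X : Type}

/-- The least `n ≥ 1` with `pⁿ x ∈ s`. -/
def time (p : Equiv.Perm X) (s : Set X) (x : X) : ℕ :=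
  sInf {n | 0 < n ∧ (p ^ n) x ∈ s}

theorem time_spec [Finite X] (p : Equiv.Perm X) (s : Set X) {x : X} (hx : x ∈ s) :
    0 < time p s x ∧ (p ^ time p s x) x ∈ s := by
  have hne : {n | 0 < n ∧ (p ^ n) x ∈ s}.Nonempty :=
    ⟨orderOf p, orderOf_pos p, by simpa [pow_orderOf_eq_one] using hx⟩
  exact Nat.sInf_mem hne

theorem time_le (p : Equiv.Perm X) (s : Set X) {x : X} {n : ℕ} (h0 : 0 < n)
    (hn : (p ^ n) x ∈ s) : time p s x ≤ n :=
  Nat.sInf_le ⟨h0, hn⟩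

/-- The first-return map of the permutation `p` to the set `s`, as a map `s → s`. -/
def map [Finite X] (p : Equiv.Perm X) (s : Set X) (x : s) : s :=
  ⟨(p ^ time p s x) x, (time_spec p s x.2).2⟩

theorem map_inv_map [Finite X] (p : Equiv.Perm X) (s : Set X) (x : s) :
    map p⁻¹ s (map p s x) = x := by
  obtain ⟨x, hx⟩ := x
  obtain ⟨h0, hm⟩ := time_spec p s hx
  set m := time p s x with hmdef
  have hback : ∀ k, k ≤ m → (p⁻¹ ^ k) ((p ^ m) x) = (p ^ (m - k)) x := by
    intro k hk
    obtain ⟨j, hj⟩ := Nat.exists_eq_add_of_le hk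
    rw [hj, pow_add, Equiv.Perm.mul_apply, ← Equiv.Perm.mul_apply, inv_pow, inv_mul_cancel]
    simp
  have hle : time p⁻¹ s ((p ^ m) x) ≤ m :=
    time_le _ _ h0 (by rw [hback m le_rfl]; simpa using hx)
  have heq : time p⁻¹ s ((p ^ m) x) = m := by
    obtain ⟨k0, hk⟩ := time_spec p⁻¹ s hm
    rw [hback _ hle] at hk
    by_contra hlt
    have := time_le p s (by omega : 0 < m - time p⁻¹ s ((p ^ m) x)) hk
    omega
  apply Subtype.ext
  change (p⁻¹ ^ time p⁻¹ s ((p ^ m) x)) ((p ^ m) x) = x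
  rw [heq, hback m le_rfl]
  simp

/-- The first-return map is a permutation of `s`; its inverse is the first-return map of `p⁻¹`. -/
def perm [Finite X] (p : Equiv.Perm X) (s : Set X) : Equiv.Perm s where
  toFun := map p s
  invFun := map p⁻¹ s
  left_inv := map_inv_map p s
  right_inv x := by simpa using map_inv_map p⁻¹ s x

/-- If `a` and `t` are involutions and `t` fixes `s` pointwise, then the first-return map of
`a * t` to `s` is an involution. -/
theorem perm_perm_of_involutive [Finite X] (a t : Equiv.Perm X) (s : Set X) (ha : ∀ x, a (a x) = x)
    (ht : ∀ x, t (t x) = x) (hts : ∀ x ∈ s, t x = x) (x : s) :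
    perm (a * t) s (perm (a * t) s x) = x := by
  have haa : a⁻¹ = a := by
    ext y; rw [Equiv.Perm.inv_eq_iff_eq, ha]
  have htt : t⁻¹ = t := by
    ext y; rw [Equiv.Perm.inv_eq_iff_eq, ht]
  have hinv : (a * t)⁻¹ = t * (a * t) * t⁻¹ := by
    rw [mul_inv_rev, haa, htt, mul_assoc, mul_assoc]
    have : t * t = 1 := by ext y; simp [ht]
    rw [this, mul_one]
  have hpow : ∀ (n : ℕ) (y : X), y ∈ s → ((a * t)⁻¹ ^ n) y = t (((a * t) ^ n) y) := by
    intro n y hy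
    rw [hinv, conj_pow, Equiv.Perm.mul_apply, Equiv.Perm.mul_apply, htt, hts y hy]
  have hmem : ∀ y : X, t y ∈ s ↔ y ∈ s := by
    intro y
    constructor
    · intro h
      have h' := hts _ h
      rw [ht] at h'
      rwa [← h'] at h
    · intro h
      rwa [hts y h]
  have hmap : ∀ y : s, map (a * t)⁻¹ s y = map (a * t) s y := by
    rintro ⟨y, hy⟩
    have htime : time (a * t)⁻¹ s y = time (a * t) s y := by
      unfold time
      congr 1
      ext n
      simp only [Set.mem_ofPred_eq, hpow n y hy, hmem]
    apply Subtype.ext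
    change ((a * t)⁻¹ ^ time (a * t)⁻¹ s y) y = ((a * t) ^ time (a * t) s y) y
    rw [htime, hpow _ y hy, hts _ (time_spec (a * t) s hy).2]
  change map (a * t) s (map (a * t) s x) = x
  rw [← hmap (map (a * t) s x), map_inv_map]

end FirstReturn

/-! ### Ribbon graphs -/

/-- A ribbon graph with internal and external edges: a finite set of half-edges, a permutation
`rot` whose cycles are the vertices with the cyclic ordering of the half-edges incident to them,
and an involution `flip` whose 2-cycles are the internal edges and whose fixed points are the
external edges. -/
structure RibbonGraph where
  HalfEdge : Type
  finite : Finite HalfEdge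
  rot : Equiv.Perm HalfEdge
  flip : Equiv.Perm HalfEdge
  flip_flip : ∀ h, flip (flip h) = h

namespace RibbonGraph

instance (G : RibbonGraph) : Finite G.HalfEdge := G.finite

/-- Vertices are the cycles of `rot`. -/
abbrev Vertex (G : RibbonGraph) : Type := Quotient (Equiv.Perm.SameCycle.setoid G.rot)

/-- Faces, that is boundary components of the surface, are the cycles of `rot * flip`: walk along
one side of an edge (of a dangling ribbon, for an external edge), then go to the next half-edge at
the vertex reached. -/
abbrev Face (G : RibbonGraph) : Type := Quotient (Equiv.Perm.SameCycle.setoid (G.rot * G.flip))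

def numVertices (G : RibbonGraph) : ℕ := Nat.card G.Vertex

def numFaces (G : RibbonGraph) : ℕ := Nat.card G.Face

/-- Number of half-edges that belong to internal edges. -/
def numInternalHalfEdges (G : RibbonGraph) : ℕ := Nat.card {h : G.HalfEdge // G.flip h ≠ h}

def numExternalEdges (G : RibbonGraph) : ℕ := Nat.card {h : G.HalfEdge // G.flip h = h}

/-- Number of faces broken by at least one external edge. -/
def numBrokenFaces (G : RibbonGraph) : ℕ :=
  Nat.card {f : G.Face // ∃ h : G.HalfEdge, G.flip h = h ∧ Quotient.mk _ h = f}

/-- The genus `g` of a connected ribbon graph, given by `2 - 2 g = V - I + F`. -/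
def genus (G : RibbonGraph) : ℚ :=
  (2 - ((G.numVertices : ℚ) - (G.numInternalHalfEdges : ℚ) / 2 + (G.numFaces : ℚ))) / 2

/-- The equivalence relation whose classes are the connected components. -/
def connSetoid (G : RibbonGraph) : Setoid G.HalfEdge :=
  Relation.EqvGen.setoid fun a b => b = G.rot a ∨ b = G.flip a

def IsConnected (G : RibbonGraph) : Prop :=
  Nonempty G.HalfEdge ∧ ∀ a b : G.HalfEdge, G.connSetoid a b

/-- Every vertex has valence four. -/
def IsQuartic (G : RibbonGraph) : Prop :=
  ∀ h : G.HalfEdge, Function.minimalPeriod G.rot h = 4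

/-- A set of internal edges of `G`, given by the set of its half-edges. -/
abbrev EdgeSet (G : RibbonGraph) : Type :=
  {D : Set G.HalfEdge // ∀ h ∈ D, G.flip h ∈ D ∧ G.flip h ≠ h}

theorem flip_mem_iff (G : RibbonGraph) (D : G.EdgeSet) (h : G.HalfEdge) :
    G.flip h ∈ D.1 ↔ h ∈ D.1 := by
  constructor
  · intro hh
    have := (D.2 _ hh).1
    rwa [G.flip_flip] at this
  · intro hh
    exact (D.2 _ hh).1

open Classical in
/-- `flip` on the edges of `D`, the identity on all the other half-edges. -/
def flipOn (G : RibbonGraph) (D : G.EdgeSet) : Equiv.Perm G.HalfEdge :=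
  Function.Involutive.toPerm (fun h => if h ∈ D.1 then G.flip h else h) (by
    intro h
    by_cases hh : h ∈ D.1
    · simp [hh, G.flip_mem_iff D h, G.flip_flip]
    · simp [hh])

/-- The graph with the same vertices as `G` in which the internal edges outside `D` are cut, each
of them into two external edges. -/
def cutOutside (G : RibbonGraph) (D : G.EdgeSet) : RibbonGraph where
  HalfEdge := G.HalfEdge
  finite := G.finite
  rot := G.rot
  flip := G.flipOn D
  flip_flip := by
    intro h
    exact (G.flipOn D).left_inv h

/-- All the internal edges other than the one containing `h`. -/
def edgesExcept (G : RibbonGraph) (h : G.HalfEdge) : G.EdgeSet :=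
  ⟨{x | G.flip x ≠ x ∧ x ≠ h ∧ x ≠ G.flip h}, by
    rintro x ⟨h1, h2, h3⟩
    refine ⟨⟨?_, ?_, ?_⟩, h1⟩
    · rw [G.flip_flip]; exact h1.symm
    · rintro rfl; exact h3 (G.flip_flip x).symm
    · exact fun hx => h2 (G.flip.injective hx)⟩

/-- One-particle irreducible: connected, with at least one internal edge, and still connected
after cutting any one internal edge. -/
def Is1PI (G : RibbonGraph) : Prop :=
  G.IsConnected ∧ (∃ h, G.flip h ≠ h) ∧
    ∀ h, G.flip h ≠ h → (G.cutOutside (G.edgesExcept h)).IsConnected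

/-- A 1PI ribbon Feynman graph of the quartic model. -/
def IsFeynman1PI (G : RibbonGraph) : Prop := G.IsQuartic ∧ G.Is1PI

/-- Planar regular (genus zero and exactly one broken face), with two or four external edges. -/
def IsPrimitivelyDivergent (G : RibbonGraph) : Prop :=
  G.genus = 0 ∧ G.numBrokenFaces = 1 ∧ (G.numExternalEdges = 2 ∨ G.numExternalEdges = 4)

/-! ### Subgraphs and their components -/

theorem connSetoid_rot (G : RibbonGraph) (h : G.HalfEdge) : G.connSetoid h (G.rot h) :=
  Relation.EqvGen.rel _ _ (Or.inl rfl)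

theorem connSetoid_flip (G : RibbonGraph) (h : G.HalfEdge) : G.connSetoid h (G.flip h) :=
  Relation.EqvGen.rel _ _ (Or.inr rfl)

/-- A connected component of `G` as a ribbon graph of its own. -/
def component (G : RibbonGraph) (c : Quotient G.connSetoid) : RibbonGraph where
  HalfEdge := {h : G.HalfEdge // Quotient.mk G.connSetoid h = c}
  finite := inferInstance
  rot := G.rot.subtypePerm fun h => by
    rw [Quotient.sound (s := G.connSetoid) (G.connSetoid_rot h)]
  flip := G.flip.subtypePerm fun h => by
    rw [Quotient.sound (s := G.connSetoid) (G.connSetoid_flip h)]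
  flip_flip := by
    rintro ⟨h, hh⟩
    exact Subtype.ext (G.flip_flip h)

/-- The connected components of the subgraph with edge set `D`. The subgraph has only the vertices
hooked to the edges of `D`, so these are the components of `G.cutOutside D` that meet `D`. -/
abbrev SubComponent (G : RibbonGraph) (D : G.EdgeSet) : Type :=
  {c : Quotient (G.cutOutside D).connSetoid //
    ∃ h : G.HalfEdge, h ∈ D.1 ∧ Quotient.mk (G.cutOutside D).connSetoid h = c}

instance (G : RibbonGraph) (D : G.EdgeSet) : Finite (G.SubComponent D) :=
  inferInstanceAs (Finite {c : Quotient (G.cutOutside D).connSetoid //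
    ∃ h : G.HalfEdge, h ∈ D.1 ∧ Quotient.mk (G.cutOutside D).connSetoid h = c})

instance (G : RibbonGraph) (D : G.EdgeSet) : Fintype (G.SubComponent D) := Fintype.ofFinite _

def subComponent (G : RibbonGraph) (D : G.EdgeSet) (c : G.SubComponent D) : RibbonGraph :=
  (G.cutOutside D).component c.1

/-! ### Shrinking -/

/-- Shrink each component of the subgraph with edge set `D` to a vertex. The half-edges at the new
vertices are the external edges of the components, in the cyclic order in which they are met along
the broken face of the component; the other vertices are unchanged. -/
def contract (G : RibbonGraph) (D : G.EdgeSet) : RibbonGraph where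
  HalfEdge := {h : G.HalfEdge // h ∈ (D.1)ᶜ}
  finite := inferInstance
  rot := FirstReturn.perm (G.rot * G.flipOn D) (D.1)ᶜ
  flip := G.flip.subtypePerm fun h => not_congr (G.flip_mem_iff D h)
  flip_flip := by
    rintro ⟨h, hh⟩
    exact Subtype.ext (G.flip_flip h)

/-- The half-edges at vertices of valence two. -/
def bivalent (G : RibbonGraph) : Set G.HalfEdge := {h | G.rot h ≠ h ∧ G.rot (G.rot h) = h}

theorem rot_mem_bivalent (G : RibbonGraph) (h : G.HalfEdge) :
    G.rot h ∈ G.bivalent ↔ h ∈ G.bivalent := by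
  simp only [bivalent, Set.mem_ofPred_eq, ne_eq, EmbeddingLike.apply_eq_iff_eq]

open Classical in
/-- `rot` at the vertices of valence two, the identity on all the other half-edges. -/
def crossBivalent (G : RibbonGraph) : Equiv.Perm G.HalfEdge :=
  Function.Involutive.toPerm (fun h => if h ∈ G.bivalent then G.rot h else h) (by
    intro h
    by_cases hh : h ∈ G.bivalent
    · simp only [hh, if_true, G.rot_mem_bivalent h]
      exact hh.2
    · simp [hh])

/-- Erase the vertices of valence two: each maximal chain of edges that passes through such
vertices becomes a single edge. -/
def eraseBivalent (G : RibbonGraph) : RibbonGraph where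
  HalfEdge := {h : G.HalfEdge // h ∈ (G.bivalent)ᶜ}
  finite := inferInstance
  rot := G.rot.subtypePerm fun h => not_congr (G.rot_mem_bivalent h)
  flip := FirstReturn.perm (G.flip * G.crossBivalent) (G.bivalent)ᶜ
  flip_flip := FirstReturn.perm_perm_of_involutive _ _ _ G.flip_flip
    (fun x => G.crossBivalent.left_inv x) (by
      intro x hx
      have hx' : x ∉ G.bivalent := hx
      exact if_neg hx')

/-- The cograph: components with four external edges are replaced by a vertex, those with two
external edges by an edge. -/
def shrink (G : RibbonGraph) (D : G.EdgeSet) : RibbonGraph := (G.contract D).eraseBivalent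

/-- The edge sets of the primitively divergent subgraphs which the coproduct of `G` sums over:
neither empty nor full, with all components 1PI and primitively divergent. The last condition only
matters if `G` has no external edges; it says that the subgraph is not a closed chain of components
with two external edges, shrinking which would leave a closed line without vertices. -/
def divergentSubgraphs (G : RibbonGraph) : Finset G.EdgeSet :=
  Set.Finite.toFinset (s := {D : G.EdgeSet |
    D.1.Nonempty ∧ D.1 ≠ {h | G.flip h ≠ h} ∧
    (∀ c, (G.subComponent D c).Is1PI ∧ (G.subComponent D c).IsPrimitivelyDivergent) ∧
    Nonempty (G.shrink D).HalfEdge}) (Set.toFinite _)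

/-! ### Isomorphism -/

/-- A homeomorphism mapping vertices to vertices and edges to edges: it preserves incidence and
either preserves or reverses all the cyclic orderings (the graphs compared below are connected, and
their surfaces are orientable but carry no preferred orientation). -/
def Isomorphic (G G' : RibbonGraph) : Prop :=
  ∃ e : G.HalfEdge ≃ G'.HalfEdge, (∀ h, e (G.flip h) = G'.flip (e h)) ∧
    ((∀ h, e (G.rot h) = G'.rot (e h)) ∨ (∀ h, e (G.rot h) = G'.rot.symm (e h)))

theorem Isomorphic.refl (G : RibbonGraph) : Isomorphic G G :=
  ⟨Equiv.refl _, fun _ => rfl, Or.inl fun _ => rfl⟩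

theorem Isomorphic.symm {G G' : RibbonGraph} (h : Isomorphic G G') : Isomorphic G' G := by
  obtain ⟨e, hf, hr⟩ := h
  refine ⟨e.symm, fun x => ?_, ?_⟩
  · rw [Equiv.symm_apply_eq, hf, Equiv.apply_symm_apply]
  · refine hr.imp (fun hr x => ?_) (fun hr x => ?_)
    · rw [Equiv.symm_apply_eq, hr, Equiv.apply_symm_apply]
    · have := hr (G.rot.symm (e.symm x))
      rw [Equiv.apply_symm_apply, Equiv.apply_symm_apply, Equiv.eq_symm_apply] at this
      rw [Equiv.symm_apply_eq, this]

theorem Isomorphic.trans {G G' G'' : RibbonGraph} (h : Isomorphic G G') (h' : Isomorphic G' G'') :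
    Isomorphic G G'' := by
  obtain ⟨e, hf, hr⟩ := h
  obtain ⟨e', hf', hr'⟩ := h'
  have hs : ∀ {A B : RibbonGraph} (i : A.HalfEdge ≃ B.HalfEdge),
      (∀ x, i (A.rot x) = B.rot (i x)) → ∀ x, i (A.rot.symm x) = B.rot.symm (i x) := by
    intro A B i hi x
    rw [Equiv.eq_symm_apply, ← hi, Equiv.apply_symm_apply]
  have hs' : ∀ {A B : RibbonGraph} (i : A.HalfEdge ≃ B.HalfEdge),
      (∀ x, i (A.rot x) = B.rot.symm (i x)) → ∀ x, i (A.rot.symm x) = B.rot (i x) := by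
    intro A B i hi x
    rw [← Equiv.symm_apply_eq, ← hi, Equiv.apply_symm_apply]
  refine ⟨e.trans e', fun x => ?_, ?_⟩
  · simp [hf, hf']
  · rcases hr with hr | hr <;> rcases hr' with hr' | hr'
    · exact Or.inl fun x => by simp [hr, hr']
    · exact Or.inr fun x => by simp [hr, hr']
    · exact Or.inr fun x => by simp [hr, hs e' hr']
    · exact Or.inl fun x => by simp [hr, hs' e' hr']

theorem Isomorphic.numInternalHalfEdges_eq {G G' : RibbonGraph} (h : Isomorphic G G') :
    G.numInternalHalfEdges = G'.numInternalHalfEdges := by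
  obtain ⟨e, hf, -⟩ := h
  refine Nat.card_congr (e.subtypeEquiv fun x => ?_)
  rw [← hf]
  simp

/-- The components of a proper subgraph have fewer internal edges than the graph. -/
theorem numInternalHalfEdges_subComponent_lt (G : RibbonGraph) (D : G.EdgeSet)
    (hD : D ∈ G.divergentSubgraphs) (c : G.SubComponent D) :
    (G.subComponent D c).numInternalHalfEdges < G.numInternalHalfEdges := by
  have hD' : D.1 ≠ {h | G.flip h ≠ h} := by
    have := (Set.Finite.mem_toFinset _).1 hD
    exact this.2.1
  have hss : D.1 ⊂ {h | G.flip h ≠ h} :=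
    (Set.ssubset_iff_subset_ne).2 ⟨fun h hh => (D.2 h hh).2, hD'⟩
  have hlt : D.1.ncard < {h | G.flip h ≠ h}.ncard := Set.ncard_lt_ncard hss (Set.toFinite _)
  refine lt_of_le_of_lt ?_ hlt
  let f : {h : (G.subComponent D c).HalfEdge // (G.subComponent D c).flip h ≠ h} → D.1 :=
    fun h => ⟨h.1.1, by
      by_contra hn
      exact h.2 (Subtype.ext (by
        change G.flipOn D h.1.1 = h.1.1
        exact if_neg hn))⟩
  have hf : Function.Injective f := fun a b hab => by
    have : a.1.1 = b.1.1 := congrArg (fun x : D.1 => x.1) hab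
    exact Subtype.ext (Subtype.ext this)
  exact Nat.card_le_card_of_injective f hf

end RibbonGraph

/-! ### The algebra -/

instance feynmanSetoid : Setoid {G : RibbonGraph // G.IsFeynman1PI} where
  r G G' := RibbonGraph.Isomorphic G.1 G'.1
  iseqv := ⟨fun G => .refl G.1, .symm, .trans⟩

/-- Isomorphism classes of 1PI ribbon Feynman graphs. -/
abbrev FeynmanClass : Type 1 := Quotient feynmanSetoid

/-- The free commutative algebra on the 1PI ribbon Feynman graphs; monomials are disjoint unions of
graphs and `1` is the empty graph. -/
abbrev HStar (K : Type*) [Field K] := MvPolynomial FeynmanClass K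

namespace HStar

variable (K : Type*) [Field K]

open Classical in
/-- A 1PI ribbon Feynman graph as a generator of the algebra (and `0` for other ribbon graphs). -/
def ofGraph (G : RibbonGraph) : HStar K :=
  if h : G.IsFeynman1PI then MvPolynomial.X (Quotient.mk feynmanSetoid ⟨G, h⟩) else 0

/-- A subgraph as an element of the algebra: the product of its connected components. -/
def ofSubgraph (G : RibbonGraph) (D : G.EdgeSet) : HStar K :=
  ∏ c, ofGraph K (G.subComponent D c)

/-- The reduced coproduct of a graph: the sum of `γ ⊗ Γ/γ` over the primitively divergent
subgraphs `γ` of `Γ`. -/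
def reducedCoproduct (G : RibbonGraph) : HStar K ⊗[K] HStar K :=
  ∑ D ∈ G.divergentSubgraphs, ofSubgraph K G D ⊗ₜ[K] ofGraph K (G.shrink D)

/-- The coproduct: the algebra homomorphism with `Γ ↦ Γ ⊗ 1 + 1 ⊗ Γ + Δ' Γ` on generators. -/
def coproduct : HStar K →ₐ[K] HStar K ⊗[K] HStar K :=
  MvPolynomial.aeval fun g =>
    MvPolynomial.X g ⊗ₜ[K] 1 + 1 ⊗ₜ[K] MvPolynomial.X g + reducedCoproduct K g.out.1

/-- The counit: the algebra homomorphism that vanishes on all generators. -/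
def counit : HStar K →ₐ[K] K := MvPolynomial.aeval fun _ => 0

open Classical in
/-- The antipode on generators, by recursion on the number of internal edges:
`S Γ = - Γ - ∑ S(γ) Γ/γ`, where `S(γ)` is the product of `S` over the components of `γ`. -/
def antipodeGen (g : FeynmanClass) : HStar K :=
  - MvPolynomial.X g - ∑ D ∈ g.out.1.divergentSubgraphs.attach,
    (∏ c, if h : (g.out.1.subComponent D.1 c).IsFeynman1PI then
        antipodeGen (Quotient.mk feynmanSetoid ⟨g.out.1.subComponent D.1 c, h⟩) else 0) *
      ofGraph K (g.out.1.shrink D.1)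
termination_by g.out.1.numInternalHalfEdges
decreasing_by
  have hiso : RibbonGraph.Isomorphic
      (Quotient.mk feynmanSetoid ⟨g.out.1.subComponent D.1 c, h⟩).out.1
      (g.out.1.subComponent D.1 c) :=
    Quotient.mk_out (s := feynmanSetoid) ⟨g.out.1.subComponent D.1 c, h⟩
  rw [hiso.numInternalHalfEdges_eq]
  exact RibbonGraph.numInternalHalfEdges_subComponent_lt _ _ D.2 c

/-- The antipode, extended multiplicatively from the generators. -/
def antipode : HStar K →ₐ[K] HStar K := MvPolynomial.aeval (antipodeGen K)

end HStar

/-! ### Hopf algebras -/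

/-- The linear maps `Δ`, `ε`, `S` make the `R`-algebra `A` a Hopf algebra. -/
structure IsHopfAlgebra (R A : Type*) [CommSemiring R] [Semiring A] [Algebra R A]
    (Δ : A →ₗ[R] A ⊗[R] A) (ε : A →ₗ[R] R) (S : A →ₗ[R] A) : Prop where
  coassoc : TensorProduct.assoc R A A A ∘ₗ Δ.rTensor A ∘ₗ Δ = Δ.lTensor A ∘ₗ Δ
  counit_left : ε.rTensor A ∘ₗ Δ = TensorProduct.mk R R A 1
  counit_right : ε.lTensor A ∘ₗ Δ = (TensorProduct.mk R A R).flip 1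
  comul_one : Δ 1 = 1
  comul_mul : ∀ a b, Δ (a * b) = Δ a * Δ b
  counit_one : ε 1 = 1
  counit_mul : ∀ a b, ε (a * b) = ε a * ε b
  antipode_left : LinearMap.mul' R A ∘ₗ S.rTensor A ∘ₗ Δ = Algebra.linearMap R A ∘ₗ ε
  antipode_right : LinearMap.mul' R A ∘ₗ S.lTensor A ∘ₗ Δ = Algebra.linearMap R A ∘ₗ ε

/-- `IsHopfAlgebra` is Mathlib's notion, with the structure maps given explicitly. -/
@[reducible]
def IsHopfAlgebra.toHopfAlgebra {R A : Type*} [CommSemiring R] [Semiring A] [Algebra R A]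
    {Δ : A →ₗ[R] A ⊗[R] A} {ε : A →ₗ[R] R} {S : A →ₗ[R] A} (h : IsHopfAlgebra R A Δ ε S) :
    HopfAlgebra R A :=
  letI : Coalgebra R A :=
    { comul := Δ
      counit := ε
      coassoc := h.coassoc
      rTensor_counit_comp_comul := h.counit_left
      lTensor_counit_comp_comul := h.counit_right }
  { Bialgebra.mk' R A h.counit_one (fun {a b} => h.counit_mul a b) h.comul_one
      (fun {a b} => h.comul_mul a b) with
    antipode := S
    mul_antipode_rTensor_comul := h.antipode_left
    mul_antipode_lTensor_comul := h.antipode_right }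

end

/-!
Shrinking a subgraph `D` of `G` is done in two steps: the contraction `G.contract D`, which replaces
the half-edges of `D` by first returns along `rot * flipOn D`, and the erasure of the vertices of
valence two. If all components of `D` have exactly one broken face, contraction keeps connectivity;
the faces inside `D` and the broken ones are exchanged for vertices, so that the Euler
characteristic of `G` is that of `G.contract D` plus a correction by that of the components of `D`.
Hence `G` is planar regular if and only if the cograph is, and bridges and external edges correspond
as well, which shows that a subgraph `D'` containing `D` is divergent if and only if its image
`D' / D` in `G / D` is.

Coassociativity amounts to the bijection between chains `D' ⊂ D` in `G` and pairs of `D'` in `G` and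
`D / D'` in `G / D'`, together with `(G / D') / (D / D') = G / D`. To compute the coproduct of a
product of divergent graphs, one sums over all divergent edge sets including the empty and the full
one: this sum is multiplicative under disjoint unions.

The recursion for `S` says that `S` is a left inverse of the identity for the convolution product.
It is then a right inverse too, since `id * S` acts as a left unit on `id`, and such an
element is the unit, by induction on the number of internal edges.
-/

noncomputable section

namespace FirstReturn

variable {X Y : Type*}

/-- `Returns p s x y` says that `y` is the first point of `s` on the orbit `p x, p (p x), …`. Unlike
`FirstReturn.time`, it also makes sense for a starting point whose orbit avoids `s`, and induction
on it is induction along the orbit. -/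
inductive Returns (p : Equiv.Perm X) (s : Set X) : X → X → Prop
  | of_mem {x : X} : p x ∈ s → Returns p s x (p x)
  | of_notMem {x y : X} : p x ∉ s → Returns p s (p x) y → Returns p s x y

namespace Returns

variable {p : Equiv.Perm X} {s : Set X} {x y : X}

theorem of_apply_eq (h : p x = y) (hy : y ∈ s) : Returns p s x y := by
  subst h
  exact of_mem hy

theorem mem (h : Returns p s x y) : y ∈ s := by
  induction h with
  | of_mem hx => exact hx
  | of_notMem _ _ ih => exact ih

theorem unique {y' : X} (h : Returns p s x y) (h' : Returns p s x y') : y = y' := by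
  induction h with
  | of_mem hx =>
    cases h' with
    | of_mem _ => rfl
    | of_notMem hx' _ => exact absurd hx hx'
  | of_notMem hx _ ih =>
    cases h' with
    | of_mem hx' => exact absurd hx' hx
    | of_notMem _ h' => exact ih h'

theorem sameCycle (h : Returns p s x y) : p.SameCycle x y := by
  induction h with
  | of_mem _ => exact ⟨1, by rw [zpow_one]⟩
  | of_notMem _ _ ih => exact .trans ⟨1, by rw [zpow_one]⟩ ih

theorem of_pow {n : ℕ} (hn : (p ^ (n + 1)) x ∈ s) (hlt : ∀ k < n, (p ^ (k + 1)) x ∉ s) :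
    Returns p s x ((p ^ (n + 1)) x) := by
  induction n generalizing x with
  | zero => exact of_apply_eq (by rw [zero_add, pow_one]) hn
  | succ n ih =>
    rw [pow_succ, Equiv.Perm.mul_apply] at hn ⊢
    refine of_notMem (by simpa using hlt 0 n.succ_pos) (ih hn fun k hk => ?_)
    simpa only [pow_succ _ (k + 1), Equiv.Perm.mul_apply] using hlt (k + 1) (by omega)

theorem congr {q : Equiv.Perm X} (hpq : ∀ z ∉ s, p z = q z) {x' : X} (hx : p x = q x')
    (h : Returns p s x y) : Returns q s x' y := by
  induction h generalizing x' with
  | of_mem hmem =>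
    rw [hx] at hmem ⊢
    exact of_mem hmem
  | of_notMem hmem _ ih =>
    have hq := ih (hpq _ hmem)
    rw [hx] at hmem hq
    exact of_notMem hmem hq

theorem congr_of_mapsTo {q : Equiv.Perm X} {A : Set X} (hA : Set.MapsTo p A A)
    (hpq : Set.EqOn p q A) (hx : x ∈ A) (h : Returns p s x y) : Returns q s x y := by
  induction h with
  | of_mem hmem => exact of_apply_eq (hpq hx).symm hmem
  | of_notMem hmem _ ih =>
    have hq := ih (hA hx)
    rw [hpq hx] at hmem hq
    exact of_notMem hmem hq

theorem mono_of_mem {r : Set X} (hrs : r ⊆ s) (h : Returns p s x y) (hy : y ∈ r) :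
    Returns p r x y := by
  induction h with
  | of_mem _ => exact of_mem hy
  | of_notMem hx _ ih => exact of_notMem (fun h => hx (hrs h)) (ih hy)

theorem trans {r : Set X} (hrs : r ⊆ s) {z : X} (h : Returns p s x y) (hy : y ∉ r)
    (hz : Returns p r y z) : Returns p r x z := by
  induction h with
  | of_mem _ => exact of_notMem hy hz
  | of_notMem hx _ ih => exact of_notMem (fun h => hx (hrs h)) (ih hy hz)

-- Taking `r = Set.univ`, this covers equivariant maps; taking for `i` the inclusion of a subset
-- `r`, it computes the first returns of a first-return map.
theorem map {q : Equiv.Perm Y} (i : X → Y) {r t : Set Y} (hi : ∀ x, Returns q r (i x) (i (p x)))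
    (htr : t ⊆ r) (hst : ∀ x, x ∈ s ↔ i x ∈ t) (h : Returns p s x y) :
    Returns q t (i x) (i y) := by
  induction h with
  | of_mem hx => exact (hi _).mono_of_mem htr ((hst _).1 hx)
  | of_notMem hx _ ih => exact (hi _).trans htr (fun h => hx ((hst _).2 h)) ih

theorem map_of_semiconj {q : Equiv.Perm Y} {i : X → Y} (hi : ∀ x, i (p x) = q (i x)) {t : Set Y}
    (hst : ∀ x, x ∈ s ↔ i x ∈ t) (h : Returns p s x y) : Returns q t (i x) (i y) :=
  h.map i (fun x => of_apply_eq (hi x).symm (Set.mem_univ _)) (Set.subset_univ t) hst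

theorem mul_comm_of_involutive {t : Equiv.Perm X} (ht : Function.Involutive t)
    (hts : ∀ z ∈ s, t z = z) (h : Returns (t * p) s x y) : Returns (p * t) s (t x) y := by
  have hpt (z : X) : (p * t) (t z) = p z := congrArg p (ht z)
  induction h with
  | @of_mem x hx =>
    have hfix : t (p x) = p x := ht.injective (hts _ hx)
    refine of_apply_eq ?_ hx
    rw [hpt, Equiv.Perm.mul_apply, hfix]
  | @of_notMem x y hx _ ih =>
    rw [Equiv.Perm.mul_apply, ht (p x)] at ih
    rw [← hpt] at ih
    refine of_notMem (fun hmem => hx ?_) ih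
    rw [hpt] at hmem
    rwa [Equiv.Perm.mul_apply, hts _ hmem]

end Returns

theorem returns_perm {X : Type} [Finite X] (p : Equiv.Perm X) (s : Set X) (x : s) :
    Returns p s x (perm p s x) := by
  obtain ⟨hpos, hmem⟩ := time_spec p s x.2
  obtain ⟨n, hn⟩ : ∃ n, time p s x = n + 1 := Nat.exists_eq_add_one.2 hpos
  change Returns p s x ((p ^ time p s x) x)
  rw [hn] at hmem ⊢
  refine .of_pow hmem fun k hk hks => ?_
  have := time_le p s k.succ_pos hks
  omega

theorem sameCycle_perm {X : Type} [Finite X] (p : Equiv.Perm X) (s : Set X) (x y : s) :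
    (perm p s).SameCycle x y ↔ p.SameCycle x y := by
  constructor
  · intro h
    obtain ⟨n, rfl⟩ := h.exists_nat_pow_eq
    clear h
    induction n with
    | zero => exact .refl _ _
    | succ n ih =>
      rw [pow_succ', Equiv.Perm.mul_apply]
      exact ih.trans (returns_perm p s _).sameCycle
  · intro h
    obtain ⟨n, hn⟩ := h.exists_nat_pow_eq
    clear h
    induction n using Nat.strong_induction_on generalizing x with
    | _ n ih =>
      rcases Nat.eq_zero_or_pos n with rfl | h0
      · have hxy : x = y := Subtype.ext (by simpa using hn)
        rw [hxy]
      · have hle : time p s x ≤ n := time_le p s h0 (hn ▸ y.2)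
        have hpos := (time_spec p s x.2).1
        have hrest : (p ^ (n - time p s x)) (perm p s x) = y := by
          change (p ^ (n - time p s x)) ((p ^ time p s x) x) = y
          rw [← Equiv.Perm.mul_apply, ← pow_add, Nat.sub_add_cancel hle, hn]
        exact .trans ⟨1, by rw [zpow_one]⟩ (ih (n - time p s x) (by omega) (perm p s x) hrest)

end FirstReturn

theorem apply_mem_iff_of_mapsTo {X : Type*} [Finite X] (p : Equiv.Perm X) {A : Set X}
    (h : Set.MapsTo p A A) (x : X) : p x ∈ A ↔ x ∈ A :=
  ⟨fun hx => by simpa using Equiv.Perm.perm_symm_mapsTo_of_mapsTo p h hx, fun hx => h hx⟩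

theorem mem_iff_of_sameCycle {X : Type*} [Finite X] {p : Equiv.Perm X} {A : Set X}
    (h : Set.MapsTo p A A) {x y : X} (hxy : p.SameCycle x y) : x ∈ A ↔ y ∈ A := by
  obtain ⟨n, rfl⟩ := hxy.exists_nat_pow_eq
  clear hxy
  induction n with
  | zero => simp
  | succ n ih => rw [pow_succ', Equiv.Perm.mul_apply, apply_mem_iff_of_mapsTo p h, ih]

theorem even_ncard_of_involutive {X : Type*} [Finite X] {A : Set X} {f : X → X}
    (hf : Function.Involutive f) (hA : Set.MapsTo f A A) (hne : ∀ x ∈ A, f x ≠ x) :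
    Even A.ncard := by
  classical
  have := Fintype.ofFinite X
  have hsum : ∑ _ ∈ A.toFinset, (1 : ZMod 2) = 0 := by
    refine Finset.sum_involution (fun x _ => f x) ?_ ?_ ?_ ?_
    · intro _ _; decide
    · intro x hx _; exact hne x (Set.mem_toFinset.1 hx)
    · intro x hx; exact Set.mem_toFinset.2 (hA (Set.mem_toFinset.1 hx))
    · intro x _; exact hf x
  rw [Finset.sum_const, nsmul_eq_mul, mul_one, ZMod.natCast_eq_zero_iff] at hsum
  rw [Set.ncard_eq_toFinset_card']
  exact even_iff_two_dvd.2 hsum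

-- A path with an end `a` has another end.
theorem exists_apply_eq_self_of_involutive {X : Type*} [Finite X] {A : Set X} {a : X} {f g : X → X}
    (hf : Function.Involutive f) (hg : Function.Involutive g) (ha : a ∈ A)
    (hfA : Set.MapsTo f A A) (hgA : Set.MapsTo g (A \ {a}) (A \ {a})) :
    (∃ x ∈ A, f x = x) ∨ ∃ x ∈ A \ {a}, g x = x := by
  by_contra! hcon
  have hA : Even A.ncard := even_ncard_of_involutive hf hfA hcon.1
  have hAa : Even (A \ {a}).ncard := even_ncard_of_involutive hg hgA hcon.2
  rw [← Set.ncard_sdiff_singleton_add_one ha (Set.toFinite A)] at hA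
  exact Nat.even_add_one.1 hA hAa

theorem minimalPeriod_eq_card_sameCycle {X : Type*} [Finite X] (p : Equiv.Perm X) (x : X) :
    Function.minimalPeriod p x = Nat.card {y // p.SameCycle x y} := by
  classical
  have := Fintype.ofFinite X
  have hcard := MulAction.minimalPeriod_eq_card (a := p) (b := x)
  rw [← Nat.card_eq_fintype_card] at hcard
  rw [show Function.minimalPeriod p x = Function.minimalPeriod (p • ·) x from rfl, hcard]
  refine Nat.card_congr (Equiv.subtypeEquivRight fun y => ?_)
  rw [MulAction.mem_orbit_iff]
  constructor
  · rintro ⟨⟨_, n, rfl⟩, hg⟩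
    exact ⟨n, hg⟩
  · rintro ⟨n, hn⟩
    exact ⟨⟨p ^ n, n, rfl⟩, hn⟩

/-- The classes of a pulled back equivalence relation are the classes that meet the image. -/
def quotientEquivMeets {A X : Type*} (r : Setoid A) (s : Setoid X) (i : A → X)
    (h : ∀ a b, r a b ↔ s (i a) (i b)) :
    Quotient r ≃ {c : Quotient s // ∃ a, Quotient.mk s (i a) = c} :=
  Equiv.ofBijective
    (Quotient.lift (fun a => ⟨Quotient.mk s (i a), a, rfl⟩)
      fun a b hab => Subtype.ext (Quotient.sound ((h a b).1 hab))) <| by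
    constructor
    · rintro ⟨a⟩ ⟨b⟩ hab
      exact Quotient.sound ((h a b).2 (Quotient.exact (congrArg Subtype.val hab)))
    · rintro ⟨_, a, rfl⟩
      exact ⟨Quotient.mk r a, rfl⟩

namespace RibbonGraph

variable {G : RibbonGraph}

open FirstReturn

/-! ### Connectedness and cutting edges -/

-- Equalities of graphs cannot be rewritten in statements about their half-edges; the next two
-- lemmas provide equalities over a fixed type of half-edges instead.
theorem eq_of_rot_eq_of_flip_eq {H : Type} {fin fin' : Finite H} {r r' f f' : Equiv.Perm H}
    {hf hf'} (hr : r = r') (hff' : f = f') :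
    (⟨H, fin, r, f, hf⟩ : RibbonGraph) = ⟨H, fin', r', f', hf'⟩ := by
  subst hr hff'
  rfl

theorem connSetoid_eq_of_rot_eq_of_flip_eq {H : Type} {fin fin' : Finite H}
    {r r' f f' : Equiv.Perm H} {hf hf'} (hr : r = r') (hff' : f = f') :
    (⟨H, fin, r, f, hf⟩ : RibbonGraph).connSetoid =
      (⟨H, fin', r', f', hf'⟩ : RibbonGraph).connSetoid := by
  subst hr hff'
  rfl

theorem connSetoid_le {r : Setoid G.HalfEdge} (hr : ∀ h, r h (G.rot h))
    (hf : ∀ h, r h (G.flip h)) : G.connSetoid ≤ r :=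
  Setoid.eqvGen_le fun a _ h => by
    rcases h with rfl | rfl
    exacts [hr a, hf a]

theorem mem_iff_of_conn {A : Set G.HalfEdge} (hr : Set.MapsTo G.rot A A)
    (hf : Set.MapsTo G.flip A A) {x y : G.HalfEdge} (h : G.connSetoid x y) : x ∈ A ↔ y ∈ A := by
  let r : Setoid G.HalfEdge := ⟨fun a b => a ∈ A ↔ b ∈ A,
    fun _ => Iff.rfl, fun h => h.symm, fun h h' => h.trans h'⟩
  exact connSetoid_le (r := r) (fun z => (apply_mem_iff_of_mapsTo G.rot hr z).symm)
    (fun z => (apply_mem_iff_of_mapsTo G.flip hf z).symm) h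

theorem conn_of_sameCycle_rot {x y : G.HalfEdge} (h : G.rot.SameCycle x y) :
    G.connSetoid x y :=
  (mem_iff_of_sameCycle (A := {z | G.connSetoid x z})
    (fun z hz => G.connSetoid.trans hz (G.connSetoid_rot z)) h).1 (G.connSetoid.refl x)

theorem conn_of_sameCycle_face {x y : G.HalfEdge} (h : (G.rot * G.flip).SameCycle x y) :
    G.connSetoid x y :=
  (mem_iff_of_sameCycle (A := {z | G.connSetoid x z})
    (fun z hz => G.connSetoid.trans hz
      (G.connSetoid.trans (G.connSetoid_flip z) (G.connSetoid_rot _))) h).1 (G.connSetoid.refl x)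

theorem flipOn_of_mem (D : G.EdgeSet) {h : G.HalfEdge} (hh : h ∈ D.1) :
    G.flipOn D h = G.flip h := if_pos hh

theorem flipOn_of_notMem (D : G.EdgeSet) {h : G.HalfEdge} (hh : h ∉ D.1) :
    G.flipOn D h = h := if_neg hh

theorem flipOn_ne_iff (D : G.EdgeSet) (h : G.HalfEdge) : G.flipOn D h ≠ h ↔ h ∈ D.1 := by
  by_cases hh : h ∈ D.1
  · simpa [flipOn_of_mem D hh, hh] using (D.2 h hh).2
  · simp [flipOn_of_notMem D hh, hh]

theorem flipOn_eq_iff (D : G.EdgeSet) (h : G.HalfEdge) : G.flipOn D h = h ↔ h ∉ D.1 := by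
  rw [← flipOn_ne_iff, not_not]

theorem conn_cutOutside_flip {D : G.EdgeSet} {h : G.HalfEdge} (hh : h ∈ D.1) :
    (G.cutOutside D).connSetoid h (G.flip h) := by
  have := (G.cutOutside D).connSetoid_flip h
  rwa [show (G.cutOutside D).flip h = G.flip h from flipOn_of_mem D hh] at this

theorem connSetoid_cutOutside_le {D : G.EdgeSet} {r : Setoid G.HalfEdge}
    (hr : ∀ h, r h (G.rot h)) (hf : ∀ h ∈ D.1, r h (G.flip h)) :
    (G.cutOutside D).connSetoid ≤ r := by
  refine connSetoid_le (G := G.cutOutside D) hr fun h => ?_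
  by_cases hh : h ∈ D.1
  · rw [show (G.cutOutside D).flip h = G.flip h from flipOn_of_mem D hh]
    exact hf h hh
  · rw [show (G.cutOutside D).flip h = h from flipOn_of_notMem D hh]
    exact r.refl h

theorem conn_cutOutside_mono {D D' : G.EdgeSet} (h : D.1 ⊆ D'.1) {x y : G.HalfEdge}
    (hxy : (G.cutOutside D).connSetoid x y) : (G.cutOutside D').connSetoid x y :=
  connSetoid_cutOutside_le (G := G) (r := (G.cutOutside D').connSetoid)
    (G.cutOutside D').connSetoid_rot (fun _ hz => conn_cutOutside_flip (h hz)) hxy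

theorem conn_of_conn_cutOutside {D : G.EdgeSet} {x y : G.HalfEdge}
    (hxy : (G.cutOutside D).connSetoid x y) : G.connSetoid x y :=
  connSetoid_cutOutside_le G.connSetoid_rot (fun z _ => G.connSetoid_flip z) hxy

/-- A smaller edge set, as an edge set of the graph cut outside a larger one. -/
def cutEdges (D D' : G.EdgeSet) (h : D.1 ⊆ D'.1) : (G.cutOutside D').EdgeSet :=
  ⟨D.1, fun x hx => by
    rw [show (G.cutOutside D').flip x = G.flip x from flipOn_of_mem D' (h hx)]
    exact D.2 x hx⟩

theorem flipOn_cutEdges (D D' : G.EdgeSet) (h : D.1 ⊆ D'.1) :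
    (G.cutOutside D').flipOn (cutEdges D D' h) = G.flipOn D := by
  refine Equiv.ext fun (x : G.HalfEdge) => ?_
  by_cases hx : x ∈ D.1
  · exact ((flipOn_of_mem (G := G.cutOutside D') (cutEdges D D' h) hx).trans
      (flipOn_of_mem D' (h hx))).trans (flipOn_of_mem D hx).symm
  · exact (flipOn_of_notMem (G := G.cutOutside D') (cutEdges D D' h) hx).trans
      (flipOn_of_notMem D hx).symm

theorem cutOutside_cutEdges (D D' : G.EdgeSet) (h : D.1 ⊆ D'.1) :
    (G.cutOutside D').cutOutside (cutEdges D D' h) = G.cutOutside D :=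
  eq_of_rot_eq_of_flip_eq rfl (flipOn_cutEdges D D' h)

/-- The set of all internal edges. -/
def allEdges (G : RibbonGraph) : G.EdgeSet :=
  ⟨{h | G.flip h ≠ h}, fun _ hh => ⟨fun heq => hh (G.flip.injective heq), hh⟩⟩

theorem subset_allEdges (D : G.EdgeSet) : D.1 ⊆ G.allEdges.1 := fun h hh => (D.2 h hh).2

theorem flipOn_allEdges (G : RibbonGraph) : G.flipOn G.allEdges = G.flip := by
  ext x
  by_cases hx : G.flip x = x
  · rw [hx]
    exact flipOn_of_notMem G.allEdges (fun h => h hx)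
  · exact flipOn_of_mem G.allEdges hx

theorem cutOutside_allEdges (G : RibbonGraph) : G.cutOutside G.allEdges = G :=
  eq_of_rot_eq_of_flip_eq rfl G.flipOn_allEdges

theorem edgesExcept_flip (h : G.HalfEdge) : G.edgesExcept (G.flip h) = G.edgesExcept h := by
  refine Subtype.ext (Set.ext fun x => ?_)
  change (_ ∧ _ ∧ _) ↔ (_ ∧ _ ∧ _)
  rw [G.flip_flip]
  tauto

/-- No internal edge is a bridge. -/
def Bridgeless (G : RibbonGraph) : Prop :=
  ∀ h, G.flip h ≠ h → (G.cutOutside (G.edgesExcept h)).connSetoid h (G.flip h)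

theorem connSetoid_le_cutOutside_edgesExcept {h : G.HalfEdge}
    (hh : (G.cutOutside (G.edgesExcept h)).connSetoid h (G.flip h)) :
    G.connSetoid ≤ (G.cutOutside (G.edgesExcept h)).connSetoid := by
  refine connSetoid_le (G.cutOutside _).connSetoid_rot fun z => ?_
  by_cases hz : G.flip z = z
  · rw [hz]
    exact Setoid.refl' _ z
  by_cases h1 : z = h
  · rwa [h1]
  by_cases h2 : z = G.flip h
  · rw [h2, G.flip_flip]
    exact Setoid.symm' _ hh
  exact conn_cutOutside_flip (D := G.edgesExcept h) ⟨hz, h1, h2⟩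

theorem is1PI_iff : G.Is1PI ↔ G.IsConnected ∧ (∃ h, G.flip h ≠ h) ∧ G.Bridgeless :=
  and_congr_right fun hc => and_congr_right fun _ => forall_congr' fun _ => forall_congr' fun _ =>
    ⟨fun H => H.2 _ _, fun H =>
      ⟨hc.1, fun x y => connSetoid_le_cutOutside_edgesExcept H (hc.2 x y)⟩⟩

/-- The edges of `D` other than the one containing `h`. -/
def removeEdge (D : G.EdgeSet) (h : G.HalfEdge) : G.EdgeSet :=
  ⟨{x | x ∈ D.1 ∧ x ≠ h ∧ x ≠ G.flip h}, by
    rintro x ⟨h1, h2, h3⟩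
    refine ⟨⟨(D.2 x h1).1, ?_, ?_⟩, (D.2 x h1).2⟩
    · rintro rfl
      exact h3 (G.flip_flip x).symm
    · exact fun hx => h2 (G.flip.injective hx)⟩

theorem edgesExcept_cutOutside (D : G.EdgeSet) {h : G.HalfEdge} (hh : h ∈ D.1) :
    (G.cutOutside D).edgesExcept h =
      cutEdges (removeEdge D h) D (fun _ hx => hx.1) := by
  have hflip : (G.cutOutside D).flip h = G.flip h := flipOn_of_mem D hh
  refine Subtype.ext (Set.ext fun (x : G.HalfEdge) => ?_)
  change ((G.cutOutside D).flip x ≠ x ∧ x ≠ h ∧ x ≠ (G.cutOutside D).flip h) ↔ _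
  rw [hflip]
  exact and_congr_left' (flipOn_ne_iff D x)

theorem bridgeless_cutOutside_iff {D : G.EdgeSet} : (G.cutOutside D).Bridgeless ↔
    ∀ h ∈ D.1, (G.cutOutside (removeEdge D h)).connSetoid h (G.flip h) := by
  refine forall_congr' fun (h : G.HalfEdge) =>
    (imp_congr_left (flipOn_ne_iff D h)).trans (forall_congr' fun hh => ?_)
  have hcut : ((G.cutOutside D).cutOutside ((G.cutOutside D).edgesExcept h)).connSetoid =
      (G.cutOutside (removeEdge D h)).connSetoid := by
    rw [edgesExcept_cutOutside D hh]
    exact connSetoid_eq_of_rot_eq_of_flip_eq rfl (flipOn_cutEdges _ D _)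
  rw [hcut, show (G.cutOutside D).flip h = G.flip h from flipOn_of_mem D hh]
  rfl

/-- Every component has external edges, and they all lie on one face. -/
def OneBrokenFace (G : RibbonGraph) : Prop :=
  (∀ x y, G.flip x = x → G.flip y = y → G.connSetoid x y → (G.rot * G.flip).SameCycle x y) ∧
    ∀ x, ∃ y, G.flip y = y ∧ G.connSetoid x y

/-! ### Contraction -/

theorem contract_rot_returns (D : G.EdgeSet) (x : (G.contract D).HalfEdge) :
    Returns (G.rot * G.flipOn D) (D.1)ᶜ x.1 ((G.contract D).rot x).1 :=
  returns_perm _ _ x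

theorem contract_face_returns (D : G.EdgeSet) (x : (G.contract D).HalfEdge) :
    Returns (G.rot * G.flip) (D.1)ᶜ x.1 ((G.contract D).rot ((G.contract D).flip x)).1 := by
  refine (contract_rot_returns D ((G.contract D).flip x)).congr (fun z hz => ?_) ?_
  · rw [Equiv.Perm.mul_apply, flipOn_of_mem D (not_not.1 hz)]
    rfl
  · rw [Equiv.Perm.mul_apply, flipOn_of_notMem D ((G.contract D).flip x).2]
    rfl

theorem contract_sameCycle_rot (D : G.EdgeSet) (x y : (G.contract D).HalfEdge) :
    (G.contract D).rot.SameCycle x y ↔ (G.rot * G.flipOn D).SameCycle x.1 y.1 :=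
  sameCycle_perm _ _ x y

theorem contract_sameCycle_face (D : G.EdgeSet) (x y : (G.contract D).HalfEdge) :
    ((G.contract D).rot * (G.contract D).flip).SameCycle x y ↔
      (G.rot * G.flip).SameCycle x.1 y.1 := by
  have hface : (G.contract D).rot * (G.contract D).flip = perm (G.rot * G.flip) (D.1)ᶜ :=
    Equiv.ext fun z => Subtype.ext ((contract_face_returns D z).unique (returns_perm _ _ z))
  rw [hface]
  exact sameCycle_perm _ _ x y

theorem conn_of_conn_contract (D : G.EdgeSet) {x y : (G.contract D).HalfEdge}
    (h : (G.contract D).connSetoid x y) : G.connSetoid x.1 y.1 := by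
  refine connSetoid_le (G := G.contract D) (r := G.connSetoid.comap Subtype.val) (fun z => ?_)
    (fun z => G.connSetoid_flip z.1) h
  exact conn_of_conn_cutOutside (D := D) (conn_of_sameCycle_face (G := G.cutOutside D)
    (contract_rot_returns D z).sameCycle)

theorem conn_contract_iff {D : G.EdgeSet} (hD : (G.cutOutside D).OneBrokenFace)
    (x y : (G.contract D).HalfEdge) :
    (G.contract D).connSetoid x y ↔ G.connSetoid x.1 y.1 := by
  refine ⟨conn_of_conn_contract D, fun h => ?_⟩
  let A : Set G.HalfEdge := {h | ∃ z : (G.contract D).HalfEdge,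
    (G.contract D).connSetoid x z ∧ (G.cutOutside D).connSetoid z.1 h}
  have conn_of_mem (z : (G.contract D).HalfEdge) : z.1 ∈ A → (G.contract D).connSetoid x z := by
    rintro ⟨w, hw, hwz⟩
    refine Setoid.trans' _ hw (conn_of_sameCycle_rot ((contract_sameCycle_rot D w z).2 ?_))
    exact hD.1 _ _ (flipOn_of_notMem D w.2) (flipOn_of_notMem D z.2) hwz
  have hrot : Set.MapsTo G.rot A A := fun z ⟨w, hw, hwz⟩ =>
    ⟨w, hw, Setoid.trans' _ hwz ((G.cutOutside D).connSetoid_rot z)⟩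
  have hflip : Set.MapsTo G.flip A A := by
    intro z hz
    by_cases hzD : z ∈ D.1
    · obtain ⟨w, hw, hwz⟩ := hz
      exact ⟨w, hw, Setoid.trans' _ hwz (conn_cutOutside_flip hzD)⟩
    · exact ⟨(G.contract D).flip ⟨z, hzD⟩,
        Setoid.trans' _ (conn_of_mem ⟨z, hzD⟩ hz) ((G.contract D).connSetoid_flip _),
        Setoid.refl' _ _⟩
  exact conn_of_mem y ((mem_iff_of_conn hrot hflip h).1 ⟨x, Setoid.refl' _ x, Setoid.refl' _ x.1⟩)

/-- The edges of `D'` that survive the contraction of `D`. -/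
def contractEdges (D D' : G.EdgeSet) : (G.contract D).EdgeSet :=
  ⟨{x | x.1 ∈ D'.1}, fun x hx =>
    ⟨(G.flip_mem_iff D' x.1).2 hx, fun h => (D'.2 _ hx).2 (congrArg Subtype.val h)⟩⟩

theorem contract_rot_cutOutside (D D' : G.EdgeSet) (h : D.1 ⊆ D'.1) :
    ((G.cutOutside D').contract (cutEdges D D' h)).rot = (G.contract D).rot :=
  congrArg (fun t : Equiv.Perm G.HalfEdge => perm (G.rot * t) (D.1)ᶜ) (flipOn_cutEdges D D' h)

theorem contract_flip_cutOutside (D D' : G.EdgeSet) (h : D.1 ⊆ D'.1) :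
    ((G.cutOutside D').contract (cutEdges D D' h)).flip =
      (G.contract D).flipOn (contractEdges D D') := by
  refine Equiv.ext fun (x : (G.contract D).HalfEdge) => Subtype.ext ?_
  by_cases hx : x.1 ∈ D'.1
  · exact (flipOn_of_mem D' hx).trans (congrArg Subtype.val
      (flipOn_of_mem (G := G.contract D) (contractEdges D D') hx)).symm
  · exact (flipOn_of_notMem D' hx).trans (congrArg Subtype.val
      (flipOn_of_notMem (G := G.contract D) (contractEdges D D') hx)).symm

theorem contract_cutOutside (D D' : G.EdgeSet) (h : D.1 ⊆ D'.1) :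
    (G.cutOutside D').contract (cutEdges D D' h) =
      (G.contract D).cutOutside (contractEdges D D') :=
  eq_of_rot_eq_of_flip_eq (contract_rot_cutOutside D D' h) (contract_flip_cutOutside D D' h)

theorem conn_contract_cutOutside_iff {D : G.EdgeSet} (hD : (G.cutOutside D).OneBrokenFace)
    {D' : G.EdgeSet} (h : D.1 ⊆ D'.1) (x y : (G.contract D).HalfEdge) :
    ((G.contract D).cutOutside (contractEdges D D')).connSetoid x y ↔
      (G.cutOutside D').connSetoid x.1 y.1 := by
  have hcut : ((G.cutOutside D').contract (cutEdges D D' h)).connSetoid =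
      ((G.contract D).cutOutside (contractEdges D D')).connSetoid :=
    connSetoid_eq_of_rot_eq_of_flip_eq (contract_rot_cutOutside D D' h)
      (contract_flip_cutOutside D D' h)
  rw [← hcut]
  exact conn_contract_iff (G := G.cutOutside D') (D := cutEdges D D' h)
    (by rwa [cutOutside_cutEdges]) x y

/-! ### Chains of bivalent vertices -/

theorem crossBivalent_of_mem {h : G.HalfEdge} (hh : h ∈ G.bivalent) :
    G.crossBivalent h = G.rot h := if_pos hh

theorem crossBivalent_of_notMem {h : G.HalfEdge} (hh : h ∉ G.bivalent) :
    G.crossBivalent h = h := if_neg hh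

theorem crossBivalent_involutive (G : RibbonGraph) : Function.Involutive G.crossBivalent :=
  G.crossBivalent.left_inv

theorem crossBivalent_mem_bivalent (h : G.HalfEdge) :
    G.crossBivalent h ∈ G.bivalent ↔ h ∈ G.bivalent := by
  by_cases hh : h ∈ G.bivalent
  · rw [crossBivalent_of_mem hh, G.rot_mem_bivalent]
  · rw [crossBivalent_of_notMem hh]

/-- The graph whose components are the maximal chains of edges that pass through vertices of
valence two. -/
def chainGraph (G : RibbonGraph) : RibbonGraph where
  HalfEdge := G.HalfEdge
  finite := G.finite
  rot := G.crossBivalent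
  flip := G.flip
  flip_flip := G.flip_flip

/-- Two half-edges belong to the same chain. -/
def chain (G : RibbonGraph) : Setoid G.HalfEdge := G.chainGraph.connSetoid

theorem chain_cross (h : G.HalfEdge) : G.chain h (G.crossBivalent h) :=
  G.chainGraph.connSetoid_rot h

theorem chain_flip (h : G.HalfEdge) : G.chain h (G.flip h) := G.chainGraph.connSetoid_flip h

theorem chain_rot {h : G.HalfEdge} (hh : h ∈ G.bivalent) : G.chain h (G.rot h) := by
  rw [← crossBivalent_of_mem hh]
  exact chain_cross h

theorem mem_iff_of_chain {A : Set G.HalfEdge} (hr : Set.MapsTo G.crossBivalent A A)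
    (hf : Set.MapsTo G.flip A A) {x y : G.HalfEdge} (h : G.chain x y) : x ∈ A ↔ y ∈ A :=
  mem_iff_of_conn (G := G.chainGraph) hr hf h

theorem conn_of_chain {x y : G.HalfEdge} (h : G.chain x y) : G.connSetoid x y := by
  refine connSetoid_le (G := G.chainGraph) (r := G.connSetoid) (fun z => ?_) G.connSetoid_flip h
  change G.connSetoid z (G.crossBivalent z)
  by_cases hz : z ∈ G.bivalent
  · rw [crossBivalent_of_mem hz]
    exact G.connSetoid_rot z
  · rw [crossBivalent_of_notMem hz]
    exact Setoid.refl' _ z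

theorem erase_flip_returns (x : G.eraseBivalent.HalfEdge) :
    Returns (G.flip * G.crossBivalent) (G.bivalent)ᶜ x.1 (G.eraseBivalent.flip x).1 :=
  returns_perm _ _ x

theorem erase_flip_eq_of_flip_eq {x : G.eraseBivalent.HalfEdge} (hx : G.flip x.1 = x.1) :
    G.eraseBivalent.flip x = x := by
  have happly : (G.flip * G.crossBivalent) x.1 = x.1 := by
    rw [Equiv.Perm.mul_apply, crossBivalent_of_notMem x.2, hx]
  exact Subtype.ext ((erase_flip_returns x).unique (.of_apply_eq happly x.2))

theorem erase_sameCycle_rot (x y : G.eraseBivalent.HalfEdge) :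
    G.eraseBivalent.rot.SameCycle x y ↔ G.rot.SameCycle x.1 y.1 :=
  Equiv.Perm.sameCycle_subtypePerm (f := G.rot)
    (h := fun h => not_congr (G.rot_mem_bivalent h))

-- At a bivalent vertex, going on along the chain and going on along the face are the same move.
theorem face_returns_of_chain_returns {x y : G.HalfEdge}
    (h : Returns (G.flip * G.crossBivalent) (G.bivalent)ᶜ x y) :
    Returns (G.rot * G.flip) (G.bivalent)ᶜ (G.crossBivalent x) (G.rot y) := by
  induction h with
  | of_mem hx => exact .of_mem fun hmem => hx ((G.rot_mem_bivalent _).1 hmem)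
  | @of_notMem x _ hx _ ih =>
    have hbiv : (G.flip * G.crossBivalent) x ∈ G.bivalent := not_not.1 hx
    have hmove : G.crossBivalent ((G.flip * G.crossBivalent) x) =
        (G.rot * G.flip) (G.crossBivalent x) := crossBivalent_of_mem hbiv
    rw [hmove] at ih
    refine .of_notMem (not_not.2 ?_) ih
    rw [← hmove]
    exact (crossBivalent_mem_bivalent _).2 hbiv

theorem erase_face_returns (x : G.eraseBivalent.HalfEdge) :
    Returns (G.rot * G.flip) (G.bivalent)ᶜ x.1
      (G.eraseBivalent.rot (G.eraseBivalent.flip x)).1 := by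
  have := face_returns_of_chain_returns (erase_flip_returns x)
  rwa [crossBivalent_of_notMem x.2] at this

theorem erase_sameCycle_face (x y : G.eraseBivalent.HalfEdge) :
    (G.eraseBivalent.rot * G.eraseBivalent.flip).SameCycle x y ↔
      (G.rot * G.flip).SameCycle x.1 y.1 := by
  have hface : G.eraseBivalent.rot * G.eraseBivalent.flip = perm (G.rot * G.flip) (G.bivalent)ᶜ :=
    Equiv.ext fun z => Subtype.ext ((erase_face_returns z).unique (returns_perm _ _ z))
  rw [hface]
  exact sameCycle_perm _ _ x y

theorem chain_erase_flip (x : G.eraseBivalent.HalfEdge) :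
    G.chain x.1 (G.eraseBivalent.flip x).1 :=
  (mem_iff_of_sameCycle (A := {z | G.chain x.1 z}) (fun z hz =>
    Setoid.trans' _ hz (Setoid.trans' _ (chain_cross z) (chain_flip _)))
    (erase_flip_returns x).sameCycle).1 (G.chain.refl x.1)

-- A chain has at most two ends.
theorem eq_or_eq_flip_of_chain {x y : G.eraseBivalent.HalfEdge} (h : G.chain x.1 y.1) :
    y = x ∨ y = G.eraseBivalent.flip x := by
  let t := G.flip * G.crossBivalent
  let A : Set G.HalfEdge := {h | t.SameCycle x.1 h ∨ t.SameCycle x.1 (G.crossBivalent h)}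
  have hcross : Set.MapsTo G.crossBivalent A A := by
    rintro z (hz | hz)
    · exact Or.inr (by rwa [G.crossBivalent_involutive])
    · exact Or.inl hz
  have hflip : Set.MapsTo G.flip A A := by
    rintro z (hz | hz)
    · have hback : t (G.crossBivalent (G.flip z)) = z := by
        rw [Equiv.Perm.mul_apply, G.crossBivalent_involutive, G.flip_flip]
      exact Or.inr (hz.trans (Equiv.Perm.SameCycle.symm ⟨1, by rwa [zpow_one]⟩))
    · have hstep : t (G.crossBivalent z) = G.flip z := by
        rw [Equiv.Perm.mul_apply, G.crossBivalent_involutive]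
      exact Or.inl (hz.trans ⟨1, by rwa [zpow_one]⟩)
  have hxy : t.SameCycle x.1 y.1 := by
    rcases (mem_iff_of_chain hcross hflip h).1 (Or.inl (.refl _ _)) with hy | hy
    · exact hy
    · rwa [crossBivalent_of_notMem y.2] at hy
  refine (mem_iff_of_sameCycle (A := {z | z = x ∨ z = G.eraseBivalent.flip x}) ?_
    ((sameCycle_perm t (G.bivalent)ᶜ x y).2 hxy)).1 (Or.inl rfl)
  rintro z (rfl | rfl)
  · exact Or.inr rfl
  · exact Or.inl (G.eraseBivalent.flip_flip x)

theorem conn_erase_iff (x y : G.eraseBivalent.HalfEdge) :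
    G.eraseBivalent.connSetoid x y ↔ G.connSetoid x.1 y.1 := by
  refine ⟨fun h => connSetoid_le (G := G.eraseBivalent) (r := G.connSetoid.comap Subtype.val)
    (fun z => G.connSetoid_rot z.1) (fun z => conn_of_chain (chain_erase_flip z)) h, fun h => ?_⟩
  let A : Set G.HalfEdge := {h | ∃ z : G.eraseBivalent.HalfEdge,
    G.eraseBivalent.connSetoid x z ∧ G.chain z.1 h}
  have conn_of_mem (z : G.eraseBivalent.HalfEdge) : z.1 ∈ A → G.eraseBivalent.connSetoid x z := by
    rintro ⟨w, hw, hwz⟩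
    rcases eq_or_eq_flip_of_chain hwz with rfl | rfl
    · exact hw
    · exact Setoid.trans' _ hw (G.eraseBivalent.connSetoid_flip w)
  have hrot : Set.MapsTo G.rot A A := by
    intro z hz
    by_cases hzb : z ∈ G.bivalent
    · obtain ⟨w, hw, hwz⟩ := hz
      exact ⟨w, hw, Setoid.trans' _ hwz (chain_rot hzb)⟩
    · exact ⟨G.eraseBivalent.rot ⟨z, hzb⟩, Setoid.trans' _ (conn_of_mem ⟨z, hzb⟩ hz)
        (G.eraseBivalent.connSetoid_rot _), Setoid.refl' _ _⟩
  have hflip : Set.MapsTo G.flip A A := fun z ⟨w, hw, hwz⟩ =>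
    ⟨w, hw, Setoid.trans' _ hwz (chain_flip z)⟩
  exact conn_of_mem y ((mem_iff_of_conn hrot hflip h).1 ⟨x, Setoid.refl' _ x, Setoid.refl' _ x.1⟩)

-- A chain with one end only contains an external edge.
theorem exists_external_of_erase_flip_eq {x : G.eraseBivalent.HalfEdge}
    (hx : G.eraseBivalent.flip x = x) : ∃ z, G.chain x.1 z ∧ G.flip z = z := by
  let C : Set G.HalfEdge := {z | G.chain x.1 z}
  have bivalent_of_mem : ∀ z ∈ C \ {x.1}, z ∈ G.bivalent := by
    rintro z ⟨hz, hzx⟩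
    by_contra hzb
    have hend := eq_or_eq_flip_of_chain (y := ⟨z, hzb⟩) hz
    rw [hx, or_self] at hend
    exact hzx (congrArg Subtype.val hend)
  have hcross : Set.MapsTo G.crossBivalent (C \ {x.1}) (C \ {x.1}) := by
    refine fun z hz => ⟨Setoid.trans' _ hz.1 (chain_cross z), fun hzx => x.2 ?_⟩
    rw [← show G.crossBivalent z = x.1 from hzx, crossBivalent_mem_bivalent]
    exact bivalent_of_mem z hz
  rcases exists_apply_eq_self_of_involutive G.flip_flip G.crossBivalent_involutive
    (G.chain.refl x.1) (fun z hz => Setoid.trans' _ hz (chain_flip z)) hcross with h | ⟨z, hz, hzz⟩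
  · exact h
  · rw [crossBivalent_of_mem (bivalent_of_mem z hz)] at hzz
    exact absurd hzz (bivalent_of_mem z hz).1

-- In a connected graph, each chain has an end, unless all vertices have valence two.
theorem exists_chain_of_conn {h : G.HalfEdge} (y : G.eraseBivalent.HalfEdge)
    (hy : G.connSetoid h y.1) : ∃ x : G.eraseBivalent.HalfEdge, G.chain h x.1 := by
  by_contra! hcon
  have bivalent_of_chain (z : G.HalfEdge) (hz : G.chain h z) : z ∈ G.bivalent := by
    by_contra hzb
    exact hcon ⟨z, hzb⟩ hz
  exact hcon y ((mem_iff_of_conn (A := {z | G.chain h z})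
    (fun z hz => Setoid.trans' _ hz (chain_rot (bivalent_of_chain z hz)))
    (fun z hz => Setoid.trans' _ hz (chain_flip z)) hy).1 (G.chain.refl h))

/-- A set of edges that contains both or none of the edges at a vertex of valence two. -/
def Saturated (E : G.EdgeSet) : Prop := ∀ b ∈ G.bivalent, b ∈ E.1 → G.rot b ∈ E.1

theorem Saturated.cross_mem {E : G.EdgeSet} (hE : Saturated E) {b : G.HalfEdge} (hb : b ∈ E.1) :
    G.crossBivalent b ∈ E.1 := by
  by_cases h : b ∈ G.bivalent
  · rw [crossBivalent_of_mem h]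
    exact hE b h hb
  · rwa [crossBivalent_of_notMem h]

theorem Saturated.mem_iff_of_chain {E : G.EdgeSet} (hE : Saturated E) {x y : G.HalfEdge}
    (h : G.chain x y) : x ∈ E.1 ↔ y ∈ E.1 :=
  RibbonGraph.mem_iff_of_chain (fun _ hz => hE.cross_mem hz) (fun z hz => (E.2 z hz).1) h

/-- The edges that a saturated edge set leaves after erasing the vertices of valence two. -/
def eraseEdges (E : G.EdgeSet) : G.eraseBivalent.EdgeSet :=
  ⟨{x | x.1 ∈ E.1 ∧ (G.eraseBivalent.flip x).1 ∈ E.1 ∧ G.eraseBivalent.flip x ≠ x}, by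
    rintro x ⟨h1, h2, h3⟩
    refine ⟨⟨h2, ?_, ?_⟩, h3⟩
    · rwa [G.eraseBivalent.flip_flip]
    · rw [G.eraseBivalent.flip_flip]
      exact h3.symm⟩

theorem Saturated.mem_eraseEdges {E : G.EdgeSet} (hE : Saturated E)
    (x : G.eraseBivalent.HalfEdge) : x ∈ (eraseEdges E).1 ↔ x.1 ∈ E.1 := by
  refine ⟨fun h => h.1, fun h => ⟨h, (hE.mem_iff_of_chain (chain_erase_flip x)).1 h, fun hx => ?_⟩⟩
  obtain ⟨z, hz, hzf⟩ := exists_external_of_erase_flip_eq hx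
  exact (E.2 z ((hE.mem_iff_of_chain hz).1 h)).2 hzf

theorem erase_flip_cutOutside {E : G.EdgeSet} (hE : Saturated E) :
    (G.cutOutside E).eraseBivalent.flip = G.eraseBivalent.flipOn (eraseEdges E) := by
  refine Equiv.ext fun (x : G.eraseBivalent.HalfEdge) => ?_
  by_cases hx : x ∈ (eraseEdges E).1
  · have hEq : Set.EqOn (G.flip * G.crossBivalent) (G.flipOn E * G.crossBivalent) E.1 :=
      fun z hz => (flipOn_of_mem E (hE.cross_mem hz)).symm
    have hmaps : Set.MapsTo (G.flip * G.crossBivalent) E.1 E.1 :=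
      fun z hz => (G.flip_mem_iff E _).2 (hE.cross_mem hz)
    refine Eq.trans (Subtype.ext ?_) (flipOn_of_mem (eraseEdges E) hx).symm
    exact (erase_flip_returns (G := G.cutOutside E) x).unique
      ((erase_flip_returns x).congr_of_mapsTo hmaps hEq hx.1)
  · have hxE : x.1 ∉ E.1 := fun h => hx ((hE.mem_eraseEdges x).2 h)
    exact (erase_flip_eq_of_flip_eq (G := G.cutOutside E) (x := x) (flipOn_of_notMem E hxE)).trans
      (flipOn_of_notMem (eraseEdges E) hx).symm

theorem erase_cutOutside {E : G.EdgeSet} (hE : Saturated E) :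
    (G.cutOutside E).eraseBivalent = G.eraseBivalent.cutOutside (eraseEdges E) :=
  eq_of_rot_eq_of_flip_eq rfl (erase_flip_cutOutside hE)

theorem conn_erase_cutOutside_iff {E : G.EdgeSet} (hE : Saturated E)
    (x y : G.eraseBivalent.HalfEdge) :
    (G.eraseBivalent.cutOutside (eraseEdges E)).connSetoid x y ↔
      (G.cutOutside E).connSetoid x.1 y.1 := by
  have hcut : (G.cutOutside E).eraseBivalent.connSetoid =
      (G.eraseBivalent.cutOutside (eraseEdges E)).connSetoid :=
    connSetoid_eq_of_rot_eq_of_flip_eq rfl (erase_flip_cutOutside hE)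
  rw [← hcut]
  exact conn_erase_iff (G := G.cutOutside E) x y

/-- No vertex of valence two joins an external and an internal edge. -/
def NoHalfExternal (G : RibbonGraph) : Prop :=
  ∀ b ∈ G.bivalent, G.flip b = b → G.flip (G.rot b) = G.rot b

theorem NoHalfExternal.flip_rot_eq_iff (hG : G.NoHalfExternal) {b : G.HalfEdge}
    (hb : b ∈ G.bivalent) : G.flip (G.rot b) = G.rot b ↔ G.flip b = b := by
  refine ⟨fun h => ?_, hG b hb⟩
  have := hG (G.rot b) ((G.rot_mem_bivalent b).2 hb) h
  rwa [show G.rot (G.rot b) = b from hb.2] at this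

theorem NoHalfExternal.bivalent_of_chain (hG : G.NoHalfExternal) {b x : G.HalfEdge}
    (hb : b ∈ G.bivalent) (hf : G.flip b = b) (h : G.chain b x) : x ∈ G.bivalent := by
  let A : Set G.HalfEdge := {z | z = b ∨ z = G.rot b}
  have hcross : Set.MapsTo G.crossBivalent A A := by
    rintro z (rfl | rfl)
    · exact Or.inr (crossBivalent_of_mem hb)
    · left
      rw [crossBivalent_of_mem ((G.rot_mem_bivalent b).2 hb)]
      exact hb.2
  have hflip : Set.MapsTo G.flip A A := by
    rintro z (rfl | rfl)
    · exact Or.inl hf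
    · exact Or.inr (hG b hb hf)
  rcases (mem_iff_of_chain hcross hflip h).1 (Or.inl rfl) with rfl | rfl
  · exact hb
  · exact (G.rot_mem_bivalent b).2 hb

theorem NoHalfExternal.erase_flip_eq_iff (hG : G.NoHalfExternal) (x : G.eraseBivalent.HalfEdge) :
    G.eraseBivalent.flip x = x ↔ G.flip x.1 = x.1 := by
  refine ⟨fun hx => ?_, erase_flip_eq_of_flip_eq⟩
  obtain ⟨z, hz, hzf⟩ := exists_external_of_erase_flip_eq hx
  have hzb : z ∉ G.bivalent := fun hzb =>
    x.2 (hG.bivalent_of_chain hzb hzf (Setoid.symm' _ hz))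
  have hzx := eq_or_eq_flip_of_chain (y := ⟨z, hzb⟩) hz
  rw [hx, or_self] at hzx
  rwa [← hzx]

theorem Saturated.noHalfExternal_cutOutside {E : G.EdgeSet} (hE : Saturated E) :
    (G.cutOutside E).NoHalfExternal := by
  intro b hb hf
  have hbE : b ∉ E.1 := (flipOn_eq_iff E b).1 hf
  refine (flipOn_eq_iff E (G.rot b)).2 fun h => hbE ?_
  have := hE (G.rot b) ((G.rot_mem_bivalent b).2 hb) h
  rwa [show G.rot (G.rot b) = b from hb.2] at this

/-- The edges whose chain belongs to `E`. -/
def liftEdges (hG : G.NoHalfExternal) (E : G.eraseBivalent.EdgeSet) : G.EdgeSet :=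
  ⟨{h | ∃ y ∈ E.1, G.chain y.1 h}, by
    rintro h ⟨y, hy, hyh⟩
    refine ⟨⟨y, hy, Setoid.trans' _ hyh (chain_flip h)⟩, fun hf => ?_⟩
    by_cases hb : h ∈ G.bivalent
    · exact y.2 (hG.bivalent_of_chain hb hf (Setoid.symm' _ hyh))
    · have hE : (⟨h, hb⟩ : G.eraseBivalent.HalfEdge) ∈ E.1 := by
        rcases eq_or_eq_flip_of_chain (y := ⟨h, hb⟩) hyh with h' | h'
        · rwa [h']
        · rw [h']
          exact (E.2 y hy).1
      exact (E.2 _ hE).2 ((hG.erase_flip_eq_iff _).2 hf)⟩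

theorem saturated_liftEdges (hG : G.NoHalfExternal) (E : G.eraseBivalent.EdgeSet) :
    Saturated (liftEdges hG E) :=
  fun _ hb ⟨y, hy, hyb⟩ => ⟨y, hy, Setoid.trans' _ hyb (chain_rot hb)⟩

theorem coe_mem_liftEdges (hG : G.NoHalfExternal) (E : G.eraseBivalent.EdgeSet)
    (x : G.eraseBivalent.HalfEdge) : x.1 ∈ (liftEdges hG E).1 ↔ x ∈ E.1 := by
  refine ⟨?_, fun h => ⟨x, h, Setoid.refl' _ _⟩⟩
  rintro ⟨y, hy, hyx⟩
  rcases eq_or_eq_flip_of_chain hyx with rfl | rfl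
  · exact hy
  · exact (E.2 y hy).1

theorem eraseEdges_liftEdges (hG : G.NoHalfExternal) (E : G.eraseBivalent.EdgeSet) :
    eraseEdges (liftEdges hG E) = E :=
  Subtype.ext (Set.ext fun x => by
    rw [(saturated_liftEdges hG E).mem_eraseEdges, coe_mem_liftEdges])

/-! ### Bridges -/

/-- The internal edges that do not belong to the chain of `h`. -/
def edgesOffChain (h : G.HalfEdge) : G.EdgeSet :=
  ⟨{z | G.flip z ≠ z ∧ ¬ G.chain h z}, fun z hz =>
    ⟨⟨fun heq => hz.1 (G.flip.injective heq),
      fun hc => hz.2 (Setoid.trans' _ hc (Setoid.symm' _ (chain_flip z)))⟩, hz.1⟩⟩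

theorem NoHalfExternal.saturated_edgesOffChain (hG : G.NoHalfExternal) (h : G.HalfEdge) :
    Saturated (edgesOffChain h) := fun _ hb hbh =>
  ⟨fun hf => hbh.1 ((hG.flip_rot_eq_iff hb).1 hf),
    fun hc => hbh.2 (Setoid.trans' _ hc (Setoid.symm' _ (chain_rot hb)))⟩

theorem NoHalfExternal.eraseEdges_edgesOffChain (hG : G.NoHalfExternal)
    (x : G.eraseBivalent.HalfEdge) :
    eraseEdges (edgesOffChain x.1) = G.eraseBivalent.edgesExcept x := by
  refine Subtype.ext (Set.ext fun z => ?_)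
  rw [(hG.saturated_edgesOffChain x.1).mem_eraseEdges]
  change (G.flip z.1 ≠ z.1 ∧ ¬ G.chain x.1 z.1) ↔ (_ ∧ _ ∧ _)
  rw [ne_eq, ← hG.erase_flip_eq_iff]
  refine and_congr_right fun _ => (not_congr ⟨eq_or_eq_flip_of_chain, ?_⟩).trans not_or
  rintro (rfl | rfl)
  · exact Setoid.refl' _ _
  · exact chain_erase_flip x

theorem NoHalfExternal.conn_erase_edgesExcept_iff (hG : G.NoHalfExternal)
    (x y z : G.eraseBivalent.HalfEdge) :
    (G.eraseBivalent.cutOutside (G.eraseBivalent.edgesExcept x)).connSetoid y z ↔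
      (G.cutOutside (edgesOffChain x.1)).connSetoid y.1 z.1 := by
  rw [← hG.eraseEdges_edgesOffChain x]
  exact conn_erase_cutOutside_iff (hG.saturated_edgesOffChain x.1) y z

theorem bivalent_of_conn_edgesOffChain {h z w : G.HalfEdge} (hz : z ∈ G.bivalent)
    (hhz : G.chain h z) (hzw : (G.cutOutside (edgesOffChain h)).connSetoid z w) :
    w ∈ G.bivalent := by
  let A : Set G.HalfEdge := {w | w = z ∨ w = G.rot z}
  have hrot : Set.MapsTo (G.cutOutside (edgesOffChain h)).rot A A := by
    rintro w (rfl | rfl)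
    · exact Or.inr rfl
    · exact Or.inl hz.2
  have hflip : Set.MapsTo (G.cutOutside (edgesOffChain h)).flip A A := by
    rintro w (rfl | rfl)
    · exact Or.inl (flipOn_of_notMem _ fun hw => hw.2 hhz)
    · exact Or.inr (flipOn_of_notMem _ fun hw => hw.2 (Setoid.trans' _ hhz (chain_rot hz)))
  rcases (mem_iff_of_conn hrot hflip hzw).1 (Or.inl rfl) with rfl | rfl
  · exact hz
  · exact (G.rot_mem_bivalent z).2 hz

theorem eq_or_eq_flip_of_conn_edgesOffChain {x : G.eraseBivalent.HalfEdge} {z : G.HalfEdge}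
    (hxz : (G.cutOutside (edgesOffChain x.1)).connSetoid x.1 z) (hc : G.chain x.1 z) :
    z = x.1 ∨ z = (G.eraseBivalent.flip x).1 := by
  have hz : z ∉ G.bivalent := fun hz =>
    x.2 (bivalent_of_conn_edgesOffChain hz hc (Setoid.symm' _ hxz))
  exact (eq_or_eq_flip_of_chain (y := ⟨z, hz⟩) hc).imp
    (congrArg Subtype.val) (congrArg Subtype.val)

-- Otherwise, without the chain of `x`, its only half-edge in the component of `x` is `x` itself, so
-- that this component is connected to the rest by the edge of `x` alone, which would be a bridge.
theorem NoHalfExternal.bridgeless_erase (hG : G.NoHalfExternal) (hb : G.Bridgeless) :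
    G.eraseBivalent.Bridgeless := by
  intro x hx
  have hx' : G.flip x.1 ≠ x.1 := fun h => hx ((hG.erase_flip_eq_iff x).2 h)
  rw [hG.conn_erase_edgesExcept_iff]
  by_contra hcon
  let D := edgesOffChain x.1
  have eq_of_conn {z : G.HalfEdge} (hz : (G.cutOutside D).connSetoid x.1 z)
      (hc : G.chain x.1 z) : z = x.1 :=
    (eq_or_eq_flip_of_conn_edgesOffChain hz hc).resolve_right (by rintro rfl; exact hcon hz)
  let A : Set G.HalfEdge := {z | (G.cutOutside D).connSetoid x.1 z}
  have hflip : Set.MapsTo (G.flipOn (G.edgesExcept x.1)) A A := by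
    intro z hz
    by_cases hzE : z ∈ (G.edgesExcept x.1).1
    · rw [flipOn_of_mem _ hzE]
      have hzD : z ∈ D.1 := ⟨hzE.1, fun hc => hzE.2.1 (eq_of_conn hz hc)⟩
      exact Setoid.trans' _ hz (conn_cutOutside_flip hzD)
    · rwa [flipOn_of_notMem _ hzE]
  have hfx : (G.cutOutside D).connSetoid x.1 (G.flip x.1) :=
    (mem_iff_of_conn (G := G.cutOutside (G.edgesExcept x.1)) (A := A)
      (fun z hz => Setoid.trans' _ hz ((G.cutOutside D).connSetoid_rot z)) hflip
      (hb x.1 hx')).1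
      ((G.cutOutside D).connSetoid.refl x.1)
  exact hx' (eq_of_conn hfx (chain_flip x.1))

theorem eq_of_chain_of_flip_eq {x : G.eraseBivalent.HalfEdge} (hx : G.flip x.1 = x.1)
    {z : G.HalfEdge} (h : G.chain x.1 z) : z = x.1 := by
  refine (mem_iff_of_chain (A := {z | z = x.1}) ?_ ?_ h).1 rfl
  · rintro z rfl
    exact crossBivalent_of_notMem x.2
  · rintro z rfl
    exact hx

-- After cutting a bridge, each of its halves still reaches an end of its chain.
theorem NoHalfExternal.conn_flip_or_exists_end (hG : G.NoHalfExternal) {h : G.HalfEdge}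
    (x : G.eraseBivalent.HalfEdge) (hx : G.chain h x.1) :
    (G.cutOutside (G.edgesExcept h)).connSetoid h (G.flip h) ∨
      ∃ y : G.eraseBivalent.HalfEdge, G.chain h y.1 ∧
        (G.cutOutside (G.edgesExcept h)).connSetoid h y.1 := by
  by_contra! hcon
  obtain ⟨hbridge, hends⟩ := hcon
  let B : Set G.HalfEdge := {z | (G.cutOutside (G.edgesExcept h)).connSetoid h z ∧ G.chain h z}
  have bivalent_of_mem : ∀ z ∈ B, z ∈ G.bivalent := fun z hz => by
    by_contra hzb
    exact hends ⟨z, hzb⟩ hz.2 hz.1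
  have flip_ne : ∀ z ∈ B, G.flip z ≠ z := fun z hz hf =>
    x.2 (hG.bivalent_of_chain (bivalent_of_mem z hz) hf
      (Setoid.trans' _ (Setoid.symm' _ hz.2) hx))
  have hcross : Set.MapsTo G.crossBivalent B B := by
    intro z hz
    refine ⟨?_, Setoid.trans' _ hz.2 (chain_cross z)⟩
    rw [crossBivalent_of_mem (bivalent_of_mem z hz)]
    exact Setoid.trans' _ hz.1 ((G.cutOutside (G.edgesExcept h)).connSetoid_rot z)
  have hflip : Set.MapsTo G.flip (B \ {h}) (B \ {h}) := by
    intro z hz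
    have hzh : z ≠ G.flip h := by
      rintro rfl
      exact hbridge hz.1.1
    have hzE : z ∈ (G.edgesExcept h).1 := ⟨flip_ne z hz.1, hz.2, hzh⟩
    refine ⟨⟨Setoid.trans' _ hz.1.1 (conn_cutOutside_flip hzE),
      Setoid.trans' _ hz.1.2 (chain_flip z)⟩, fun hz' => hzh ?_⟩
    rw [← show G.flip z = h from hz', G.flip_flip]
  have hB : h ∈ B := ⟨Setoid.refl' _ h, Setoid.refl' _ h⟩
  rcases exists_apply_eq_self_of_involutive G.crossBivalent_involutive G.flip_flip
    hB hcross hflip with ⟨z, hz, hzz⟩ | ⟨z, hz, hzz⟩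
  · rw [crossBivalent_of_mem (bivalent_of_mem z hz)] at hzz
    exact (bivalent_of_mem z hz).1 hzz
  · exact flip_ne z hz.1 hzz

theorem NoHalfExternal.erase_flip_ne (hG : G.NoHalfExternal) {h : G.HalfEdge}
    (hh : G.flip h ≠ h) {x : G.eraseBivalent.HalfEdge} (hx : G.chain h x.1) :
    G.eraseBivalent.flip x ≠ x := by
  intro hf
  have hf' := (hG.erase_flip_eq_iff x).1 hf
  rw [eq_of_chain_of_flip_eq hf' (Setoid.symm' _ hx)] at hh
  exact hh hf'

theorem NoHalfExternal.bridgeless_of_erase (hG : G.NoHalfExternal)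
    (hb : G.eraseBivalent.Bridgeless)
    (hends : ∀ h, G.flip h ≠ h → ∃ x : G.eraseBivalent.HalfEdge, G.chain h x.1) :
    G.Bridgeless := by
  intro h hh
  obtain ⟨x, hx⟩ := hends h hh
  have hfx : G.eraseBivalent.flip x ≠ x := hG.erase_flip_ne hh hx
  let R := (G.cutOutside (G.edgesExcept h)).connSetoid
  have hRx : R x.1 (G.eraseBivalent.flip x).1 := by
    refine conn_cutOutside_mono (D := G.edgesOffChain x.1) (D' := G.edgesExcept h)
      (fun z hz => ⟨hz.1, ?_, ?_⟩) ((hG.conn_erase_edgesExcept_iff x _ _).1 (hb x hfx))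
    · rintro rfl
      exact hz.2 (Setoid.symm' _ hx)
    · rintro rfl
      exact hz.2 (Setoid.trans' _ (Setoid.symm' _ hx) (chain_flip h))
  have conn_of_chain {y : G.eraseBivalent.HalfEdge} (hy : G.chain h y.1) : R x.1 y.1 := by
    rcases eq_or_eq_flip_of_chain (Setoid.trans' _ (Setoid.symm' _ hx) hy) with rfl | rfl
    · exact Setoid.refl' _ _
    · exact hRx
  have hother := hG.conn_flip_or_exists_end x (Setoid.trans' _ (Setoid.symm' _ (chain_flip h)) hx)
  rw [G.flip_flip, edgesExcept_flip] at hother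
  rcases hG.conn_flip_or_exists_end x hx with h1 | ⟨y, hy, hRy⟩
  · exact h1
  rcases hother with h2 | ⟨z, hz, hRz⟩
  · exact Setoid.symm' _ h2
  have hRyz : R y.1 z.1 := Setoid.trans' _ (Setoid.symm' _ (conn_of_chain hy))
    (conn_of_chain (Setoid.trans' _ (chain_flip h) hz))
  exact Setoid.trans' _ hRy (Setoid.trans' _ hRyz (Setoid.symm' _ hRz))

theorem contractEdges_edgesExcept (D : G.EdgeSet) (x : (G.contract D).HalfEdge) :
    contractEdges D (G.edgesExcept x.1) = (G.contract D).edgesExcept x := by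
  refine Subtype.ext (Set.ext fun z => ?_)
  exact and_congr (not_congr (Subtype.ext_iff (a1 := (G.contract D).flip z) (a2 := z)).symm)
    (and_congr (not_congr Subtype.ext_iff.symm)
      (not_congr (Subtype.ext_iff (a1 := z) (a2 := (G.contract D).flip x)).symm))

theorem conn_contract_edgesExcept_iff {D : G.EdgeSet} (hD : (G.cutOutside D).OneBrokenFace)
    (x y z : (G.contract D).HalfEdge) :
    ((G.contract D).cutOutside ((G.contract D).edgesExcept x)).connSetoid y z ↔
      (G.cutOutside (G.edgesExcept x.1)).connSetoid y.1 z.1 := by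
  have hsub : D.1 ⊆ (G.edgesExcept x.1).1 := fun z hz => ⟨(D.2 z hz).2, fun h => x.2 (h ▸ hz),
    fun h => x.2 ((G.flip_mem_iff D x.1).1 (h ▸ hz))⟩
  rw [← contractEdges_edgesExcept]
  exact conn_contract_cutOutside_iff hD hsub y z

theorem bridgeless_contract_iff {D : G.EdgeSet} (hD : (G.cutOutside D).OneBrokenFace)
    (hDb : (G.cutOutside D).Bridgeless) : (G.contract D).Bridgeless ↔ G.Bridgeless := by
  constructor
  · intro hb h hh
    by_cases hhD : h ∈ D.1
    · exact conn_cutOutside_mono (D := removeEdge D h) (D' := G.edgesExcept h)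
        (fun z hz => ⟨(D.2 z hz.1).2, hz.2⟩) (bridgeless_cutOutside_iff.1 hDb h hhD)
    · exact (conn_contract_edgesExcept_iff hD ⟨h, hhD⟩ _ _).1
        (hb _ fun h' => hh (congrArg Subtype.val h'))
  · intro hb x hx
    exact (conn_contract_edgesExcept_iff hD x _ _).2 (hb x.1 fun h => hx (Subtype.ext h))

end RibbonGraph

theorem sameCycle_iff_of_semiconj {X Y : Type*} {p : Equiv.Perm X} {q : Equiv.Perm Y}
    {i : X → Y} (hi : Function.Injective i) (h : Function.Semiconj i p q) (x y : X) :
    p.SameCycle x y ↔ q.SameCycle (i x) (i y) := by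
  have hpow (n : ℕ) (z : X) : i ((p ^ n) z) = (q ^ n) (i z) := by
    simpa only [Equiv.Perm.iterate_eq_pow] using h.iterate_right n z
  have hzpow (n : ℤ) : i ((p ^ n) x) = (q ^ n) (i x) := by
    cases n with
    | ofNat n => exact hpow n x
    | negSucc n =>
      rw [zpow_negSucc, zpow_negSucc, Equiv.Perm.eq_inv_iff_eq, ← hpow, ← Equiv.Perm.mul_apply,
        mul_inv_cancel, Equiv.Perm.one_apply]
  exact exists_congr fun n => by rw [← hzpow, hi.eq_iff]

namespace RibbonGraph

variable {A B G G' : RibbonGraph}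

open FirstReturn

/-! ### Embeddings -/

/-- An embedding of ribbon surfaces: an injective map of half-edges compatible with the involutions,
which preserves or reverses all the cyclic orderings. Its range is a union of components. -/
structure Emb (B A : RibbonGraph) where
  toFun : B.HalfEdge → A.HalfEdge
  injective : Function.Injective toFun
  map_flip : ∀ x, toFun (B.flip x) = A.flip (toFun x)
  map_rot : (∀ x, toFun (B.rot x) = A.rot (toFun x)) ∨
    ∀ x, toFun (B.rot x) = A.rot.symm (toFun x)

namespace Emb

instance : CoeFun (Emb B A) fun _ => B.HalfEdge → A.HalfEdge := ⟨toFun⟩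

theorem flip_eq_iff (m : Emb B A) (x : B.HalfEdge) : A.flip (m x) = m x ↔ B.flip x = x := by
  rw [← m.map_flip, m.injective.eq_iff]

theorem conn_rot (m : Emb B A) (x : B.HalfEdge) : A.connSetoid (m x) (m (B.rot x)) := by
  rcases m.map_rot with h | h
  · rw [h]
    exact A.connSetoid_rot _
  · rw [h]
    simpa only [Equiv.apply_symm_apply] using
      Setoid.symm' _ (A.connSetoid_rot (A.rot.symm (m x)))

theorem exists_map_eq_rot (m : Emb B A) (x : B.HalfEdge) :
    ∃ z, m z = A.rot (m x) ∧ B.connSetoid x z := by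
  rcases m.map_rot with h | h
  · exact ⟨B.rot x, h x, B.connSetoid_rot x⟩
  · refine ⟨B.rot.symm x, ?_, ?_⟩
    · rw [← Equiv.symm_apply_eq, ← h, Equiv.apply_symm_apply]
    · simpa only [Equiv.apply_symm_apply] using Setoid.symm' _ (B.connSetoid_rot (B.rot.symm x))

theorem exists_of_conn (m : Emb B A) {x : B.HalfEdge} {y : A.HalfEdge}
    (h : A.connSetoid (m x) y) : ∃ z, m z = y ∧ B.connSetoid x z := by
  refine (mem_iff_of_conn (A := {y | ∃ z, m z = y ∧ B.connSetoid x z}) ?_ ?_ h).1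
    ⟨x, rfl, B.connSetoid.refl x⟩
  · rintro _ ⟨z, rfl, hz⟩
    obtain ⟨w, hw, hzw⟩ := m.exists_map_eq_rot z
    exact ⟨w, hw, Setoid.trans' _ hz hzw⟩
  · rintro _ ⟨z, rfl, hz⟩
    exact ⟨B.flip z, m.map_flip z, Setoid.trans' _ hz (B.connSetoid_flip z)⟩

theorem conn_iff (m : Emb B A) (x y : B.HalfEdge) :
    B.connSetoid x y ↔ A.connSetoid (m x) (m y) := by
  constructor
  · refine fun h => connSetoid_le (G := B) (r := A.connSetoid.comap m) m.conn_rot (fun z => ?_) h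
    change A.connSetoid (m z) (m (B.flip z))
    rw [m.map_flip]
    exact A.connSetoid_flip _
  · intro h
    obtain ⟨z, hz, hxz⟩ := m.exists_of_conn h
    rwa [← m.injective hz]

theorem isConnected (m : Emb B A) (hm : Function.Surjective m) (h : B.IsConnected) :
    A.IsConnected := by
  refine ⟨h.1.map m, fun a b => ?_⟩
  obtain ⟨x, rfl⟩ := hm a
  obtain ⟨y, rfl⟩ := hm b
  exact (m.conn_iff x y).1 (h.2 x y)

theorem isomorphic_of_surjective (m : Emb B A) (hs : Function.Surjective m) : Isomorphic B A :=
  ⟨Equiv.ofBijective m ⟨m.injective, hs⟩, m.map_flip, m.map_rot⟩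

theorem isomorphic_of_isConnected (m : Emb B A) (hB : B.IsConnected) (hA : A.IsConnected) :
    Isomorphic B A := by
  obtain ⟨b⟩ := hB.1
  exact m.isomorphic_of_surjective fun y => (m.exists_of_conn (hA.2 (m b) y)).imp fun _ => And.left

/-- The inclusion of a component. -/
def ofComponent (A : RibbonGraph) (c : Quotient A.connSetoid) : Emb (A.component c) A where
  toFun := Subtype.val
  injective := Subtype.val_injective
  map_flip _ := rfl
  map_rot := Or.inl fun _ => rfl

theorem isomorphic_component (m : Emb B A) (hB : B.IsConnected) (b : B.HalfEdge) :
    Isomorphic B (A.component (Quotient.mk _ (m b))) := by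
  let m' : Emb B (A.component (Quotient.mk _ (m b))) :=
    { toFun := fun x => ⟨m x, Quotient.sound ((m.conn_iff x b).1 (hB.2 x b))⟩
      injective := fun x y h => m.injective (congrArg Subtype.val h)
      map_flip := fun x => Subtype.ext (m.map_flip x)
      map_rot := m.map_rot.imp (fun h x => Subtype.ext (h x)) fun h x => Subtype.ext (h x) }
  refine m'.isomorphic_of_surjective fun y => ?_
  obtain ⟨z, hz, -⟩ := m.exists_of_conn (Quotient.exact y.2.symm)
  exact ⟨z, Subtype.ext hz⟩

theorem map_flipOn (m : Emb B A) {F : B.EdgeSet} {E : A.EdgeSet}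
    (h : ∀ x, x ∈ F.1 ↔ m x ∈ E.1) (x : B.HalfEdge) :
    m (B.flipOn F x) = A.flipOn E (m x) := by
  by_cases hx : x ∈ F.1
  · rw [flipOn_of_mem F hx, flipOn_of_mem E ((h x).1 hx), m.map_flip]
  · rw [flipOn_of_notMem F hx, flipOn_of_notMem E fun hE => hx ((h x).2 hE)]

/-- Cutting corresponding edges in both graphs. -/
def cutOutside (m : Emb B A) {F : B.EdgeSet} {E : A.EdgeSet} (h : ∀ x, x ∈ F.1 ↔ m x ∈ E.1) :
    Emb (B.cutOutside F) (A.cutOutside E) where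
  toFun := m
  injective := m.injective
  map_flip := m.map_flipOn h
  map_rot := m.map_rot

theorem map_contract_rot (m : Emb B A) {F : B.EdgeSet} {E : A.EdgeSet}
    (h : ∀ x, x ∈ F.1 ↔ m x ∈ E.1) (hr : ∀ x, m (B.rot x) = A.rot (m x))
    (x : (B.contract F).HalfEdge) (hx : m x.1 ∉ E.1) :
    m ((B.contract F).rot x).1 = ((A.contract E).rot ⟨m x.1, hx⟩).1 :=
  (Returns.map_of_semiconj (q := A.rot * A.flipOn E)
    (fun y => by rw [Equiv.Perm.mul_apply, Equiv.Perm.mul_apply, hr, m.map_flipOn h])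
    (fun y => not_congr (h y)) (contract_rot_returns F x)).unique
    (contract_rot_returns E ⟨m x.1, hx⟩)

theorem map_contract_rot_symm (m : Emb B A) {F : B.EdgeSet} {E : A.EdgeSet}
    (h : ∀ x, x ∈ F.1 ↔ m x ∈ E.1) (hr : ∀ x, m (B.rot x) = A.rot.symm (m x))
    (x : (B.contract F).HalfEdge) (hx : m x.1 ∉ E.1) :
    m ((B.contract F).rot x).1 = ((A.contract E).rot.symm ⟨m x.1, hx⟩).1 := by
  have hB : Returns (A.rot⁻¹ * A.flipOn E) (E.1)ᶜ (m x.1) (m ((B.contract F).rot x).1) :=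
    Returns.map_of_semiconj (fun y => by
      rw [Equiv.Perm.mul_apply, Equiv.Perm.mul_apply, hr, m.map_flipOn h]
      rfl) (fun y => not_congr (h y)) (contract_rot_returns F x)
  have hA : Returns (A.flipOn E * A.rot⁻¹) (E.1)ᶜ (m x.1)
      ((A.contract E).rot.symm ⟨m x.1, hx⟩).1 :=
    returns_perm (A.rot * A.flipOn E)⁻¹ (E.1)ᶜ ⟨m x.1, hx⟩
  -- The two permutations are conjugate by `flipOn E`, which fixes the complement of `E`.
  have hA' := hA.mul_comm_of_involutive (fun y => (A.flipOn E).left_inv y)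
    fun y hy => flipOn_of_notMem E hy
  rw [flipOn_of_notMem E hx] at hA'
  exact hB.unique hA'

/-- Contracting corresponding edges in both graphs. -/
def contract (m : Emb B A) {F : B.EdgeSet} {E : A.EdgeSet} (h : ∀ x, x ∈ F.1 ↔ m x ∈ E.1) :
    Emb (B.contract F) (A.contract E) where
  toFun x := ⟨m x.1, fun h' => x.2 ((h x.1).2 h')⟩
  injective _ _ hxy := Subtype.ext (m.injective (congrArg Subtype.val hxy))
  map_flip x := Subtype.ext (m.map_flip x.1)
  map_rot := m.map_rot.imp (fun hr x => Subtype.ext (m.map_contract_rot h hr x _))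
    fun hr x => Subtype.ext (m.map_contract_rot_symm h hr x _)

theorem mem_bivalent_iff (m : Emb B A) (x : B.HalfEdge) :
    x ∈ B.bivalent ↔ m x ∈ A.bivalent := by
  change (_ ∧ _) ↔ (_ ∧ _)
  rcases m.map_rot with h | h
  · rw [← h, ← h, m.injective.ne_iff, m.injective.eq_iff]
  · rw [← m.injective.ne_iff, ← m.injective.eq_iff, h, h]
    rw [Equiv.symm_apply_eq, ne_eq, Equiv.symm_apply_eq, h, Equiv.symm_apply_eq]
    exact and_congr (not_congr eq_comm) eq_comm

theorem map_crossBivalent (m : Emb B A) (x : B.HalfEdge) :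
    m (B.crossBivalent x) = A.crossBivalent (m x) := by
  by_cases hx : x ∈ B.bivalent
  · have hx' := (m.mem_bivalent_iff x).1 hx
    rw [crossBivalent_of_mem hx, crossBivalent_of_mem hx']
    rcases m.map_rot with h | h
    · exact h x
    · rw [h, Equiv.symm_apply_eq]
      exact hx'.2.symm
  · rw [crossBivalent_of_notMem hx, crossBivalent_of_notMem (mt (m.mem_bivalent_iff x).2 hx)]

/-- Erasing the vertices of valence two in both graphs. -/
def eraseBivalent (m : Emb B A) : Emb B.eraseBivalent A.eraseBivalent where
  toFun x := ⟨m x.1, fun h' => x.2 ((m.mem_bivalent_iff x.1).2 h')⟩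
  injective _ _ hxy := Subtype.ext (m.injective (congrArg Subtype.val hxy))
  map_flip x := Subtype.ext <|
    (Returns.map_of_semiconj (q := A.flip * A.crossBivalent) (t := (A.bivalent)ᶜ)
      (fun y => (m.map_flip (B.crossBivalent y)).trans (congrArg A.flip (m.map_crossBivalent y)))
      (fun y => not_congr (m.mem_bivalent_iff y)) (erase_flip_returns x)).unique
      (erase_flip_returns ⟨m x.1, fun h' => x.2 ((m.mem_bivalent_iff x.1).2 h')⟩)
  map_rot := m.map_rot.imp (fun h x => Subtype.ext (h x.1)) fun h x => Subtype.ext (h x.1)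

/-- Shrinking corresponding subgraphs of both graphs. -/
def shrink (m : Emb B A) {F : B.EdgeSet} {E : A.EdgeSet} (h : ∀ x, x ∈ F.1 ↔ m x ∈ E.1) :
    Emb (B.shrink F) (A.shrink E) :=
  (m.contract h).eraseBivalent

end Emb

theorem isConnected_component (c : Quotient A.connSetoid) : (A.component c).IsConnected := by
  refine ⟨?_, fun x y =>
    ((Emb.ofComponent A c).conn_iff x y).2 (Quotient.exact (x.2.trans y.2.symm))⟩
  induction c using Quotient.inductionOn with
  | h x => exact ⟨⟨x, rfl⟩⟩

namespace Emb

/-- The restriction of an embedding to a connected component. -/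
def restrictComponent (m : Emb B A) (c : Quotient B.connSetoid) : Emb (B.component c) A where
  toFun x := m x.1
  injective := m.injective.comp Subtype.val_injective
  map_flip x := m.map_flip x.1
  map_rot := m.map_rot.imp (fun h x => h x.1) fun h x => h x.1

theorem isomorphic_component_map (m : Emb B A) (x : B.HalfEdge) :
    Isomorphic (B.component (Quotient.mk _ x)) (A.component (Quotient.mk _ (m x))) :=
  (m.restrictComponent _).isomorphic_component (isConnected_component _) ⟨x, rfl⟩

/-- The map on components of corresponding subgraphs. -/
def subComponentMap (m : Emb B A) {F : B.EdgeSet} {E : A.EdgeSet}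
    (h : ∀ x, x ∈ F.1 ↔ m x ∈ E.1) (c : B.SubComponent F) : A.SubComponent E :=
  ⟨Quotient.map m (fun x y => ((m.cutOutside h).conn_iff x y).1) c.1, by
    obtain ⟨c, x, hx, rfl⟩ := c
    exact ⟨m x, (h x).1 hx, rfl⟩⟩

theorem isomorphic_subComponent (m : Emb B A) {F : B.EdgeSet} {E : A.EdgeSet}
    (h : ∀ x, x ∈ F.1 ↔ m x ∈ E.1) (c : B.SubComponent F) :
    Isomorphic (B.subComponent F c) (A.subComponent E (m.subComponentMap h c)) := by
  obtain ⟨_, x, hx, rfl⟩ := c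
  exact (m.cutOutside h).isomorphic_component_map x

/-- The preimage of an edge set under an embedding. -/
def pullEdges (m : Emb B A) (E : A.EdgeSet) : B.EdgeSet :=
  ⟨{x | m x ∈ E.1}, fun x hx => ⟨by
    change m (B.flip x) ∈ E.1
    rw [m.map_flip]
    exact (E.2 _ hx).1, fun h => (E.2 _ hx).2 (by rw [← m.map_flip, h])⟩⟩

theorem sameCycle_rot_iff (m : Emb B A) (x y : B.HalfEdge) :
    B.rot.SameCycle x y ↔ A.rot.SameCycle (m x) (m y) := by
  rcases m.map_rot with h | h
  · exact sameCycle_iff_of_semiconj m.injective h x y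
  · rw [← Equiv.Perm.sameCycle_inv (f := A.rot)]
    exact sameCycle_iff_of_semiconj m.injective h x y

theorem minimalPeriod_rot (m : Emb B A) (x : B.HalfEdge) :
    Function.minimalPeriod A.rot (m x) = Function.minimalPeriod B.rot x := by
  rw [minimalPeriod_eq_card_sameCycle, minimalPeriod_eq_card_sameCycle]
  refine (Nat.card_congr (Equiv.ofBijective
    (fun z => ⟨m z.1, (m.sameCycle_rot_iff x z.1).1 z.2⟩) ⟨fun z w h => ?_, fun y => ?_⟩)).symm
  · exact Subtype.ext (m.injective (congrArg Subtype.val h))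
  · obtain ⟨z, hz, -⟩ := m.exists_of_conn (conn_of_sameCycle_rot y.2)
    exact ⟨⟨z, (m.sameCycle_rot_iff x z).2 (hz ▸ y.2)⟩, Subtype.ext hz⟩

theorem mem_edgesExcept_iff (m : Emb B A) (x z : B.HalfEdge) :
    z ∈ (B.edgesExcept x).1 ↔ m z ∈ (A.edgesExcept (m x)).1 := by
  change (_ ∧ _ ∧ _) ↔ (_ ∧ _ ∧ _)
  rw [← m.map_flip, ← m.map_flip, m.injective.ne_iff, m.injective.ne_iff, m.injective.ne_iff]

theorem conn_edgesExcept_iff (m : Emb B A) (x y z : B.HalfEdge) :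
    (B.cutOutside (B.edgesExcept x)).connSetoid y z ↔
      (A.cutOutside (A.edgesExcept (m x))).connSetoid (m y) (m z) :=
  (m.cutOutside (m.mem_edgesExcept_iff x)).conn_iff y z

/-- When the orientation is reversed, the face of `x` corresponds to the face of `A.flip (m x)`. -/
theorem exists_sameCycle_face_iff (m : Emb B A) (hm : Function.Bijective m) :
    ∃ e : B.HalfEdge ≃ A.HalfEdge, (∀ x, B.flip x = x → e x = m x) ∧
      ∀ x y, (B.rot * B.flip).SameCycle x y ↔ (A.rot * A.flip).SameCycle (e x) (e y) := by
  rcases m.map_rot with h | h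
  · refine ⟨Equiv.ofBijective m hm, fun _ _ => rfl,
      sameCycle_iff_of_semiconj m.injective fun z => ?_⟩
    change m (B.rot (B.flip z)) = A.rot (A.flip (m z))
    rw [h, m.map_flip]
  · refine ⟨(Equiv.ofBijective m hm).trans A.flip, fun x hx => (m.flip_eq_iff x).2 hx,
      fun x y => ?_⟩
    rw [← Equiv.Perm.sameCycle_inv (f := A.rot * A.flip)]
    refine sameCycle_iff_of_semiconj ((Equiv.ofBijective m hm).trans A.flip).injective
      (fun z => ?_) x y
    rw [Equiv.Perm.eq_inv_iff_eq]
    change A.rot (A.flip (A.flip (m (B.rot (B.flip z))))) = A.flip (m z)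
    rw [A.flip_flip, h, Equiv.apply_symm_apply, m.map_flip]

end Emb

/-! ### Isomorphism invariance -/

theorem Isomorphic.exists_emb (h : Isomorphic G G') :
    ∃ m : Emb G G', Function.Bijective m := by
  obtain ⟨e, hf, hr⟩ := h
  exact ⟨⟨e, e.injective, hf, hr⟩, e.bijective⟩

theorem Isomorphic.isQuartic (h : Isomorphic G G') (hG : G.IsQuartic) : G'.IsQuartic := by
  obtain ⟨m, hm⟩ := h.exists_emb
  intro y
  obtain ⟨x, rfl⟩ := hm.2 y
  rw [m.minimalPeriod_rot, hG x]

theorem Isomorphic.is1PI (h : Isomorphic G G') (hG : G.Is1PI) : G'.Is1PI := by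
  obtain ⟨m, hm⟩ := h.exists_emb
  rw [is1PI_iff] at hG ⊢
  obtain ⟨hconn, ⟨x, hx⟩, hbr⟩ := hG
  refine ⟨m.isConnected hm.2 hconn, ⟨m x, mt (m.flip_eq_iff x).1 hx⟩, fun y hy => ?_⟩
  obtain ⟨z, rfl⟩ := hm.2 y
  rw [← m.map_flip]
  exact (m.conn_edgesExcept_iff z z (G.flip z)).1 (hbr z (mt (m.flip_eq_iff z).2 hy))

theorem Isomorphic.isFeynman1PI (h : Isomorphic G G') (hG : G.IsFeynman1PI) : G'.IsFeynman1PI :=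
  ⟨h.isQuartic hG.1, h.is1PI hG.2⟩

end RibbonGraph

/-! ### Counting cycles -/

theorem card_subtype_eq_add_compl {X : Type*} [Finite X] {P : X → Prop} {S : Set X}
    (hS : ∀ x ∈ S, P x) :
    Nat.card {x // P x} = Nat.card S + Nat.card {x : (Sᶜ : Set X) // P x.1} := by
  classical
  rw [← Nat.card_congr (Equiv.sumCompl fun x : {x // P x} => x.1 ∈ S), Nat.card_sum]
  congr 1
  · exact Nat.card_congr ⟨fun x => ⟨x.1.1, x.2⟩, fun x => ⟨⟨x.1, hS x.1 x.2⟩, x.2⟩,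
      fun _ => rfl, fun _ => rfl⟩
  · exact Nat.card_congr ⟨fun x => ⟨⟨x.1.1, x.2⟩, x.1.2⟩, fun x => ⟨⟨x.1.1, x.2⟩, x.1.2⟩,
      fun _ => rfl, fun _ => rfl⟩

theorem card_subtype_eq_sum {X : Type*} [Finite X] (r : Setoid X) (P : X → Prop)
    [Fintype (Quotient r)] :
    Nat.card {x // P x} =
      ∑ c : Quotient r, Nat.card {x : {x // Quotient.mk r x = c} // P x.1} := by
  rw [← Nat.card_congr (Equiv.sigmaFiberEquiv fun x : {x // P x} => Quotient.mk r x.1),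
    Nat.card_sigma]
  exact Finset.sum_congr rfl fun c _ => Nat.card_congr
    ⟨fun x => ⟨⟨x.1.1, x.2⟩, x.1.2⟩, fun x => ⟨⟨x.1.1, x.2⟩, x.1.2⟩, fun _ => rfl, fun _ => rfl⟩

theorem card_quotient_eq_of_exists {A X : Type*} {r : Setoid A} {s : Setoid X} {i : A → X}
    (h : ∀ a b, r a b ↔ s (i a) (i b)) (hi : ∀ x, ∃ a, s x (i a)) :
    Nat.card (Quotient r) = Nat.card (Quotient s) := by
  refine Nat.card_congr ((quotientEquivMeets r s i h).trans (Equiv.subtypeUnivEquiv fun c => ?_))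
  induction c using Quotient.inductionOn with
  | h x => exact (hi x).imp fun a ha => Quotient.sound (Setoid.symm' _ ha)

theorem card_quotient_eq_add {A X : Type*} [Finite X] {r : Setoid A} {s : Setoid X} {i : A → X}
    (h : ∀ a b, r a b ↔ s (i a) (i b)) :
    Nat.card (Quotient s) =
      Nat.card (Quotient r) + Nat.card {c : Quotient s // ¬ ∃ a, Quotient.mk s (i a) = c} := by
  classical
  rw [Nat.card_congr (quotientEquivMeets r s i h), ← Nat.card_sum]
  exact Nat.card_congr (Equiv.sumCompl _).symm

theorem card_quotient_eq_sum {X : Type*} [Finite X] {r s : Setoid X} (h : s ≤ r)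
    {t : ∀ c : Quotient r, Setoid {x // Quotient.mk r x = c}}
    (ht : ∀ c x y, t c x y ↔ s x.1 y.1) [Fintype (Quotient r)] :
    Nat.card (Quotient s) = ∑ c, Nat.card (Quotient (t c)) := by
  let f : Quotient s → Quotient r := Quotient.lift (Quotient.mk r) fun _ _ hab =>
    Quotient.sound (h hab)
  rw [← Nat.card_congr (Equiv.sigmaFiberEquiv f), Nat.card_sigma]
  refine Finset.sum_congr rfl fun c _ => Nat.card_congr
    (Equiv.trans (Equiv.subtypeEquivRight fun q => ?_)
      (quotientEquivMeets (t c) s Subtype.val (ht c)).symm)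
  induction q using Quotient.inductionOn with
  | h x =>
    constructor
    · exact fun hx => ⟨⟨x, hx⟩, rfl⟩
    · rintro ⟨a, ha⟩
      rw [← ha]
      exact a.2

theorem sameCycle_congr {X : Type*} [Finite X] {p q : Equiv.Perm X} {x : X}
    (h : ∀ z, p.SameCycle x z → p z = q z) (y : X) : p.SameCycle x y ↔ q.SameCycle x y := by
  let A : Set X := {z | p.SameCycle x z ∧ q.SameCycle x z}
  have hpA : Set.MapsTo p A A := fun z hz =>
    ⟨Equiv.Perm.sameCycle_apply_right.2 hz.1, by
      rw [h z hz.1]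
      exact Equiv.Perm.sameCycle_apply_right.2 hz.2⟩
  have hqA : Set.MapsTo q A A := fun z hz => h z hz.1 ▸ hpA hz
  have hx : x ∈ A := ⟨.refl p x, .refl q x⟩
  exact ⟨fun hxy => ((mem_iff_of_sameCycle hpA hxy).1 hx).2,
    fun hxy => ((mem_iff_of_sameCycle hqA hxy).1 hx).1⟩

theorem card_cycles_subset {X : Type*} (p : Equiv.Perm X) (S : Set X) :
    Nat.card {c : Quotient (Equiv.Perm.SameCycle.setoid p) //
        ¬ ∃ x : (Sᶜ : Set X), Quotient.mk _ x.1 = c} =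
      Nat.card (Quotient ((Equiv.Perm.SameCycle.setoid p).comap
        (Subtype.val : {x // ∀ y, p.SameCycle x y → y ∈ S} → X))) := by
  refine (Nat.card_congr ((quotientEquivMeets _ (Equiv.Perm.SameCycle.setoid p)
    (Subtype.val : {x // ∀ y, p.SameCycle x y → y ∈ S} → X) (fun _ _ => Iff.rfl)).trans
    (Equiv.subtypeEquivRight fun c => ?_))).symm
  induction c using Quotient.inductionOn with
  | h x =>
    constructor
    · rintro ⟨a, ha⟩ ⟨b, hb⟩
      exact b.2 (a.2 b.1 (Quotient.exact (ha.trans hb.symm)))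
    · refine fun hx => ⟨⟨x, fun y hy => ?_⟩, rfl⟩
      by_contra hyS
      exact hx ⟨⟨y, hyS⟩, Quotient.sound (Equiv.Perm.SameCycle.symm hy)⟩

theorem card_cycles_subset_congr {X : Type*} [Finite X] {p q : Equiv.Perm X} {S : Set X}
    (h : Set.EqOn p q S) :
    Nat.card {c : Quotient (Equiv.Perm.SameCycle.setoid p) //
        ¬ ∃ x : (Sᶜ : Set X), Quotient.mk _ x.1 = c} =
      Nat.card {c : Quotient (Equiv.Perm.SameCycle.setoid q) //
        ¬ ∃ x : (Sᶜ : Set X), Quotient.mk _ x.1 = c} := by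
  have hpq {p q : Equiv.Perm X} (h : Set.EqOn p q S) (x : X) (hx : ∀ y, p.SameCycle x y → y ∈ S) :
      ∀ y, p.SameCycle x y ↔ q.SameCycle x y :=
    sameCycle_congr fun z hz => h (hx z hz)
  rw [card_cycles_subset, card_cycles_subset]
  refine Nat.card_congr (Quotient.congr (Equiv.subtypeEquivRight fun x => ?_)
    fun a b => hpq h a.1 a.2 b.1)
  exact ⟨fun hx y hy => hx y ((hpq h x hx y).2 hy),
    fun hx y hy => hx y ((hpq h.symm x hx y).2 hy)⟩

theorem card_eq_mul_of_minimalPeriod_eq {X : Type*} [Finite X] {p : Equiv.Perm X} {S : Set X}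
    (hS : Set.MapsTo p S S) {k : ℕ} (hk : ∀ x ∈ S, Function.minimalPeriod p x = k) :
    Nat.card S = k * Nat.card {c : Quotient (Equiv.Perm.SameCycle.setoid p) //
      ¬ ∃ x : (Sᶜ : Set X), Quotient.mk _ x.1 = c} := by
  let C := {c : Quotient (Equiv.Perm.SameCycle.setoid p) //
    ¬ ∃ x : (Sᶜ : Set X), Quotient.mk _ x.1 = c}
  have : Fintype C := Fintype.ofFinite _
  let f : S → C := fun b => ⟨Quotient.mk _ b.1, fun ⟨x, hx⟩ =>
    x.2 ((mem_iff_of_sameCycle hS (Quotient.exact hx)).2 b.2)⟩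
  have hfiber (c : C) : Nat.card {b // f b = c} = k := by
    obtain ⟨v, hv⟩ := c
    induction v using Quotient.inductionOn with
    | h x =>
      have hx : x ∈ S := by
        by_contra hx
        exact hv ⟨⟨x, hx⟩, rfl⟩
      rw [← hk x hx, minimalPeriod_eq_card_sameCycle]
      exact Nat.card_congr
        ⟨fun b => ⟨b.1.1, .symm (Quotient.exact (congrArg Subtype.val b.2))⟩,
          fun y => ⟨⟨y.1, (mem_iff_of_sameCycle hS y.2).1 hx⟩,
            Subtype.ext (Quotient.sound (Equiv.Perm.SameCycle.symm y.2))⟩,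
          fun _ => rfl, fun _ => rfl⟩
  rw [← Nat.card_congr (Equiv.sigmaFiberEquiv f), Nat.card_sigma, Finset.sum_congr rfl
    fun c _ => hfiber c, Finset.sum_const, Finset.card_univ, ← Nat.card_eq_fintype_card,
    smul_eq_mul, mul_comm]

namespace RibbonGraph

variable {A B G G' : RibbonGraph}

open FirstReturn

/-! ### Components -/

theorem bridgeless_component_iff (c : Quotient G.connSetoid) :
    (G.component c).Bridgeless ↔ ∀ x : (G.component c).HalfEdge, G.flip x.1 ≠ x.1 →
      (G.cutOutside (G.edgesExcept x.1)).connSetoid x.1 (G.flip x.1) :=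
  forall_congr' fun x => imp_congr (not_congr ((Emb.ofComponent G c).flip_eq_iff x).symm)
    ((Emb.ofComponent G c).conn_edgesExcept_iff x x ((G.component c).flip x))

theorem bridgeless_iff_component : G.Bridgeless ↔ ∀ c, (G.component c).Bridgeless := by
  simp_rw [bridgeless_component_iff]
  exact ⟨fun h c x hx => h x.1 hx, fun h x hx => h (Quotient.mk _ x) ⟨x, rfl⟩ hx⟩

theorem is1PI_component_iff (c : Quotient G.connSetoid) : (G.component c).Is1PI ↔
    (∃ x : (G.component c).HalfEdge, G.flip x.1 ≠ x.1) ∧ (G.component c).Bridgeless := by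
  rw [is1PI_iff, and_iff_right (isConnected_component c)]
  exact and_congr_left' (exists_congr fun x =>
    not_congr ((Emb.ofComponent G c).flip_eq_iff x).symm)

theorem isQuartic_component (hG : G.IsQuartic) (c : Quotient G.connSetoid) :
    (G.component c).IsQuartic := fun x =>
  ((Emb.ofComponent G c).minimalPeriod_rot x).symm.trans (hG x.1)

theorem component_sameCycle_face (c : Quotient G.connSetoid) (x y : (G.component c).HalfEdge) :
    ((G.component c).rot * (G.component c).flip).SameCycle x y ↔
      (G.rot * G.flip).SameCycle x.1 y.1 :=
  sameCycle_iff_of_semiconj (Emb.ofComponent G c).injective (fun _ => rfl) x y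

/-! ### Euler characteristic and broken faces -/

/-- The Euler characteristic `V - I + F`. -/
def euler (G : RibbonGraph) : ℚ :=
  (G.numVertices : ℚ) - (G.numInternalHalfEdges : ℚ) / 2 + (G.numFaces : ℚ)

theorem genus_eq_zero_iff : G.genus = 0 ↔ G.euler = 2 := by
  rw [genus, ← euler]
  constructor <;> intro h <;> linarith

theorem euler_eq_sum [Fintype (Quotient G.connSetoid)] :
    G.euler = ∑ c, (G.component c).euler := by
  have hV : G.numVertices = ∑ c, (G.component c).numVertices :=
    card_quotient_eq_sum (r := G.connSetoid) (s := Equiv.Perm.SameCycle.setoid G.rot)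
      (t := fun c => Equiv.Perm.SameCycle.setoid (G.component c).rot)
      (fun _ _ h => conn_of_sameCycle_rot h) fun c => (Emb.ofComponent G c).sameCycle_rot_iff
  have hF : G.numFaces = ∑ c, (G.component c).numFaces :=
    card_quotient_eq_sum (r := G.connSetoid) (s := Equiv.Perm.SameCycle.setoid (G.rot * G.flip))
      (t := fun c => Equiv.Perm.SameCycle.setoid ((G.component c).rot * (G.component c).flip))
      (fun _ _ h => conn_of_sameCycle_face h) component_sameCycle_face
  have hI : G.numInternalHalfEdges = ∑ c, (G.component c).numInternalHalfEdges :=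
    (card_subtype_eq_sum G.connSetoid _).trans (Finset.sum_congr rfl fun c _ =>
      Nat.card_congr (Equiv.subtypeEquivRight fun x =>
        not_congr ((Emb.ofComponent G c).flip_eq_iff x)))
  simp only [euler, hV, hF, hI, Nat.cast_sum, Finset.sum_add_distrib, Finset.sum_sub_distrib,
    Finset.sum_div]

/-- The relation on the external edges of lying on the same face; its classes are the broken
faces. -/
def externalSetoid (G : RibbonGraph) : Setoid {h : G.HalfEdge // G.flip h = h} :=
  (Equiv.Perm.SameCycle.setoid (G.rot * G.flip)).comap Subtype.val

theorem numBrokenFaces_eq : G.numBrokenFaces = Nat.card (Quotient G.externalSetoid) := by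
  refine (Nat.card_congr ((quotientEquivMeets G.externalSetoid _ Subtype.val
    (fun _ _ => Iff.rfl)).trans (Equiv.subtypeEquivRight fun f => ?_))).symm
  exact ⟨fun ⟨a, ha⟩ => ⟨a.1, a.2, ha⟩, fun ⟨a, h, ha⟩ => ⟨⟨a, h⟩, ha⟩⟩

theorem numBrokenFaces_eq_one_iff : G.numBrokenFaces = 1 ↔
    (∀ x y, G.flip x = x → G.flip y = y → (G.rot * G.flip).SameCycle x y) ∧
      ∃ x, G.flip x = x := by
  rw [numBrokenFaces_eq, Nat.card_eq_one_iff_unique]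
  constructor
  · rintro ⟨hsub, ⟨q⟩⟩
    refine ⟨fun x y hx hy => ?_, ?_⟩
    · exact Quotient.exact (hsub.elim (Quotient.mk G.externalSetoid ⟨x, hx⟩)
        (Quotient.mk G.externalSetoid ⟨y, hy⟩))
    · obtain ⟨x, -⟩ := Quotient.exists_rep q
      exact ⟨x.1, x.2⟩
  · rintro ⟨hface, x, hx⟩
    refine ⟨⟨fun a b => ?_⟩, ⟨Quotient.mk _ ⟨x, hx⟩⟩⟩
    induction a, b using Quotient.inductionOn₂ with
    | h a b => exact Quotient.sound (hface a.1 b.1 a.2 b.2)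

theorem isPrimitivelyDivergent_congr
    (e : {h : A.HalfEdge // A.flip h = h} ≃ {h : B.HalfEdge // B.flip h = h})
    (he : ∀ x y, (A.rot * A.flip).SameCycle x.1 y.1 ↔ (B.rot * B.flip).SameCycle (e x).1 (e y).1)
    (heuler : A.euler = B.euler) : A.IsPrimitivelyDivergent ↔ B.IsPrimitivelyDivergent := by
  have hbroken : A.numBrokenFaces = B.numBrokenFaces := by
    rw [numBrokenFaces_eq, numBrokenFaces_eq]
    exact Nat.card_congr (Quotient.congr e he)
  have hexternal : A.numExternalEdges = B.numExternalEdges := Nat.card_congr e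
  rw [IsPrimitivelyDivergent, IsPrimitivelyDivergent, genus_eq_zero_iff, genus_eq_zero_iff,
    heuler, hbroken, hexternal]

theorem Isomorphic.isPrimitivelyDivergent_iff (h : Isomorphic G G') :
    G.IsPrimitivelyDivergent ↔ G'.IsPrimitivelyDivergent := by
  obtain ⟨m, hm⟩ := h.exists_emb
  obtain ⟨e, he, hface⟩ := m.exists_sameCycle_face_iff hm
  have hV : G.numVertices = G'.numVertices :=
    Nat.card_congr (Quotient.congr (Equiv.ofBijective m hm) m.sameCycle_rot_iff)
  have hF : G.numFaces = G'.numFaces := Nat.card_congr (Quotient.congr e hface)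
  refine isPrimitivelyDivergent_congr
    ((Equiv.ofBijective m hm).subtypeEquiv fun x => (m.flip_eq_iff x).symm) (fun x y => ?_)
    (by rw [euler, euler, hV, hF, h.numInternalHalfEdges_eq])
  refine (hface x.1 y.1).trans ?_
  rw [he x.1 x.2, he y.1 y.2]
  rfl

/-- All components are planar regular with two or four external edges. -/
def LocallyDivergent (G : RibbonGraph) : Prop := ∀ c, (G.component c).IsPrimitivelyDivergent

theorem LocallyDivergent.oneBrokenFace (hG : G.LocallyDivergent) : G.OneBrokenFace := by
  refine ⟨fun x y hx hy hxy => ?_, fun x => ?_⟩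
  · have h := (numBrokenFaces_eq_one_iff.1 (hG (Quotient.mk _ x)).2.1).1
      ⟨x, rfl⟩ ⟨y, Quotient.sound (Setoid.symm' _ hxy)⟩ (Subtype.ext hx) (Subtype.ext hy)
    exact (component_sameCycle_face _ _ _).1 h
  · obtain ⟨y, hy⟩ := (numBrokenFaces_eq_one_iff.1 (hG (Quotient.mk _ x)).2.1).2
    exact ⟨y.1, congrArg Subtype.val hy, Quotient.exact y.2.symm⟩

theorem LocallyDivergent.euler_eq (hG : G.LocallyDivergent) :
    G.euler = 2 * Nat.card (Quotient G.connSetoid) := by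
  have : Fintype (Quotient G.connSetoid) := Fintype.ofFinite _
  rw [euler_eq_sum, Finset.sum_congr rfl fun c _ => genus_eq_zero_iff.1 (hG c).1,
    Finset.sum_const, Finset.card_univ, ← Nat.card_eq_fintype_card, nsmul_eq_mul, mul_comm]

/-! ### Contraction -/

theorem minimalPeriod_contract {D : G.EdgeSet} (hD : (G.cutOutside D).OneBrokenFace)
    (x : (G.contract D).HalfEdge) : Function.minimalPeriod (G.contract D).rot x =
      ((G.cutOutside D).component (Quotient.mk _ x.1)).numExternalEdges := by
  rw [minimalPeriod_eq_card_sameCycle]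
  refine Nat.card_congr ⟨fun y => ⟨⟨y.1.1, ?_⟩, Subtype.ext (flipOn_of_notMem D y.1.2)⟩,
    fun y => ⟨⟨y.1.1, ?_⟩, ?_⟩, fun _ => rfl, fun _ => rfl⟩
  · refine Quotient.sound (s := (G.cutOutside D).connSetoid) (Setoid.symm' _ ?_)
    exact conn_of_sameCycle_face (G := G.cutOutside D) ((contract_sameCycle_rot D x y.1).1 y.2)
  · exact (flipOn_eq_iff D y.1.1).1 (congrArg Subtype.val y.2)
  · refine (contract_sameCycle_rot D x _).2 ?_
    exact hD.1 _ _ (flipOn_of_notMem D x.2) (congrArg Subtype.val y.2)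
      (Quotient.exact y.1.2.symm)

theorem numInternalHalfEdges_cutOutside (D : G.EdgeSet) :
    (G.cutOutside D).numInternalHalfEdges = Nat.card D.1 :=
  Nat.card_congr (Equiv.subtypeEquivRight (flipOn_ne_iff D))

theorem numInternalHalfEdges_eq_add_contract (D : G.EdgeSet) :
    G.numInternalHalfEdges =
      (G.cutOutside D).numInternalHalfEdges + (G.contract D).numInternalHalfEdges := by
  rw [numInternalHalfEdges_cutOutside]
  refine (card_subtype_eq_add_compl fun x hx => (D.2 x hx).2).trans (congrArg _ ?_)
  exact Nat.card_congr (Equiv.subtypeEquivRight fun x =>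
    not_congr (Subtype.ext_iff (a1 := (G.contract D).flip x) (a2 := x)).symm)

-- The faces of `G` and of `G.cutOutside D` all of whose half-edges lie in `D` are the same; the
-- other ones are the faces and the vertices of `G.contract D`, respectively.
theorem numFaces_add_numVertices_contract (D : G.EdgeSet) :
    G.numFaces + (G.contract D).numVertices =
      (G.cutOutside D).numFaces + (G.contract D).numFaces := by
  have hG : G.numFaces = _ := card_quotient_eq_add
    (r := Equiv.Perm.SameCycle.setoid ((G.contract D).rot * (G.contract D).flip))
    (s := Equiv.Perm.SameCycle.setoid (G.rot * G.flip)) (contract_sameCycle_face D)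
  have hcut : (G.cutOutside D).numFaces = _ := card_quotient_eq_add
    (r := Equiv.Perm.SameCycle.setoid (G.contract D).rot)
    (s := Equiv.Perm.SameCycle.setoid (G.rot * G.flipOn D)) (contract_sameCycle_rot D)
  have hinside := card_cycles_subset_congr (p := G.rot * G.flip) (q := G.rot * G.flipOn D)
    (S := D.1) fun x hx => congrArg G.rot (flipOn_of_mem D hx).symm
  rw [hG, hcut]
  change _ = (G.contract D).numVertices + _ + (G.contract D).numFaces
  refine Eq.trans (congrArg (fun n => (G.contract D).numFaces + n + (G.contract D).numVertices)
    hinside) ?_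
  ring!

theorem euler_add_two_mul_numVertices_contract (D : G.EdgeSet) :
    G.euler + 2 * (G.contract D).numVertices =
      (G.cutOutside D).euler + (G.contract D).euler := by
  have hF : (G.numFaces + (G.contract D).numVertices : ℚ) =
      (G.cutOutside D).numFaces + (G.contract D).numFaces :=
    mod_cast numFaces_add_numVertices_contract D
  have hV : (G.cutOutside D).numVertices = G.numVertices := rfl
  rw [euler, euler, euler, hV, numInternalHalfEdges_eq_add_contract D]
  push_cast
  linarith

theorem numVertices_contract {D : G.EdgeSet} (hD : (G.cutOutside D).OneBrokenFace) :
    (G.contract D).numVertices = Nat.card (Quotient (G.cutOutside D).connSetoid) := by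
  refine card_quotient_eq_of_exists (i := Subtype.val) (fun x y => ?_) fun x => ?_
  · exact (contract_sameCycle_rot D x y).trans
      ⟨fun h => conn_of_sameCycle_face (G := G.cutOutside D) h,
        hD.1 _ _ (flipOn_of_notMem D x.2) (flipOn_of_notMem D y.2)⟩
  · obtain ⟨y, hy, hxy⟩ := hD.2 x
    exact ⟨⟨y, (flipOn_eq_iff D y).1 hy⟩, hxy⟩

theorem euler_contract {D : G.EdgeSet} (hD : (G.cutOutside D).LocallyDivergent) :
    (G.contract D).euler = G.euler := by
  have h := euler_add_two_mul_numVertices_contract D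
  rw [hD.euler_eq, numVertices_contract hD.oneBrokenFace] at h
  linarith

theorem isPrimitivelyDivergent_contract_iff {D : G.EdgeSet}
    (hD : (G.cutOutside D).LocallyDivergent) :
    (G.contract D).IsPrimitivelyDivergent ↔ G.IsPrimitivelyDivergent :=
  isPrimitivelyDivergent_congr
    ⟨fun x => ⟨x.1.1, congrArg Subtype.val x.2⟩,
      fun x => ⟨⟨x.1, fun h => (D.2 _ h).2 x.2⟩, Subtype.ext x.2⟩, fun _ => rfl, fun _ => rfl⟩
    (fun x y => contract_sameCycle_face D x.1 y.1) (euler_contract hD)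

/-! ### Erasing vertices of valence two -/

theorem mem_bivalent_iff (h : G.HalfEdge) :
    h ∈ G.bivalent ↔ Function.minimalPeriod G.rot h = 2 := by
  constructor
  · rintro ⟨hne, hper⟩
    exact Function.minimalPeriod_eq_prime hper hne
  · intro h2
    have hper := Function.isPeriodicPt_minimalPeriod G.rot h
    rw [h2] at hper
    refine ⟨fun hfix => ?_, hper⟩
    rw [Function.minimalPeriod_eq_one_iff_isFixedPt.2 hfix] at h2
    omega

theorem minimalPeriod_erase (x : G.eraseBivalent.HalfEdge) :
    Function.minimalPeriod G.eraseBivalent.rot x = Function.minimalPeriod G.rot x.1 := by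
  refine Function.minimalPeriod_eq_minimalPeriod_iff.2 fun n => ?_
  have h : Function.Semiconj (Subtype.val : G.eraseBivalent.HalfEdge → G.HalfEdge)
    G.eraseBivalent.rot G.rot := fun _ => rfl
  exact Subtype.ext_iff.trans (Eq.congr_left (h.iterate_right n x))

theorem isQuartic_shrink {D : G.EdgeSet} (hD : (G.cutOutside D).LocallyDivergent) :
    (G.shrink D).IsQuartic := by
  intro x
  refine (minimalPeriod_erase (G := G.contract D) x).trans ?_
  have hne := mt (mem_bivalent_iff (G := G.contract D) x.1).2 x.2
  rw [minimalPeriod_contract hD.oneBrokenFace] at hne ⊢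
  exact (hD _).2.2.resolve_left hne

theorem NoHalfExternal.flip_ne_of_isConnected (hG : G.NoHalfExternal) (hc : G.IsConnected)
    (hn : Nonempty G.eraseBivalent.HalfEdge) {b : G.HalfEdge} (hb : b ∈ G.bivalent) :
    G.flip b ≠ b := by
  intro hf
  obtain ⟨y⟩ := hn
  obtain ⟨x, hx⟩ := exists_chain_of_conn y (hc.2 b y.1)
  exact x.2 (hG.bivalent_of_chain hb hf hx)

theorem exists_sameCycle_face (hc : G.IsConnected) (hn : Nonempty G.eraseBivalent.HalfEdge)
    (x : G.HalfEdge) : ∃ y : G.eraseBivalent.HalfEdge, (G.rot * G.flip).SameCycle x y.1 := by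
  by_contra! hcon
  have hbiv (z : G.HalfEdge) (hz : (G.rot * G.flip).SameCycle x z) : z ∈ G.bivalent := by
    by_contra hzb
    exact hcon ⟨z, hzb⟩ hz
  have hface (z : G.HalfEdge) : (G.rot * G.flip).SameCycle (G.flip z) (G.rot z) :=
    ⟨1, by rw [zpow_one, Equiv.Perm.mul_apply, G.flip_flip]⟩
  have hface' (z : G.HalfEdge) (hz : z ∈ G.bivalent) :
      (G.rot * G.flip).SameCycle (G.flip (G.rot z)) z := by
    simpa only [hz.2] using hface (G.rot z)
  -- The half-edges of the face and their opposites would form a whole component.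
  let A : Set G.HalfEdge := {z | (G.rot * G.flip).SameCycle x z ∨
    (G.rot * G.flip).SameCycle x (G.flip z)}
  have hrot : Set.MapsTo G.rot A A := by
    rintro z (hz | hz)
    · exact Or.inr (hz.trans (hface' z (hbiv z hz)).symm)
    · exact Or.inl (hz.trans (hface z))
  have hflip : Set.MapsTo G.flip A A := by
    rintro z (hz | hz)
    · exact Or.inr (by rwa [G.flip_flip])
    · exact Or.inl hz
  obtain ⟨y⟩ := hn
  rcases (mem_iff_of_conn hrot hflip (hc.2 x y.1)).1 (Or.inl (.refl _ _)) with hy | hy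
  · exact hcon y hy
  · exact y.2 ((G.rot_mem_bivalent _).1 (hbiv _ (hy.trans (hface y.1))))

theorem two_mul_numVertices_eq_erase (G : RibbonGraph) :
    2 * G.numVertices = 2 * G.eraseBivalent.numVertices + Nat.card G.bivalent := by
  have hV : G.numVertices = _ := card_quotient_eq_add
    (r := Equiv.Perm.SameCycle.setoid G.eraseBivalent.rot)
    (s := Equiv.Perm.SameCycle.setoid G.rot) erase_sameCycle_rot
  have hcard := card_eq_mul_of_minimalPeriod_eq (p := G.rot) (S := G.bivalent)
    (fun z hz => (G.rot_mem_bivalent z).2 hz) fun z hz => (mem_bivalent_iff z).1 hz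
  rw [hV, hcard, mul_add]
  rfl

theorem numFaces_erase (hc : G.IsConnected) (hn : Nonempty G.eraseBivalent.HalfEdge) :
    G.eraseBivalent.numFaces = G.numFaces :=
  card_quotient_eq_of_exists erase_sameCycle_face (exists_sameCycle_face hc hn)

theorem NoHalfExternal.numInternalHalfEdges_eq_erase (hG : G.NoHalfExternal) (hc : G.IsConnected)
    (hn : Nonempty G.eraseBivalent.HalfEdge) : G.numInternalHalfEdges =
      Nat.card G.bivalent + G.eraseBivalent.numInternalHalfEdges := by
  refine (card_subtype_eq_add_compl fun b hb => hG.flip_ne_of_isConnected hc hn hb).trans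
    (congrArg _ ?_)
  exact Nat.card_congr (Equiv.subtypeEquivRight fun x => not_congr (hG.erase_flip_eq_iff x).symm)

theorem NoHalfExternal.euler_erase (hG : G.NoHalfExternal) (hc : G.IsConnected)
    (hn : Nonempty G.eraseBivalent.HalfEdge) : G.eraseBivalent.euler = G.euler := by
  have hV : (2 * G.numVertices : ℚ) = 2 * G.eraseBivalent.numVertices + Nat.card G.bivalent :=
    mod_cast two_mul_numVertices_eq_erase G
  rw [euler, euler, numFaces_erase hc hn, hG.numInternalHalfEdges_eq_erase hc hn]
  push_cast
  linarith

theorem NoHalfExternal.isPrimitivelyDivergent_erase_iff (hG : G.NoHalfExternal)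
    (hc : G.IsConnected) (hn : Nonempty G.eraseBivalent.HalfEdge) :
    G.eraseBivalent.IsPrimitivelyDivergent ↔ G.IsPrimitivelyDivergent :=
  isPrimitivelyDivergent_congr
    ⟨fun x => ⟨x.1.1, (hG.erase_flip_eq_iff x.1).1 x.2⟩,
      fun x => ⟨⟨x.1, fun h => hG.flip_ne_of_isConnected hc hn h x.2⟩,
        (hG.erase_flip_eq_iff ⟨x.1, _⟩).2 x.2⟩, fun _ => rfl, fun _ => rfl⟩
    (fun x y => erase_sameCycle_face x.1 y.1) (hG.euler_erase hc hn)

/-! ### Divergent edge sets -/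

theorem sameCycle_rot_of_flip_eq (hc : G.IsConnected) (hf : ∀ h, G.flip h = h)
    (x y : G.HalfEdge) : G.rot.SameCycle x y := by
  refine connSetoid_le (r := Equiv.Perm.SameCycle.setoid G.rot)
    (fun z => Equiv.Perm.sameCycle_apply_right.2 (.refl _ z)) (fun z => ?_) (hc.2 x y)
  rw [hf]

theorem isPrimitivelyDivergent_of_flip_eq (hq : G.IsQuartic) (hc : G.IsConnected)
    (hf : ∀ h, G.flip h = h) : G.IsPrimitivelyDivergent := by
  have hcycle := sameCycle_rot_of_flip_eq hc hf
  have hflip : G.flip = 1 := Equiv.ext hf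
  obtain ⟨x⟩ := hc.1
  have hV : G.numVertices = 1 := by
    refine Nat.card_eq_one_iff_unique.2 ⟨⟨fun a b => ?_⟩, ⟨Quotient.mk _ x⟩⟩
    induction a, b using Quotient.inductionOn₂ with
    | h a b => exact Quotient.sound (hcycle a b)
  have hF : G.numFaces = 1 := by
    rw [← hV, numFaces, Face, hflip, mul_one]
    rfl
  have hI : G.numInternalHalfEdges = 0 := Nat.card_eq_zero.2 (Or.inl ⟨fun z => z.2 (hf z.1)⟩)
  refine ⟨?_, ?_, Or.inr ?_⟩
  · rw [genus, hV, hF, hI]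
    norm_num
  · rw [numBrokenFaces_eq_one_iff, hflip, mul_one]
    exact ⟨fun y z _ _ => hcycle y z, x, rfl⟩
  · rw [← hq x, minimalPeriod_eq_card_sameCycle]
    exact Nat.card_congr (Equiv.subtypeEquivRight fun y => iff_of_true (hf y) (hcycle x y))

/-- The edge set `D` spans a subgraph all of whose components are 1PI and primitively divergent. -/
def IsDivergent (D : G.EdgeSet) : Prop :=
  ∀ c, (G.subComponent D c).Is1PI ∧ (G.subComponent D c).IsPrimitivelyDivergent

theorem exists_internal_component_cutOutside_iff (D : G.EdgeSet)
    (c : Quotient (G.cutOutside D).connSetoid) :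
    (∃ x : ((G.cutOutside D).component c).HalfEdge, (G.cutOutside D).flip x.1 ≠ x.1) ↔
      ∃ h : G.HalfEdge, h ∈ D.1 ∧ Quotient.mk (G.cutOutside D).connSetoid h = c :=
  ⟨fun ⟨x, hx⟩ => ⟨x.1, (flipOn_ne_iff D x.1).1 hx, x.2⟩,
    fun ⟨h, hh, hc⟩ => ⟨⟨h, hc⟩, (flipOn_ne_iff D h).2 hh⟩⟩

-- The components of `G.cutOutside D` that do not meet `D` are single vertices of valence four.
theorem isDivergent_iff (hG : G.IsQuartic) (D : G.EdgeSet) :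
    IsDivergent D ↔ (G.cutOutside D).Bridgeless ∧ (G.cutOutside D).LocallyDivergent := by
  rw [bridgeless_iff_component, LocallyDivergent, ← forall_and]
  constructor
  · intro h c
    by_cases hc : ∃ h : G.HalfEdge, h ∈ D.1 ∧ Quotient.mk (G.cutOutside D).connSetoid h = c
    · exact ⟨((is1PI_component_iff c).1 (h ⟨c, hc⟩).1).2, (h ⟨c, hc⟩).2⟩
    · rw [← exists_internal_component_cutOutside_iff] at hc
      push Not at hc
      exact ⟨(bridgeless_component_iff c).2 fun x hx => absurd (hc x) hx,
        isPrimitivelyDivergent_of_flip_eq (isQuartic_component (G := G.cutOutside D) hG c)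
          (isConnected_component c) fun x => Subtype.ext (hc x)⟩
  · rintro h ⟨c, hc⟩
    exact ⟨(is1PI_component_iff c).2
      ⟨(exists_internal_component_cutOutside_iff D c).2 hc, (h c).1⟩, (h c).2⟩

/-! ### Shrinking divergent subgraphs -/

theorem eq_or_eq_rot_of_bivalent {D : G.EdgeSet} (hD : (G.cutOutside D).OneBrokenFace)
    {b z : (G.contract D).HalfEdge} (hb : b ∈ (G.contract D).bivalent)
    (h : (G.cutOutside D).connSetoid b.1 z.1) : z = b ∨ z = (G.contract D).rot b := by
  have hc : (G.contract D).rot.SameCycle b z := (contract_sameCycle_rot D b z).2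
    (hD.1 _ _ (flipOn_of_notMem D b.2) (flipOn_of_notMem D z.2) h)
  refine (mem_iff_of_sameCycle (A := {z | z = b ∨ z = (G.contract D).rot b}) ?_ hc).1 (Or.inl rfl)
  rintro z (rfl | rfl)
  · exact Or.inr rfl
  · exact Or.inl hb.2

theorem conn_cutOutside_of_conn_removeEdge {D D' : G.EdgeSet}
    (hD : (G.cutOutside D).OneBrokenFace) {b : (G.contract D).HalfEdge}
    (hb : b ∈ (G.contract D).bivalent) (hbD' : ((G.contract D).rot b).1 ∉ D'.1) {y : G.HalfEdge}
    (hy : (G.cutOutside (removeEdge D' b.1)).connSetoid b.1 y) :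
    (G.cutOutside D).connSetoid b.1 y := by
  refine (mem_iff_of_conn (G := G.cutOutside (removeEdge D' b.1))
    (A := {z | (G.cutOutside D).connSetoid b.1 z}) (fun z hz => ?_) (fun z hz => ?_) hy).1
    ((G.cutOutside D).connSetoid.refl b.1)
  · exact Setoid.trans' _ hz ((G.cutOutside D).connSetoid_rot z)
  change (G.cutOutside D).connSetoid b.1 (G.flipOn (removeEdge D' b.1) z)
  by_cases hzr : z ∈ (removeEdge D' b.1).1
  · have hzD : z ∈ D.1 := by
      by_contra hzD
      rcases eq_or_eq_rot_of_bivalent hD (z := ⟨z, hzD⟩) hb hz with h | h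
      · exact hzr.2.1 (congrArg Subtype.val h)
      · exact hbD' (h ▸ hzr.1)
    rw [flipOn_of_mem _ hzr]
    exact Setoid.trans' _ hz (conn_cutOutside_flip hzD)
  · rwa [flipOn_of_notMem _ hzr]

-- The two edges at a vertex of valence two of `G.contract D` are both bridges in any edge set that
-- contains exactly one of them.
theorem saturated_contractEdges {D D' : G.EdgeSet} (hD : (G.cutOutside D).OneBrokenFace)
    (hb : (G.cutOutside D').Bridgeless) : Saturated (contractEdges D D') := by
  intro b hbb hbD
  by_contra hcon
  have hconn : (G.cutOutside D).connSetoid b.1 (G.flip b.1) :=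
    conn_cutOutside_of_conn_removeEdge hD hbb hcon (bridgeless_cutOutside_iff.1 hb b.1 hbD)
  rcases eq_or_eq_rot_of_bivalent hD (z := (G.contract D).flip b) hbb hconn with h | h
  · exact (D'.2 _ hbD).2 (congrArg Subtype.val h)
  · exact hcon (h ▸ (D'.2 _ hbD).1)

theorem noHalfExternal_contract {D : G.EdgeSet} (hD : (G.cutOutside D).OneBrokenFace)
    (hb : G.Bridgeless) : (G.contract D).NoHalfExternal := by
  have hs : Saturated (contractEdges D G.allEdges) :=
    saturated_contractEdges hD (by rwa [cutOutside_allEdges])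
  intro b hbb hf
  by_contra hcon
  have hbE : ((G.contract D).rot ((G.contract D).rot b)).1 ∈ G.allEdges.1 :=
    hs _ (((G.contract D).rot_mem_bivalent b).2 hbb) fun h => hcon (Subtype.ext h)
  rw [hbb.2] at hbE
  exact hbE (congrArg Subtype.val hf)

/-- The edges which `D'` leaves in the cograph of `D`. -/
def shrinkEdges (D D' : G.EdgeSet) : (G.shrink D).EdgeSet :=
  eraseEdges (G := G.contract D) (contractEdges D D')

theorem mem_shrinkEdges {D D' : G.EdgeSet} (h : Saturated (contractEdges D D'))
    (x : (G.shrink D).HalfEdge) : x ∈ (shrinkEdges D D').1 ↔ x.1.1 ∈ D'.1 :=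
  h.mem_eraseEdges x

theorem shrink_cutOutside {D D' : G.EdgeSet} (h : D.1 ⊆ D'.1)
    (hs : Saturated (contractEdges D D')) :
    (G.cutOutside D').shrink (cutEdges D D' h) =
      (G.shrink D).cutOutside (shrinkEdges D D') := by
  rw [shrink, contract_cutOutside, erase_cutOutside hs]
  rfl

theorem conn_shrink_iff {D : G.EdgeSet} (hD : (G.cutOutside D).OneBrokenFace)
    (x y : (G.shrink D).HalfEdge) : (G.shrink D).connSetoid x y ↔ G.connSetoid x.1.1 y.1.1 :=
  (conn_erase_iff (G := G.contract D) x y).trans (conn_contract_iff hD x.1 y.1)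

theorem isConnected_shrink {D : G.EdgeSet} (hD : (G.cutOutside D).OneBrokenFace)
    (hG : G.IsConnected) (hn : Nonempty (G.shrink D).HalfEdge) : (G.shrink D).IsConnected :=
  ⟨hn, fun x y => (conn_shrink_iff hD x y).2 (hG.2 _ _)⟩

theorem isConnected_contract {D : G.EdgeSet} (hD : (G.cutOutside D).OneBrokenFace)
    (hG : G.IsConnected) : (G.contract D).IsConnected := by
  obtain ⟨⟨x⟩, hc⟩ := hG
  obtain ⟨y, hy, -⟩ := hD.2 x
  exact ⟨⟨⟨y, (flipOn_eq_iff D y).1 hy⟩⟩, fun x y => (conn_contract_iff hD x y).2 (hc _ _)⟩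

theorem bridgeless_shrink {D : G.EdgeSet} (hD : (G.cutOutside D).OneBrokenFace)
    (hDb : (G.cutOutside D).Bridgeless) (hG : G.Bridgeless) : (G.shrink D).Bridgeless :=
  (noHalfExternal_contract hD hG).bridgeless_erase ((bridgeless_contract_iff hD hDb).2 hG)

theorem mem_divergentSubgraphs {D : G.EdgeSet} : D ∈ G.divergentSubgraphs ↔
    D.1.Nonempty ∧ D.1 ≠ G.allEdges.1 ∧ IsDivergent D ∧ Nonempty (G.shrink D).HalfEdge :=
  Set.Finite.mem_toFinset _

theorem exists_chain_shrink {D : G.EdgeSet} (hD : (G.cutOutside D).OneBrokenFace)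
    (hG : G.IsConnected) (hn : Nonempty (G.shrink D).HalfEdge) (h : (G.contract D).HalfEdge) :
    ∃ x : (G.shrink D).HalfEdge, (G.contract D).chain h x.1 := by
  obtain ⟨y⟩ := hn
  exact exists_chain_of_conn (G := G.contract D) y ((isConnected_contract hD hG).2 _ _)

theorem exists_notMem_of_ne_allEdges {D : G.EdgeSet} (h : D.1 ≠ G.allEdges.1) :
    ∃ z, z ∉ D.1 ∧ G.flip z ≠ z := by
  by_contra! hcon
  refine h (Set.Subset.antisymm (subset_allEdges D) fun z hz => ?_)
  by_contra hzD
  exact hz (hcon z hzD)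

theorem isFeynman1PI_shrink (hG : G.IsFeynman1PI) {D : G.EdgeSet} (hne : D.1 ≠ G.allEdges.1)
    (hdiv : IsDivergent D) (hn : Nonempty (G.shrink D).HalfEdge) :
    (G.shrink D).IsFeynman1PI := by
  obtain ⟨hDb, hDl⟩ := (isDivergent_iff hG.1 D).1 hdiv
  obtain ⟨hc, -, hb⟩ := is1PI_iff.1 hG.2
  have hone := hDl.oneBrokenFace
  have hinternal : ∃ x, (G.shrink D).flip x ≠ x := by
    obtain ⟨z, hz, hzf⟩ := exists_notMem_of_ne_allEdges hne
    obtain ⟨x, hx⟩ := exists_chain_shrink hone hc hn ⟨z, hz⟩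
    exact ⟨x, (noHalfExternal_contract hone hb).erase_flip_ne (h := ⟨z, hz⟩)
      (fun h => hzf (congrArg Subtype.val h)) hx⟩
  exact ⟨isQuartic_shrink hDl,
    is1PI_iff.2 ⟨isConnected_shrink hone hc hn, hinternal, bridgeless_shrink hone hDb hb⟩⟩

theorem isFeynman1PI_subComponent (hG : G.IsQuartic) {D : G.EdgeSet} (hD : IsDivergent D)
    (c : G.SubComponent D) : (G.subComponent D c).IsFeynman1PI :=
  ⟨isQuartic_component (G := G.cutOutside D) hG c.1, (hD c).1⟩

/-! ### Iterated shrinking -/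

section ShrinkErase

variable {E : G.EdgeSet}

theorem Saturated.notMem_eraseEdges (hE : Saturated E) (x : G.eraseBivalent.HalfEdge) :
    x ∈ ((eraseEdges E).1)ᶜ ↔ x.1 ∈ (G.bivalent)ᶜ ∩ (E.1)ᶜ :=
  (not_congr (hE.mem_eraseEdges x)).trans (and_iff_right x.2).symm

theorem Saturated.mapsTo_rot_mul_flipOn (hE : Saturated E) :
    Set.MapsTo (G.rot * G.flipOn E) (G.bivalent ∩ (E.1)ᶜ) (G.bivalent ∩ (E.1)ᶜ) := by
  rintro z ⟨hz, hzE⟩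
  rw [Equiv.Perm.mul_apply, flipOn_of_notMem E hzE]
  have hrz := (G.rot_mem_bivalent z).2 hz
  exact ⟨hrz, fun h => hzE (hz.2 ▸ hE _ hrz h)⟩

theorem Saturated.erase_contract_rot_returns (hE : Saturated E)
    (x : (G.eraseBivalent.contract (eraseEdges E)).HalfEdge) :
    Returns (G.rot * G.flipOn E) ((G.bivalent)ᶜ ∩ (E.1)ᶜ) x.1.1
      ((G.eraseBivalent.contract (eraseEdges E)).rot x).1.1 := by
  refine (contract_rot_returns (eraseEdges E) x).map Subtype.val (r := (G.bivalent)ᶜ) (fun z => ?_)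
    Set.inter_subset_left hE.notMem_eraseEdges
  have := erase_face_returns (G := G.cutOutside E) z
  rwa [erase_flip_cutOutside hE] at this

theorem Saturated.erase_contract_face_returns (hE : Saturated E)
    (x : (G.eraseBivalent.contract (eraseEdges E)).HalfEdge) :
    Returns (G.rot * G.flip) ((G.bivalent)ᶜ ∩ (E.1)ᶜ) x.1.1
      ((G.eraseBivalent.contract (eraseEdges E)).rot
        ((G.eraseBivalent.contract (eraseEdges E)).flip x)).1.1 :=
  (contract_face_returns (eraseEdges E) x).map Subtype.val (p := G.eraseBivalent.rot *
    G.eraseBivalent.flip) erase_face_returns Set.inter_subset_left hE.notMem_eraseEdges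

/-- The half-edges that survive erasing the vertices of valence two and then contracting `E`, as
half-edges that survive contracting `E`. -/
def eraseContractMap (hE : Saturated E)
    (x : (G.eraseBivalent.contract (eraseEdges E)).HalfEdge) : (G.contract E).HalfEdge :=
  ⟨x.1.1, ((hE.notMem_eraseEdges x.1).1 x.2).2⟩

theorem eraseContractMap_injective (hE : Saturated E) :
    Function.Injective (eraseContractMap hE) := fun _ _ h =>
  Subtype.ext (Subtype.ext (Subtype.mk.inj h))

theorem eraseContractMap_rot (hE : Saturated E)
    (x : (G.eraseBivalent.contract (eraseEdges E)).HalfEdge) :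
    eraseContractMap hE ((G.eraseBivalent.contract (eraseEdges E)).rot x) =
      (G.contract E).rot (eraseContractMap hE x) := by
  have hrot := contract_rot_returns E (eraseContractMap hE x)
  refine Subtype.ext ((hE.erase_contract_rot_returns x).unique
    (hrot.mono_of_mem Set.inter_subset_right ⟨fun hb => ?_, hrot.mem⟩))
  exact x.1.2 ((mem_iff_of_sameCycle hE.mapsTo_rot_mul_flipOn hrot.sameCycle).2
    ⟨hb, hrot.mem⟩).1

theorem eraseContractMap_mem_bivalent_iff (hE : Saturated E)
    (x : (G.eraseBivalent.contract (eraseEdges E)).HalfEdge) :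
    x ∈ (G.eraseBivalent.contract (eraseEdges E)).bivalent ↔
      eraseContractMap hE x ∈ (G.contract E).bivalent := by
  change (_ ∧ _) ↔ (_ ∧ _)
  rw [← eraseContractMap_rot, ← eraseContractMap_rot, (eraseContractMap_injective hE).ne_iff,
    (eraseContractMap_injective hE).eq_iff]

theorem Saturated.contract_rot_of_mem_bivalent (hE : Saturated E) {y : (G.contract E).HalfEdge}
    (hy : y.1 ∈ G.bivalent) : ((G.contract E).rot y).1 = G.rot y.1 := by
  have hstep : (G.rot * G.flipOn E) y.1 = G.rot y.1 := congrArg G.rot (flipOn_of_notMem E y.2)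
  exact (contract_rot_returns E y).unique
    (.of_apply_eq hstep (hstep ▸ (hE.mapsTo_rot_mul_flipOn ⟨hy, y.2⟩).2))

theorem Saturated.mem_bivalent_contract (hE : Saturated E) {y : (G.contract E).HalfEdge}
    (hy : y.1 ∈ G.bivalent) : y ∈ (G.contract E).bivalent := by
  have hrot := hE.contract_rot_of_mem_bivalent hy
  have hrot' := hE.contract_rot_of_mem_bivalent (y := (G.contract E).rot y)
    (by rw [hrot]; exact (G.rot_mem_bivalent _).2 hy)
  rw [hrot] at hrot'
  exact ⟨fun h => hy.1 (hrot.symm.trans (congrArg Subtype.val h)), Subtype.ext (hrot'.trans hy.2)⟩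

theorem Saturated.shrink_erase_face_eq (hE : Saturated E)
    (x : (G.eraseBivalent.shrink (eraseEdges E)).HalfEdge) (y : (G.shrink E).HalfEdge)
    (hxy : eraseContractMap hE x.1 = y.1) :
    eraseContractMap hE ((G.eraseBivalent.shrink (eraseEdges E)).rot
      ((G.eraseBivalent.shrink (eraseEdges E)).flip x)).1 =
      ((G.shrink E).rot ((G.shrink E).flip y)).1 := by
  -- Both sides are the next half-edge in `W` along the face of `G` through `y`.
  let W : Set G.HalfEdge := {h | ∃ z ∉ (G.contract E).bivalent, z.1 = h}
  have hW (z : (G.contract E).HalfEdge) : z ∈ ((G.contract E).bivalent)ᶜ ↔ z.1 ∈ W :=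
    ⟨fun h => ⟨z, h, rfl⟩, fun ⟨w, hw, hwz⟩ => (Subtype.ext hwz : w = z) ▸ hw⟩
  have hWsub : W ⊆ (G.bivalent)ᶜ ∩ (E.1)ᶜ := by
    rintro _ ⟨z, hz, rfl⟩
    exact ⟨mt hE.mem_bivalent_contract hz, z.2⟩
  have hx := (erase_face_returns x).map (fun z => z.1.1) hE.erase_contract_face_returns hWsub
    fun z => (not_congr (eraseContractMap_mem_bivalent_iff hE z)).trans (hW _)
  have hy := (erase_face_returns y).map Subtype.val (p := (G.contract E).rot * (G.contract E).flip)
    (contract_face_returns E) (hWsub.trans Set.inter_subset_right) hW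
  rw [← hxy] at hy
  exact Subtype.ext (hx.unique hy)

/-- Shrinking `E` absorbs erasing the vertices of valence two beforehand. -/
def embShrinkErase (hE : Saturated E) :
    Emb (G.eraseBivalent.shrink (eraseEdges E)) (G.shrink E) where
  toFun x := ⟨eraseContractMap hE x.1, mt (eraseContractMap_mem_bivalent_iff hE x.1).2 x.2⟩
  injective _ _ h := Subtype.ext (eraseContractMap_injective hE (congrArg Subtype.val h))
  map_flip x := (G.shrink E).rot.injective (Subtype.ext
    ((eraseContractMap_rot hE _).symm.trans (hE.shrink_erase_face_eq x _ rfl)))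
  map_rot := Or.inl fun x => Subtype.ext (eraseContractMap_rot hE x.1)

theorem isomorphic_shrink_erase (hE : Saturated E) :
    Isomorphic (G.eraseBivalent.shrink (eraseEdges E)) (G.shrink E) := by
  refine (embShrinkErase hE).isomorphic_of_surjective fun y => ?_
  have hy : y.1.1 ∉ G.bivalent := mt hE.mem_bivalent_contract y.2
  let x : (G.eraseBivalent.contract (eraseEdges E)).HalfEdge :=
    ⟨⟨y.1.1, hy⟩, (hE.notMem_eraseEdges _).2 ⟨hy, y.1.2⟩⟩
  exact ⟨⟨x, mt (eraseContractMap_mem_bivalent_iff hE x).1 y.2⟩, rfl⟩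

end ShrinkErase

theorem Emb.eraseBivalent_surjective (m : Emb B A) (hm : Function.Surjective m) :
    Function.Surjective m.eraseBivalent := by
  rintro ⟨y, hy⟩
  obtain ⟨x, rfl⟩ := hm y
  exact ⟨⟨x, mt (m.mem_bivalent_iff x).1 hy⟩, rfl⟩

theorem contract_rot_mul_flipOn_returns {D D' : G.EdgeSet} (h : D.1 ⊆ D'.1)
    (x : (G.contract D).HalfEdge) :
    Returns (G.rot * G.flipOn D') (D.1)ᶜ x.1
      (((G.contract D).rot * (G.contract D).flipOn (contractEdges D D')) x).1 := by
  have := contract_face_returns (G := G.cutOutside D') (cutEdges D D' h) x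
  rwa [contract_rot_cutOutside, contract_flip_cutOutside] at this

/-- Contracting in two steps. -/
def embContractContract (D D' : G.EdgeSet) (h : D.1 ⊆ D'.1) :
    Emb ((G.contract D).contract (contractEdges D D')) (G.contract D') where
  toFun x := ⟨x.1.1, x.2⟩
  injective _ _ hxy := Subtype.ext (Subtype.ext
    (congrArg (fun z : (G.contract D').HalfEdge => z.1) hxy))
  map_flip _ := rfl
  map_rot := Or.inl fun x => Subtype.ext
    (((contract_rot_returns (contractEdges D D') x).map Subtype.val
      (contract_rot_mul_flipOn_returns h) (Set.compl_subset_compl.2 h) fun _ => Iff.rfl).unique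
      (contract_rot_returns D' ⟨x.1.1, x.2⟩))

theorem isomorphic_shrink_shrink {D D' : G.EdgeSet} (h : D.1 ⊆ D'.1)
    (hs : Saturated (contractEdges D D')) :
    Isomorphic ((G.shrink D).shrink (shrinkEdges D D')) (G.shrink D') :=
  (isomorphic_shrink_erase hs).trans
    ((embContractContract D D' h).eraseBivalent.isomorphic_of_surjective
      (Emb.eraseBivalent_surjective _ fun y => ⟨⟨⟨y.1, fun hy => y.2 (h hy)⟩, y.2⟩, rfl⟩))

theorem Isomorphic.nonempty (h : Isomorphic A B) (hA : Nonempty A.HalfEdge) :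
    Nonempty B.HalfEdge := by
  obtain ⟨e, -⟩ := h
  exact hA.map e

/-! ### Divergent subgraphs of cographs -/

theorem LocallyDivergent.of_emb (hA : A.LocallyDivergent) (m : Emb B A) :
    B.LocallyDivergent := fun c =>
  c.inductionOn fun x => (m.isomorphic_component_map x).isPrimitivelyDivergent_iff.2 (hA _)

theorem NoHalfExternal.of_emb (hA : A.NoHalfExternal) (m : Emb B A) : B.NoHalfExternal := by
  intro b hb hf
  have hb' := (m.mem_bivalent_iff b).1 hb
  have hrot : m (B.rot b) = A.rot (m b) := by
    rw [← crossBivalent_of_mem hb, m.map_crossBivalent, crossBivalent_of_mem hb']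
  rw [← m.flip_eq_iff, hrot]
  exact hA (m b) hb' ((m.flip_eq_iff b).2 hf)

theorem isPrimitivelyDivergent_shrink_iff {D : G.EdgeSet} (hc : G.IsConnected)
    (hD : (G.cutOutside D).LocallyDivergent) (hN : (G.contract D).NoHalfExternal)
    (hn : Nonempty (G.shrink D).HalfEdge) :
    (G.shrink D).IsPrimitivelyDivergent ↔ G.IsPrimitivelyDivergent :=
  (hN.isPrimitivelyDivergent_erase_iff (isConnected_contract hD.oneBrokenFace hc) hn).trans
    (isPrimitivelyDivergent_contract_iff hD)

/-- The edges of `F` that lie in the component `c`. -/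
abbrev componentEdges (F : A.EdgeSet) (c : Quotient A.connSetoid) : (A.component c).EdgeSet :=
  (Emb.ofComponent A c).pullEdges F

/-- The cograph of a component is a part of the cograph. -/
def embShrinkComponent (F : A.EdgeSet) (c : Quotient A.connSetoid) :
    Emb ((A.component c).shrink (componentEdges F c)) (A.shrink F) :=
  (Emb.ofComponent A c).shrink fun _ => Iff.rfl

theorem exists_embShrinkComponent_eq (F : A.EdgeSet) (x : (A.shrink F).HalfEdge) :
    ∃ y, embShrinkComponent F (Quotient.mk _ x.1.1) y = x := by
  let y : ((A.component (Quotient.mk _ x.1.1)).contract (componentEdges F _)).HalfEdge :=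
    ⟨⟨x.1.1, rfl⟩, x.1.2⟩
  let m : Emb _ (A.contract F) := (Emb.ofComponent A (Quotient.mk _ x.1.1)).contract
    (F := componentEdges F _) fun _ => Iff.rfl
  exact ⟨⟨y, mt (m.mem_bivalent_iff y).1 x.2⟩, rfl⟩

theorem isPrimitivelyDivergent_component_shrink_iff {F : A.EdgeSet}
    (hF : (A.cutOutside F).LocallyDivergent) (hN : (A.contract F).NoHalfExternal)
    (x : (A.shrink F).HalfEdge) :
    ((A.shrink F).component (Quotient.mk _ x)).IsPrimitivelyDivergent ↔
      (A.component (Quotient.mk _ x.1.1)).IsPrimitivelyDivergent := by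
  let c : Quotient A.connSetoid := Quotient.mk _ x.1.1
  have hF' : ((A.component c).cutOutside (componentEdges F c)).LocallyDivergent :=
    hF.of_emb ((Emb.ofComponent A c).cutOutside fun _ => Iff.rfl)
  have hN' : ((A.component c).contract (componentEdges F c)).NoHalfExternal :=
    hN.of_emb ((Emb.ofComponent A c).contract fun _ => Iff.rfl)
  have hc : (A.component c).IsConnected := isConnected_component c
  obtain ⟨y, hy⟩ := exists_embShrinkComponent_eq F x
  have hiso : Isomorphic ((A.component c).shrink (componentEdges F c))
      ((A.shrink F).component (Quotient.mk _ x)) := by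
    rw [← hy]
    exact (embShrinkComponent F c).isomorphic_component
      (isConnected_shrink hF'.oneBrokenFace hc ⟨y⟩) y
  rw [← hiso.isPrimitivelyDivergent_iff]
  exact isPrimitivelyDivergent_shrink_iff hc hF' hN' ⟨y⟩

theorem isDivergent_shrinkEdges (hG : G.IsQuartic) {D D' : G.EdgeSet} (hD : IsDivergent D)
    (hD' : IsDivergent D') (h : D.1 ⊆ D'.1) : IsDivergent (shrinkEdges D D') := by
  obtain ⟨hDb, hDl⟩ := (isDivergent_iff hG D).1 hD
  obtain ⟨hDb', hDl'⟩ := (isDivergent_iff hG D').1 hD'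
  have hs := saturated_contractEdges hDl.oneBrokenFace hDb'
  rw [← cutOutside_cutEdges D D' h] at hDb hDl
  rw [isDivergent_iff (isQuartic_shrink (by rwa [cutOutside_cutEdges] at hDl)),
    ← shrink_cutOutside h hs]
  refine ⟨bridgeless_shrink hDl.oneBrokenFace hDb hDb', fun c => ?_⟩
  induction c using Quotient.inductionOn with
  | h x =>
    exact (isPrimitivelyDivergent_component_shrink_iff hDl
      (noHalfExternal_contract hDl.oneBrokenFace hDb') x).2 (hDl' _)

/-- Every internal edge belongs to a chain that ends at a vertex of valence other than two; that is,
no component is a closed chain of vertices of valence two. -/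
def ChainsEnd (G : RibbonGraph) : Prop :=
  ∀ h, G.flip h ≠ h → ∃ x : G.eraseBivalent.HalfEdge, G.chain h x.1

theorem bridgeless_of_shrink {F : A.EdgeSet} (hF : (A.cutOutside F).OneBrokenFace)
    (hFb : (A.cutOutside F).Bridgeless) (hN : (A.contract F).NoHalfExternal)
    (hends : (A.contract F).ChainsEnd) (hb : (A.shrink F).Bridgeless) : A.Bridgeless :=
  (bridgeless_contract_iff hF hFb).1 (hN.bridgeless_of_erase hb hends)

theorem mem_of_conn_of_forall_not_conn {F : A.EdgeSet} (hends : (A.contract F).ChainsEnd)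
    {z w : A.HalfEdge} (hz : ∀ x : (A.shrink F).HalfEdge, ¬A.connSetoid x.1.1 z)
    (hw : A.connSetoid z w) (hwf : A.flip w ≠ w) : w ∈ F.1 := by
  by_contra hwF
  obtain ⟨x, hx⟩ := hends ⟨w, hwF⟩ fun h => hwf (congrArg Subtype.val h)
  have hwx : A.connSetoid w x.1.1 := conn_of_conn_contract F (conn_of_chain hx)
  exact hz x (Setoid.symm' _ (Setoid.trans' _ hw hwx))

theorem locallyDivergent_of_shrink {F : A.EdgeSet} (hF : (A.cutOutside F).LocallyDivergent)
    (hN : (A.contract F).NoHalfExternal) (hends : (A.contract F).ChainsEnd)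
    (hl : (A.shrink F).LocallyDivergent) : A.LocallyDivergent := by
  intro c
  induction c using Quotient.inductionOn with
  | h z =>
    by_cases hz : ∃ x : (A.shrink F).HalfEdge, A.connSetoid x.1.1 z
    · obtain ⟨x, hx⟩ := hz
      rw [← Quotient.sound hx]
      exact (isPrimitivelyDivergent_component_shrink_iff hF hN x).1 (hl _)
    · push Not at hz
      -- All the internal edges of the component of `z` belong to `F`.
      let m : Emb ((A.cutOutside F).component (Quotient.mk _ z)) A :=
        { toFun := Subtype.val
          injective := Subtype.val_injective
          map_flip := fun w => by
            change A.flipOn F w.1 = A.flip w.1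
            have hw : A.connSetoid z w.1 := conn_of_conn_cutOutside (Quotient.exact w.2.symm)
            by_cases hwf : A.flip w.1 = w.1
            · exact (flipOn_of_notMem F fun h => (F.2 _ h).2 hwf).trans hwf.symm
            · exact flipOn_of_mem F (mem_of_conn_of_forall_not_conn hends hz hw hwf)
          map_rot := Or.inl fun _ => rfl }
      exact (m.isomorphic_component (isConnected_component _)
        ⟨z, rfl⟩).isPrimitivelyDivergent_iff.1 (hF _)

/-- The edges of `D` together with those that form edges of `E` in the cograph. -/
def unionLift {D : G.EdgeSet} (hN : (G.contract D).NoHalfExternal) (E : (G.shrink D).EdgeSet) :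
    G.EdgeSet :=
  ⟨{h | h ∈ D.1 ∨ ∃ hh : h ∈ (D.1)ᶜ,
      (⟨h, hh⟩ : (G.contract D).HalfEdge) ∈ (liftEdges hN E).1}, by
    rintro h (hh | ⟨hh, hE⟩)
    · exact ⟨Or.inl (D.2 h hh).1, (D.2 h hh).2⟩
    · obtain ⟨hflip, hne⟩ := (liftEdges hN E).2 _ hE
      exact ⟨Or.inr ⟨fun h' => hh ((G.flip_mem_iff D h).1 h'), hflip⟩,
        fun h' => hne (Subtype.ext h')⟩⟩

theorem subset_unionLift {D : G.EdgeSet} (hN : (G.contract D).NoHalfExternal)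
    (E : (G.shrink D).EdgeSet) : D.1 ⊆ (unionLift hN E).1 := fun _ => Or.inl

theorem contractEdges_unionLift {D : G.EdgeSet} (hN : (G.contract D).NoHalfExternal)
    (E : (G.shrink D).EdgeSet) : contractEdges D (unionLift hN E) = liftEdges hN E := by
  refine Subtype.ext (Set.ext fun x => ⟨?_, fun h => Or.inr ⟨x.2, h⟩⟩)
  rintro (h | ⟨_, h⟩)
  · exact absurd h x.2
  · exact h

theorem shrinkEdges_unionLift {D : G.EdgeSet} (hN : (G.contract D).NoHalfExternal)
    (E : (G.shrink D).EdgeSet) : shrinkEdges D (unionLift hN E) = E := by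
  rw [shrinkEdges, contractEdges_unionLift]
  exact eraseEdges_liftEdges hN E

theorem Saturated.chain_cutOutside {E : G.EdgeSet} (hE : Saturated E) {x y : G.HalfEdge}
    (hx : x ∈ E.1) (h : G.chain x y) : (G.cutOutside E).chain x y := by
  refine ((RibbonGraph.mem_iff_of_chain
    (A := {z | z ∈ E.1 ∧ (G.cutOutside E).chain x z}) ?_ ?_ h).1
    ⟨hx, (G.cutOutside E).chain.refl x⟩).2
  · rintro z ⟨hzE, hxz⟩
    exact ⟨hE.cross_mem hzE, Setoid.trans' _ hxz (chain_cross (G := G.cutOutside E) z)⟩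
  · rintro z ⟨hzE, hxz⟩
    refine ⟨(E.2 z hzE).1, Setoid.trans' _ hxz ?_⟩
    have hflip : (G.cutOutside E).flip z = G.flip z := flipOn_of_mem E hzE
    exact hflip ▸ chain_flip (G := G.cutOutside E) z

theorem chainsEnd_cutOutside_liftEdges (hG : G.NoHalfExternal) (E : G.eraseBivalent.EdgeSet) :
    (G.cutOutside (liftEdges hG E)).ChainsEnd := by
  intro z hz
  have hzE : z ∈ (liftEdges hG E).1 := (flipOn_ne_iff (G := G) (liftEdges hG E) z).1 hz
  obtain ⟨x, -, hx⟩ := id hzE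
  exact ⟨x, (saturated_liftEdges hG E).chain_cutOutside hzE (Setoid.symm' _ hx)⟩

theorem isDivergent_unionLift (hG : G.IsQuartic) {D : G.EdgeSet} (hD : IsDivergent D)
    (hN : (G.contract D).NoHalfExternal) (E : (G.shrink D).EdgeSet) (hE : IsDivergent E) :
    IsDivergent (unionLift hN E) := by
  obtain ⟨hDb, hDl⟩ := (isDivergent_iff hG D).1 hD
  obtain ⟨hEb, hEl⟩ := (isDivergent_iff (isQuartic_shrink hDl) E).1 hE
  let D' := unionLift hN E
  have h : D.1 ⊆ D'.1 := subset_unionLift hN E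
  have hlift : contractEdges D D' = liftEdges hN E := contractEdges_unionLift hN E
  have hs : Saturated (contractEdges D D') := hlift ▸ saturated_liftEdges hN E
  have hends : ((G.cutOutside D').contract (cutEdges D D' h)).ChainsEnd := by
    rw [contract_cutOutside, hlift]
    exact chainsEnd_cutOutside_liftEdges hN E
  have hN' : ((G.cutOutside D').contract (cutEdges D D' h)).NoHalfExternal := by
    rw [contract_cutOutside]
    exact hs.noHalfExternal_cutOutside
  have hshrink : (G.cutOutside D').shrink (cutEdges D D' h) = (G.shrink D).cutOutside E := by
    rw [shrink_cutOutside h hs, shrinkEdges_unionLift]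
  rw [← hshrink] at hEb hEl
  rw [← cutOutside_cutEdges D D' h] at hDb hDl
  exact (isDivergent_iff hG _).2 ⟨bridgeless_of_shrink hDl.oneBrokenFace hDb hN' hends hEb,
    locallyDivergent_of_shrink hDl hN' hends hEl⟩

/-! ### Nested divergent subgraphs -/

theorem mem_divergentSubgraphs_of_subset (hG : G.IsQuartic) {D D' : G.EdgeSet}
    (hD' : D' ∈ G.divergentSubgraphs) (hD : IsDivergent D) (hne : D.1.Nonempty)
    (h : D.1 ⊆ D'.1) : D ∈ G.divergentSubgraphs := by
  obtain ⟨-, h2, h3, h4⟩ := mem_divergentSubgraphs.1 hD'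
  refine mem_divergentSubgraphs.2 ⟨hne, fun h' => h2 ?_, hD, ?_⟩
  · exact Set.Subset.antisymm (subset_allEdges D') (h' ▸ h)
  · have hs := saturated_contractEdges ((isDivergent_iff hG D).1 hD).2.oneBrokenFace
      ((isDivergent_iff hG D').1 h3).1
    obtain ⟨x⟩ := (isomorphic_shrink_shrink h hs).symm.nonempty h4
    exact ⟨x.1.1⟩

theorem shrinkEdges_mem (hG : G.IsFeynman1PI) {D D' : G.EdgeSet} (hD : D ∈ G.divergentSubgraphs)
    (hD' : D' ∈ G.divergentSubgraphs) (h : D.1 ⊂ D'.1) :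
    shrinkEdges D D' ∈ (G.shrink D).divergentSubgraphs := by
  obtain ⟨-, -, hd, hn⟩ := mem_divergentSubgraphs.1 hD
  obtain ⟨-, hne', hd', hn'⟩ := mem_divergentSubgraphs.1 hD'
  have hone := ((isDivergent_iff hG.1 D).1 hd).2.oneBrokenFace
  obtain ⟨hc, -, hb⟩ := is1PI_iff.1 hG.2
  have hs := saturated_contractEdges hone ((isDivergent_iff hG.1 D').1 hd').1
  refine mem_divergentSubgraphs.2 ⟨?nonempty, fun hall => ?ne_all,
    isDivergent_shrinkEdges hG.1 hd hd' h.1, (isomorphic_shrink_shrink h.1 hs).symm.nonempty hn'⟩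
  case nonempty =>
    obtain ⟨z, hz, hzD⟩ := Set.exists_of_ssubset h
    obtain ⟨x, hx⟩ := exists_chain_shrink hone hc hn ⟨z, hzD⟩
    exact ⟨x, (mem_shrinkEdges hs x).2 ((hs.mem_iff_of_chain hx).1 hz)⟩
  case ne_all =>
    obtain ⟨z, hz, hzf⟩ := exists_notMem_of_ne_allEdges hne'
    have hzD : z ∉ D.1 := fun h' => hz (h.1 h')
    obtain ⟨x, hx⟩ := exists_chain_shrink hone hc hn ⟨z, hzD⟩
    have hx_internal : x ∈ (G.shrink D).allEdges.1 :=
      (noHalfExternal_contract hone hb).erase_flip_ne (h := ⟨z, hzD⟩)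
        (fun h => hzf (congrArg Subtype.val h)) hx
    rw [← hall, mem_shrinkEdges hs] at hx_internal
    exact hz ((hs.mem_iff_of_chain hx).2 hx_internal)

theorem shrinkEdges_injective (hG : G.IsFeynman1PI) {D D' D'' : G.EdgeSet}
    (hD : D ∈ G.divergentSubgraphs) (hD' : IsDivergent D') (hD'' : IsDivergent D'')
    (h' : D.1 ⊆ D'.1) (h'' : D.1 ⊆ D''.1) (heq : shrinkEdges D D' = shrinkEdges D D'') :
    D' = D'' := by
  obtain ⟨-, -, hd, hn⟩ := mem_divergentSubgraphs.1 hD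
  have hone := ((isDivergent_iff hG.1 D).1 hd).2.oneBrokenFace
  have hs' := saturated_contractEdges hone ((isDivergent_iff hG.1 D').1 hD').1
  have hs'' := saturated_contractEdges hone ((isDivergent_iff hG.1 D'').1 hD'').1
  refine Subtype.ext (Set.ext fun z => ?_)
  by_cases hz : z ∈ D.1
  · exact iff_of_true (h' hz) (h'' hz)
  · obtain ⟨x, hx⟩ := exists_chain_shrink hone hG.2.1 hn ⟨z, hz⟩
    calc z ∈ D'.1 ↔ x.1.1 ∈ D'.1 := hs'.mem_iff_of_chain hx
      _ ↔ x ∈ (shrinkEdges D D').1 := (mem_shrinkEdges hs' x).symm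
      _ ↔ x ∈ (shrinkEdges D D'').1 := by rw [heq]
      _ ↔ x.1.1 ∈ D''.1 := mem_shrinkEdges hs'' x
      _ ↔ z ∈ D''.1 := (hs''.mem_iff_of_chain hx).symm

theorem exists_shrinkEdges_eq (hG : G.IsFeynman1PI) {D : G.EdgeSet}
    (hD : D ∈ G.divergentSubgraphs) {E : (G.shrink D).EdgeSet}
    (hE : E ∈ (G.shrink D).divergentSubgraphs) :
    ∃ D' ∈ G.divergentSubgraphs, D.1 ⊂ D'.1 ∧ shrinkEdges D D' = E := by
  obtain ⟨hne, -, hd, -⟩ := mem_divergentSubgraphs.1 hD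
  obtain ⟨⟨y, hy⟩, hEne, hEd, hEn⟩ := mem_divergentSubgraphs.1 hE
  have hone := ((isDivergent_iff hG.1 D).1 hd).2.oneBrokenFace
  have hN := noHalfExternal_contract hone (is1PI_iff.1 hG.2).2.2
  let D' := unionLift hN E
  have hd' : IsDivergent D' := isDivergent_unionLift hG.1 hd hN E hEd
  have hsub : D.1 ⊆ D'.1 := subset_unionLift hN E
  have heq : shrinkEdges D D' = E := shrinkEdges_unionLift hN E
  have hs := saturated_contractEdges hone ((isDivergent_iff hG.1 D').1 hd').1
  have hmem (x : (G.shrink D).HalfEdge) : x ∈ E.1 ↔ x.1.1 ∈ D'.1 := by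
    rw [← mem_shrinkEdges hs x, heq]
  have hne_all : D'.1 ≠ G.allEdges.1 := by
    intro hall
    obtain ⟨x, hx, hxf⟩ := exists_notMem_of_ne_allEdges hEne
    refine hx ((hmem x).2 (hall ▸ fun hf => ?_))
    exact hxf ((hN.erase_flip_eq_iff x).2 (Subtype.ext hf))
  have hn' : Nonempty (G.shrink D').HalfEdge :=
    (isomorphic_shrink_shrink hsub hs).nonempty (by rwa [heq])
  exact ⟨D', mem_divergentSubgraphs.2 ⟨hne.mono hsub, hne_all, hd', hn'⟩,
    ⟨hsub, fun h => y.1.2 (h ((hmem y).1 hy))⟩, heq⟩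

/-- The empty edge set. -/
def noEdges (G : RibbonGraph) : G.EdgeSet := ⟨∅, fun _ h => h.elim⟩

theorem isDivergent_noEdges : IsDivergent G.noEdges := by
  rintro ⟨c, h, hh, -⟩
  exact hh.elim

theorem contract_noEdges_rot (x : (G.contract G.noEdges).HalfEdge) :
    ((G.contract G.noEdges).rot x).1 = G.rot x.1 := by
  have happly : (G.rot * G.flipOn G.noEdges) x.1 = G.rot x.1 := by
    rw [Equiv.Perm.mul_apply, flipOn_of_notMem G.noEdges x.2]
  exact (contract_rot_returns _ x).unique (.of_apply_eq happly fun h => h.elim)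

/-- Contracting nothing changes nothing. -/
def embContractNoEdges (G : RibbonGraph) : Emb (G.contract G.noEdges) G where
  toFun := Subtype.val
  injective := Subtype.val_injective
  map_flip _ := rfl
  map_rot := Or.inl contract_noEdges_rot

theorem IsQuartic.notMem_bivalent_contract_noEdges (hG : G.IsQuartic)
    (x : (G.contract G.noEdges).HalfEdge) : x ∉ (G.contract G.noEdges).bivalent := by
  intro hx
  have h2 := (mem_bivalent_iff _).1 ((G.embContractNoEdges.mem_bivalent_iff x).1 hx)
  rw [hG] at h2
  omega

theorem shrink_noEdges_flip (hG : G.IsQuartic) (x : (G.shrink G.noEdges).HalfEdge) :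
    ((G.shrink G.noEdges).flip x).1 = (G.contract G.noEdges).flip x.1 := by
  have happly : ((G.contract G.noEdges).flip * (G.contract G.noEdges).crossBivalent) x.1 =
      (G.contract G.noEdges).flip x.1 := by
    rw [Equiv.Perm.mul_apply, crossBivalent_of_notMem x.2]
  exact (erase_flip_returns x).unique
    (.of_apply_eq happly (hG.notMem_bivalent_contract_noEdges _))

theorem exists_emb_shrink_noEdges (hG : G.IsQuartic) :
    ∃ m : Emb (G.shrink G.noEdges) G, Function.Bijective m := by
  let m : Emb (G.shrink G.noEdges) G :=
    { toFun := fun x => x.1.1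
      injective := Subtype.val_injective.comp Subtype.val_injective
      map_flip := fun x => congrArg Subtype.val (shrink_noEdges_flip hG x)
      map_rot := Or.inl fun x => contract_noEdges_rot x.1 }
  exact ⟨m, m.injective,
    fun y => ⟨⟨⟨y, fun h => h.elim⟩, hG.notMem_bivalent_contract_noEdges _⟩, rfl⟩⟩

theorem shrink_allEdges_flip (x : (G.shrink G.allEdges).HalfEdge) :
    (G.shrink G.allEdges).flip x = x :=
  erase_flip_eq_of_flip_eq (Subtype.ext (not_not.1 x.1.2))

theorem flip_ne_of_shrink_flip_ne {D : G.EdgeSet} {x : (G.shrink D).HalfEdge}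
    (hx : (G.shrink D).flip x ≠ x) : G.flip x.1.1 ≠ x.1.1 :=
  fun h => hx (erase_flip_eq_of_flip_eq (Subtype.ext h))

theorem eq_allEdges_of_forall_conn {D : G.EdgeSet} (hc : G.IsConnected) {h : G.HalfEdge}
    (hD : ∀ z, (G.cutOutside D).connSetoid h z → z ∉ D.1 → G.flip z = z) :
    D.1 = G.allEdges.1 := by
  have hconn (z : G.HalfEdge) : (G.cutOutside D).connSetoid h z := by
    refine (mem_iff_of_conn (G := G) (A := {z | (G.cutOutside D).connSetoid h z}) (fun w hw => ?_)
      (fun w hw => ?_) (hc.2 h z)).1 ((G.cutOutside D).connSetoid.refl h)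
    · exact Setoid.trans' _ hw ((G.cutOutside D).connSetoid_rot w)
    · by_cases hwD : w ∈ D.1
      · exact Setoid.trans' _ hw (conn_cutOutside_flip hwD)
      · change (G.cutOutside D).connSetoid h (G.flip w)
        rwa [hD w hw hwD]
  exact (subset_allEdges D).antisymm fun z hz => by_contra fun hzD => hz (hD z (hconn z) hzD)

theorem nonempty_shrink (hG : G.IsFeynman1PI) (hext : ∃ h, G.flip h = h) {D : G.EdgeSet}
    (hD : IsDivergent D) (hne : D.1 ≠ G.allEdges.1) : Nonempty (G.shrink D).HalfEdge := by
  obtain ⟨h, hh⟩ := hext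
  have hone := ((isDivergent_iff hG.1 D).1 hD).2.oneBrokenFace
  have hN := noHalfExternal_contract hone (is1PI_iff.1 hG.2).2.2
  let x : (G.contract D).HalfEdge := ⟨h, fun h' => (D.2 h h').2 hh⟩
  by_contra hempty
  have hbiv : x ∈ (G.contract D).bivalent := by_contra fun hnb => hempty ⟨⟨x, hnb⟩⟩
  refine hne (eq_allEdges_of_forall_conn hG.2.1 (h := h) fun z hz hzD => ?_)
  rcases eq_or_eq_rot_of_bivalent hone (z := ⟨z, hzD⟩) hbiv hz with h1 | h1
  · rw [show z = h from congrArg Subtype.val h1, hh]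
  · have h2 := hN x hbiv (Subtype.ext hh)
    rw [← h1] at h2
    exact congrArg Subtype.val h2

theorem locallyDivergent_of_isConnected (hc : G.IsConnected) (hG : G.IsPrimitivelyDivergent) :
    G.LocallyDivergent := fun c =>
  ((Emb.ofComponent G c).isomorphic_of_isConnected (isConnected_component c)
    hc).isPrimitivelyDivergent_iff.2 hG

theorem isDivergent_allEdges (hG : G.IsFeynman1PI) (hd : G.IsPrimitivelyDivergent) :
    IsDivergent G.allEdges := by
  rw [isDivergent_iff hG.1, cutOutside_allEdges]
  exact ⟨(is1PI_iff.1 hG.2).2.2, locallyDivergent_of_isConnected hG.2.1 hd⟩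

/-! ### Isomorphic graphs have the same divergent subgraphs -/

theorem Emb.isDivergent_pullEdges_iff (m : Emb B A) (hm : Function.Surjective m)
    (E : A.EdgeSet) : IsDivergent (m.pullEdges E) ↔ IsDivergent E := by
  have hE : ∀ x, x ∈ (m.pullEdges E).1 ↔ m x ∈ E.1 := fun _ => Iff.rfl
  have hiso (c : B.SubComponent (m.pullEdges E)) :
      ((B.subComponent _ c).Is1PI ∧ (B.subComponent _ c).IsPrimitivelyDivergent) ↔
        (A.subComponent E (m.subComponentMap hE c)).Is1PI ∧
          (A.subComponent E (m.subComponentMap hE c)).IsPrimitivelyDivergent :=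
    have h := m.isomorphic_subComponent hE c
    and_congr ⟨h.is1PI, h.symm.is1PI⟩ h.isPrimitivelyDivergent_iff
  refine ⟨?_, fun h c => (hiso c).2 (h _)⟩
  rintro h ⟨_, y, hy, rfl⟩
  obtain ⟨x, rfl⟩ := hm y
  exact (hiso ⟨_, x, hy, rfl⟩).1 (h _)

theorem Emb.isomorphic_shrink (m : Emb B A) (hm : Function.Surjective m) (E : A.EdgeSet) :
    Isomorphic (B.shrink (m.pullEdges E)) (A.shrink E) := by
  refine (m.shrink (F := m.pullEdges E) (E := E) fun _ => Iff.rfl).isomorphic_of_surjective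
    (Emb.eraseBivalent_surjective _ fun y => ?_)
  obtain ⟨x, hx⟩ := hm y.1
  exact ⟨⟨x, fun h => y.2 (hx ▸ h)⟩, Subtype.ext hx⟩

theorem Emb.pullEdges_nonempty_iff (m : Emb B A) (hm : Function.Surjective m) (E : A.EdgeSet) :
    (m.pullEdges E).1.Nonempty ↔ E.1.Nonempty :=
  (hm.exists (p := fun y => y ∈ E.1)).symm

theorem Emb.pullEdges_eq_allEdges_iff (m : Emb B A) (hm : Function.Surjective m)
    (E : A.EdgeSet) : (m.pullEdges E).1 = B.allEdges.1 ↔ E.1 = A.allEdges.1 := by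
  rw [Set.ext_iff, Set.ext_iff, hm.forall]
  exact forall_congr' fun x =>
    iff_congr Iff.rfl (not_congr (m.flip_eq_iff x).symm)

theorem Emb.pullEdges_mem_iff (m : Emb B A) (hm : Function.Surjective m) (E : A.EdgeSet) :
    m.pullEdges E ∈ B.divergentSubgraphs ↔ E ∈ A.divergentSubgraphs := by
  rw [mem_divergentSubgraphs, mem_divergentSubgraphs, m.isDivergent_pullEdges_iff hm,
    m.pullEdges_nonempty_iff hm, ne_eq, m.pullEdges_eq_allEdges_iff hm]
  have hiso := m.isomorphic_shrink hm E
  exact and_congr_right fun _ => and_congr_right fun _ => and_congr_right fun _ =>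
    ⟨hiso.nonempty, hiso.symm.nonempty⟩

theorem Emb.pullEdges_injective (m : Emb B A) (hm : Function.Surjective m) :
    Function.Injective m.pullEdges :=
  fun _ _ h => Subtype.ext (hm.preimage_injective (congrArg Subtype.val h))

theorem Emb.pullEdges_surjective (m : Emb B A) : Function.Surjective m.pullEdges := by
  intro F
  refine ⟨⟨m '' F.1, ?_⟩, Subtype.ext (m.injective.preimage_image F.1)⟩
  rintro _ ⟨x, hx, rfl⟩
  exact ⟨⟨B.flip x, (F.2 x hx).1, m.map_flip x⟩, fun h => (F.2 x hx).2 ((m.flip_eq_iff x).1 h)⟩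

/-! ### Components with internal edges -/

/-- The connected components that have internal edges. -/
abbrev EdgeComponent (A : RibbonGraph) : Type :=
  {c : Quotient A.connSetoid // ∃ h, A.flip h ≠ h ∧ Quotient.mk A.connSetoid h = c}

instance (A : RibbonGraph) : Finite A.EdgeComponent :=
  inferInstanceAs (Finite {c : Quotient A.connSetoid //
    ∃ h, A.flip h ≠ h ∧ Quotient.mk A.connSetoid h = c})

instance (A : RibbonGraph) : Fintype A.EdgeComponent := Fintype.ofFinite _

/-- The component of an internal edge. -/
def edgeComponentOf (h : A.HalfEdge) (hh : A.flip h ≠ h) : A.EdgeComponent :=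
  ⟨Quotient.mk _ h, h, hh, rfl⟩

/-- The map that an embedding induces on the components with internal edges. -/
def Emb.edgeComponentMap (m : Emb B A) (c : B.EdgeComponent) : A.EdgeComponent :=
  ⟨Quotient.map m (fun x y => (m.conn_iff x y).1) c.1, by
    obtain ⟨c, x, hx, rfl⟩ := c
    exact ⟨m x, mt (m.flip_eq_iff x).1 hx, rfl⟩⟩

theorem Emb.isomorphic_edgeComponent (m : Emb B A) (c : B.EdgeComponent) :
    Isomorphic (B.component c.1) (A.component (m.edgeComponentMap c).1) := by
  obtain ⟨_, x, hx, rfl⟩ := c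
  exact m.isomorphic_component_map x

/-- The edge sets of the divergent subgraphs, the empty and the full one included. -/
def divergentSets (G : RibbonGraph) : Finset G.EdgeSet :=
  Set.Finite.toFinset (s := {D : G.EdgeSet | IsDivergent D}) (Set.toFinite _)

theorem mem_divergentSets {D : G.EdgeSet} : D ∈ G.divergentSets ↔ IsDivergent D :=
  Set.Finite.mem_toFinset _

theorem isDivergent_iff_componentEdges {F : A.EdgeSet} :
    IsDivergent F ↔ ∀ c : A.EdgeComponent, IsDivergent (componentEdges F c.1) := by
  have hiso (c : Quotient A.connSetoid) (d : (A.component c).SubComponent (componentEdges F c)) :=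
    (Emb.ofComponent A c).isomorphic_subComponent (F := componentEdges F c) (E := F)
      (fun _ => Iff.rfl) d
  constructor
  · intro h c d
    exact ⟨(hiso c.1 d).symm.is1PI (h _).1, (hiso c.1 d).isPrimitivelyDivergent_iff.2 (h _).2⟩
  · rintro h ⟨_, y, hy, rfl⟩
    let c := edgeComponentOf y (F.2 y hy).2
    let d : (A.component c.1).SubComponent (componentEdges F c.1) := ⟨_, ⟨y, rfl⟩, hy, rfl⟩
    exact ⟨(hiso c.1 d).is1PI (h c d).1, (hiso c.1 d).isPrimitivelyDivergent_iff.1 (h c d).2⟩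

/-- The union of edge sets of the components. -/
def unionComponents (p : ∀ c : A.EdgeComponent, (A.component c.1).EdgeSet) : A.EdgeSet :=
  ⟨{h | ∃ (c : A.EdgeComponent) (x : (A.component c.1).HalfEdge), x ∈ (p c).1 ∧ x.1 = h}, by
    rintro _ ⟨c, x, hx, rfl⟩
    exact ⟨⟨c, (A.component c.1).flip x, ((p c).2 x hx).1, rfl⟩,
      fun h => ((p c).2 x hx).2 (Subtype.ext h)⟩⟩

theorem componentEdges_unionComponents
    (p : ∀ c : A.EdgeComponent, (A.component c.1).EdgeSet) (c : A.EdgeComponent) :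
    componentEdges (unionComponents p) c.1 = p c := by
  refine Subtype.ext (Set.ext fun x => ⟨?_, fun h => ⟨c, x, h, rfl⟩⟩)
  rintro ⟨c', x', hx', heq⟩
  have hval : x'.1 = x.1 := heq
  have hc : c' = c := Subtype.ext (by rw [← x.2, ← x'.2, hval])
  subst hc
  rwa [← Subtype.ext hval]

theorem eq_of_componentEdges_eq {F F' : A.EdgeSet}
    (h : ∀ c : A.EdgeComponent, componentEdges F c.1 = componentEdges F' c.1) : F = F' := by
  have subset {F F' : A.EdgeSet}
      (h : ∀ c : A.EdgeComponent, componentEdges F c.1 = componentEdges F' c.1) :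
      F.1 ⊆ F'.1 := fun y hy => by
    have hc := congrArg Subtype.val (h (edgeComponentOf y (F.2 y hy).2))
    exact (Set.ext_iff.1 hc ⟨y, rfl⟩).1 hy
  exact Subtype.ext ((subset h).antisymm (subset fun c => (h c).symm))

theorem divergentSets_eq_insert [DecidableEq A.EdgeSet] (hA : IsDivergent A.allEdges)
    {s : Finset A.EdgeSet}
    (hs : ∀ F, F ∈ s ↔ IsDivergent F ∧ F.1.Nonempty ∧ F.1 ≠ A.allEdges.1) :
    A.divergentSets = insert A.allEdges (insert A.noEdges s) := by
  ext F
  rw [mem_divergentSets, Finset.mem_insert, Finset.mem_insert, hs]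
  constructor
  · intro h
    by_cases hall : F.1 = A.allEdges.1
    · exact Or.inl (Subtype.ext hall)
    · rcases Set.eq_empty_or_nonempty F.1 with hempty | hne
      · exact Or.inr (Or.inl (Subtype.ext hempty))
      · exact Or.inr (Or.inr ⟨h, hne, hall⟩)
  · rintro (rfl | rfl | h)
    · exact hA
    · exact isDivergent_noEdges
    · exact h.1

theorem sum_divergentSets {M : Type*} [AddCommMonoid M] (f : A.EdgeSet → M)
    (hA : IsDivergent A.allEdges) (hne : ∃ x, A.flip x ≠ x) {s : Finset A.EdgeSet}
    (hs : ∀ F, F ∈ s ↔ IsDivergent F ∧ F.1.Nonempty ∧ F.1 ≠ A.allEdges.1) :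
    ∑ F ∈ A.divergentSets, f F = f A.allEdges + f A.noEdges + ∑ F ∈ s, f F := by
  classical
  have hno : A.noEdges ∉ s := fun h => ((hs _).1 h).2.1.ne_empty rfl
  have hall : A.allEdges ∉ insert A.noEdges s := by
    rw [Finset.mem_insert, not_or]
    refine ⟨fun h => ?_, fun h => ((hs _).1 h).2.2 rfl⟩
    obtain ⟨x, hx⟩ := hne
    exact (Set.ext_iff.1 (congrArg Subtype.val h) x).1 hx
  rw [divergentSets_eq_insert hA hs, Finset.sum_insert hall, Finset.sum_insert hno, add_assoc]

theorem IsPrimitivelyDivergent.exists_flip_eq (h : G.IsPrimitivelyDivergent) :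
    ∃ x, G.flip x = x :=
  (numBrokenFaces_eq_one_iff.1 h.2.1).2

/-- An edge set of a graph with edges cut, as an edge set of the graph. -/
def uncutEdges {D : G.EdgeSet} (F : (G.cutOutside D).EdgeSet) : G.EdgeSet :=
  ⟨F.1, fun x hx => by
    have hxD : x ∈ D.1 := (flipOn_ne_iff D x).1 (F.2 x hx).2
    have hflip : (G.cutOutside D).flip x = G.flip x := flipOn_of_mem D hxD
    exact hflip ▸ F.2 x hx⟩

theorem uncutEdges_subset {D : G.EdgeSet} (F : (G.cutOutside D).EdgeSet) :
    (uncutEdges F).1 ⊆ D.1 := fun x hx => (flipOn_ne_iff D x).1 (F.2 x hx).2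

theorem allEdges_cutOutside (D : G.EdgeSet) : (G.cutOutside D).allEdges.1 = D.1 :=
  Set.ext fun x => flipOn_ne_iff D x

theorem isDivergent_cutEdges_iff (hG : G.IsQuartic) {D D' : G.EdgeSet} (h : D.1 ⊆ D'.1) :
    IsDivergent (cutEdges D D' h) ↔ IsDivergent D := by
  rw [isDivergent_iff (G := G.cutOutside D') hG, isDivergent_iff hG, cutOutside_cutEdges]

theorem isomorphic_out_mk (hG : G.IsFeynman1PI) :
    Isomorphic (Quotient.mk feynmanSetoid ⟨G, hG⟩).out.1 G :=
  Quotient.mk_out (s := feynmanSetoid) ⟨G, hG⟩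

theorem isFeynman1PI_component (hq : A.IsQuartic) (hA : A.Bridgeless) (c : A.EdgeComponent) :
    (A.component c.1).IsFeynman1PI := by
  obtain ⟨x, hx, hxc⟩ := c.2
  exact ⟨isQuartic_component hq c.1,
    (is1PI_component_iff c.1).2 ⟨⟨⟨x, hxc⟩, hx⟩, bridgeless_iff_component.1 hA c.1⟩⟩

theorem sum_uncutEdges {M : Type*} [AddCommMonoid M] (hG : G.IsQuartic) {D : G.EdgeSet}
    (hD : D ∈ G.divergentSubgraphs) {s : Finset G.EdgeSet}
    (hs : ∀ D', D' ∈ s ↔ D' ∈ G.divergentSubgraphs ∧ D'.1 ⊂ D.1)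
    {t : Finset (G.cutOutside D).EdgeSet} (ht : ∀ F, F ∈ t ↔
      IsDivergent F ∧ F.1.Nonempty ∧ F.1 ≠ (G.cutOutside D).allEdges.1) (f : G.EdgeSet → M) :
    ∑ F ∈ t, f (uncutEdges F) = ∑ D' ∈ s, f D' := by
  have hdiv (F : (G.cutOutside D).EdgeSet) : IsDivergent F ↔ IsDivergent (uncutEdges F) :=
    isDivergent_cutEdges_iff hG (uncutEdges_subset F)
  refine Finset.sum_bij (fun F _ => uncutEdges F) (fun F hF => ?mem)
    (fun F _ F' _ h => Subtype.ext (congrArg (fun E : G.EdgeSet => E.1) h))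
    (fun D' hD' => ?surjective) (fun F _ => rfl)
  case mem =>
    rw [ht, hdiv, allEdges_cutOutside] at hF
    exact (hs _).2 ⟨mem_divergentSubgraphs_of_subset hG hD hF.1 hF.2.1 (uncutEdges_subset F),
      (uncutEdges_subset F).ssubset_of_ne hF.2.2⟩
  case surjective =>
    obtain ⟨hD', hlt⟩ := (hs _).1 hD'
    obtain ⟨hne, -, hdiv', -⟩ := mem_divergentSubgraphs.1 hD'
    refine ⟨cutEdges D' D hlt.1, ?_, rfl⟩
    rw [ht, isDivergent_cutEdges_iff hG, allEdges_cutOutside]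
    exact ⟨hdiv', hne, hlt.ne⟩

end RibbonGraph

namespace HStar

open RibbonGraph

variable (K : Type*) [Field K] {A B G : RibbonGraph}

theorem ofGraph_eq (h : G.IsFeynman1PI) :
    ofGraph K G = MvPolynomial.X (Quotient.mk feynmanSetoid ⟨G, h⟩) := dif_pos h

theorem ofGraph_out (g : FeynmanClass) : ofGraph K g.out.1 = MvPolynomial.X g := by
  rw [ofGraph_eq K g.out.2]
  exact congrArg _ (Quotient.out_eq g)

theorem ofGraph_eq_of_isomorphic (h : Isomorphic A B) : ofGraph K A = ofGraph K B := by
  by_cases hA : A.IsFeynman1PI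
  · rw [ofGraph_eq K hA, ofGraph_eq K (h.isFeynman1PI hA)]
    exact congrArg _ (Quotient.sound h)
  · rw [ofGraph, dif_neg hA, ofGraph, dif_neg fun hB => hA (h.symm.isFeynman1PI hB)]

/-- The product of the components that have internal edges. It is multiplicative under disjoint
unions and ignores vertices without internal edges, so it can be applied to a graph with edges cut
as well as to a cograph. -/
def ofComponents (A : RibbonGraph) : HStar K := ∏ c : A.EdgeComponent, ofGraph K (A.component c.1)

theorem ofSubgraph_eq (D : G.EdgeSet) : ofSubgraph K G D = ofComponents K (G.cutOutside D) := by
  let e : G.SubComponent D ≃ (G.cutOutside D).EdgeComponent :=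
    Equiv.subtypeEquivRight fun c => exists_congr fun h => and_congr_left' (flipOn_ne_iff D h).symm
  exact Fintype.prod_equiv e _ _ fun c => rfl

theorem ofComponents_eq_prod {ι : Type*} [Fintype ι] {B : ι → RibbonGraph} (m : ∀ i, Emb (B i) A)
    (hm : ∀ y, A.flip y ≠ y → ∃! i, ∃ x, m i x = y) :
    ofComponents K A = ∏ i, ofComponents K (B i) := by
  simp only [ofComponents]
  rw [← Fintype.prod_sigma']
  refine (Fintype.prod_bijective
    (fun p : Σ i, (B i).EdgeComponent => (m p.1).edgeComponentMap p.2) ⟨?injective, ?surjective⟩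
    _ _ fun p => ofGraph_eq_of_isomorphic K ((m p.1).isomorphic_edgeComponent p.2)).symm
  case injective =>
    rintro ⟨i, _, x, hx, rfl⟩ ⟨j, _, y, hy, rfl⟩ heq
    have hxy : A.connSetoid (m i x) (m j y) := Quotient.exact (congrArg Subtype.val heq)
    obtain ⟨z, hz, -⟩ := (m i).exists_of_conn hxy
    obtain rfl : i = j := (hm (m j y) (mt ((m j).flip_eq_iff y).1 hy)).unique ⟨z, hz⟩ ⟨y, rfl⟩
    exact congrArg _ (Subtype.ext (Quotient.sound (((m i).conn_iff x y).2 hxy)))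
  case surjective =>
    rintro ⟨_, y, hy, rfl⟩
    obtain ⟨i, ⟨x, rfl⟩, -⟩ := hm y hy
    exact ⟨⟨i, edgeComponentOf x (mt ((m i).flip_eq_iff x).2 hy)⟩, rfl⟩

theorem ofComponents_eq_of_emb (m : Emb B A) (hm : Function.Surjective m) :
    ofComponents K A = ofComponents K B := by
  rw [ofComponents_eq_prod K (B := fun _ : Unit => B) (fun _ => m)
    fun y _ => ⟨(), hm y, fun _ _ => rfl⟩]
  exact Fintype.prod_unique _

theorem ofComponents_eq_one (h : ∀ x, A.flip x = x) : ofComponents K A = 1 := by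
  have : IsEmpty A.EdgeComponent := ⟨fun ⟨_, x, hx, _⟩ => hx (h x)⟩
  exact Fintype.prod_empty _

theorem ofComponents_of_isConnected (hA : A.IsConnected) (h : ∃ x, A.flip x ≠ x) :
    ofComponents K A = ofGraph K A := by
  obtain ⟨x, hx⟩ := h
  have : Unique A.EdgeComponent :=
    { default := edgeComponentOf x hx
      uniq := by
        rintro ⟨_, y, hy, rfl⟩
        exact Subtype.ext (Quotient.sound (hA.2 _ _)) }
  rw [ofComponents, Fintype.prod_unique]
  exact ofGraph_eq_of_isomorphic K
    ((Emb.ofComponent A _).isomorphic_of_isConnected (isConnected_component _) hA)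

theorem ofComponents_cutOutside_noEdges : ofComponents K (A.cutOutside A.noEdges) = 1 :=
  ofComponents_eq_one K fun _ => flipOn_of_notMem A.noEdges fun h => h.elim

theorem ofComponents_shrink_allEdges : ofComponents K (A.shrink A.allEdges) = 1 :=
  ofComponents_eq_one K shrink_allEdges_flip

theorem ofComponents_shrink_noEdges (hA : A.IsQuartic) :
    ofComponents K (A.shrink A.noEdges) = ofComponents K A := by
  obtain ⟨m, hm⟩ := exists_emb_shrink_noEdges hA
  exact (ofComponents_eq_of_emb K m hm.2).symm

theorem ofComponents_cutOutside_eq_prod (F : A.EdgeSet) :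
    ofComponents K (A.cutOutside F) = ∏ c : A.EdgeComponent,
      ofComponents K ((A.component c.1).cutOutside (componentEdges F c.1)) := by
  refine ofComponents_eq_prod K (fun c : A.EdgeComponent => (Emb.ofComponent A c.1).cutOutside
    (F := componentEdges F c.1) (E := F) fun _ => Iff.rfl) fun y hy => ?_
  have hyF : y ∈ F.1 := (flipOn_ne_iff F y).1 hy
  refine ⟨edgeComponentOf y (F.2 y hyF).2, ⟨⟨y, rfl⟩, rfl⟩, ?_⟩
  rintro c ⟨x, rfl⟩
  exact Subtype.ext x.2.symm

theorem ofComponents_shrink_eq_prod (F : A.EdgeSet) :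
    ofComponents K (A.shrink F) = ∏ c : A.EdgeComponent,
      ofComponents K ((A.component c.1).shrink (componentEdges F c.1)) := by
  refine ofComponents_eq_prod K (fun c : A.EdgeComponent => embShrinkComponent F c.1)
    fun y hy => ⟨edgeComponentOf y.1.1 (flip_ne_of_shrink_flip_ne hy),
      exists_embShrinkComponent_eq F y, ?_⟩
  rintro c ⟨x, rfl⟩
  exact Subtype.ext x.1.1.2.symm

/-! ### The structure maps on graphs -/

theorem reducedCoproduct_eq_of_isomorphic (h : Isomorphic A B) :
    reducedCoproduct K A = reducedCoproduct K B := by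
  obtain ⟨m, hm⟩ := h.exists_emb
  symm
  refine Finset.sum_bij (fun D _ => m.pullEdges D)
    (fun D => (m.pullEdges_mem_iff hm.2 D).2)
    (fun D _ D' _ h => m.pullEdges_injective hm.2 h) (fun F hF => ?_) (fun D _ => ?_)
  · obtain ⟨D, rfl⟩ := m.pullEdges_surjective F
    exact ⟨D, (m.pullEdges_mem_iff hm.2 D).1 hF, rfl⟩
  · rw [ofSubgraph_eq, ofSubgraph_eq, ofGraph_eq_of_isomorphic K (m.isomorphic_shrink hm.2 D),
      ofComponents_eq_of_emb K (m.cutOutside (F := m.pullEdges D) (E := D) fun _ => Iff.rfl) hm.2]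

theorem coproduct_ofGraph (hG : G.IsFeynman1PI) :
    coproduct K (ofGraph K G) =
      ofGraph K G ⊗ₜ[K] 1 + 1 ⊗ₜ[K] ofGraph K G + reducedCoproduct K G := by
  rw [ofGraph_eq K hG, coproduct, MvPolynomial.aeval_X,
    reducedCoproduct_eq_of_isomorphic K (isomorphic_out_mk hG)]

theorem counit_ofGraph (G : RibbonGraph) : counit K (ofGraph K G) = 0 := by
  by_cases hG : G.IsFeynman1PI
  · rw [ofGraph_eq K hG, counit, MvPolynomial.aeval_X]
  · rw [ofGraph, dif_neg hG, map_zero]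

theorem map_ofSubgraph_eq_zero {C : Type*} [CommSemiring C] [Algebra K C] (f : HStar K →ₐ[K] C)
    {D : G.EdgeSet} (hD : D.1.Nonempty) (h : ∀ c, f (ofGraph K (G.subComponent D c)) = 0) :
    f (ofSubgraph K G D) = 0 := by
  obtain ⟨x, hx⟩ := hD
  rw [ofSubgraph, map_prod]
  exact Finset.prod_eq_zero (Finset.mem_univ ⟨_, x, hx, rfl⟩) (h _)

theorem antipodeGen_eq (g : FeynmanClass) :
    antipodeGen K g = - MvPolynomial.X g - ∑ D ∈ g.out.1.divergentSubgraphs,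
      antipode K (ofSubgraph K g.out.1 D) * ofGraph K (g.out.1.shrink D) := by
  classical
  have hcomponent (H : RibbonGraph) : antipode K (ofGraph K H) =
      if h : H.IsFeynman1PI then antipodeGen K (Quotient.mk feynmanSetoid ⟨H, h⟩) else 0 := by
    split_ifs with h
    · rw [ofGraph_eq K h, antipode, MvPolynomial.aeval_X]
    · rw [ofGraph, dif_neg h, map_zero]
  rw [antipodeGen, ← Finset.sum_attach g.out.1.divergentSubgraphs]
  simp only [ofSubgraph, map_prod, hcomponent]

theorem sum_antipode_mul_ofGraph (G : RibbonGraph) :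
    ∑ D ∈ G.divergentSubgraphs, antipode K (ofSubgraph K G D) * ofGraph K (G.shrink D) =
      Algebra.TensorProduct.productMap (antipode K) (AlgHom.id K _) (reducedCoproduct K G) := by
  simp only [reducedCoproduct, map_sum, Algebra.TensorProduct.productMap_apply_tmul,
    AlgHom.id_apply]

theorem antipode_ofGraph (hG : G.IsFeynman1PI) :
    antipode K (ofGraph K G) = - ofGraph K G - ∑ D ∈ G.divergentSubgraphs,
      antipode K (ofSubgraph K G D) * ofGraph K (G.shrink D) := by
  rw [sum_antipode_mul_ofGraph,
    ← reducedCoproduct_eq_of_isomorphic K (isomorphic_out_mk hG), ← sum_antipode_mul_ofGraph,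
    ofGraph_eq K hG, ← antipodeGen_eq, antipode, MvPolynomial.aeval_X]

/-! ### The coproduct of divergent graphs -/

theorem coproduct_ofGraph_of_isPrimitivelyDivergent (hG : G.IsFeynman1PI)
    (hd : G.IsPrimitivelyDivergent) :
    coproduct K (ofGraph K G) = ∑ D ∈ G.divergentSets,
      ofComponents K (G.cutOutside D) ⊗ₜ[K] ofComponents K (G.shrink D) := by
  have hcomponents := ofComponents_of_isConnected K hG.2.1 hG.2.2.1
  have hmem (F : G.EdgeSet) : F ∈ G.divergentSubgraphs ↔
      IsDivergent F ∧ F.1.Nonempty ∧ F.1 ≠ G.allEdges.1 := by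
    rw [mem_divergentSubgraphs]
    exact ⟨fun ⟨hne, hfull, hdiv, _⟩ => ⟨hdiv, hne, hfull⟩, fun ⟨hdiv, hne, hfull⟩ =>
      ⟨hne, hfull, hdiv, nonempty_shrink hG hd.exists_flip_eq hdiv hfull⟩⟩
  rw [sum_divergentSets _ (isDivergent_allEdges hG hd) hG.2.2.1 hmem,
    cutOutside_allEdges, ofComponents_shrink_allEdges, ofComponents_cutOutside_noEdges,
    ofComponents_shrink_noEdges K hG.1, hcomponents, coproduct_ofGraph K hG, reducedCoproduct]
  congr 1
  refine Finset.sum_congr rfl fun D hD => ?_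
  obtain ⟨-, hfull, hdiv, hne⟩ := mem_divergentSubgraphs.1 hD
  have hshrink := isFeynman1PI_shrink hG hfull hdiv hne
  rw [ofSubgraph_eq, ofComponents_of_isConnected K hshrink.2.1 hshrink.2.2.1]

theorem prod_tmul {R ι S T : Type*} [CommSemiring R] [CommSemiring S] [CommSemiring T]
    [Algebra R S] [Algebra R T] (s : Finset ι) (a : ι → S) (b : ι → T) :
    ∏ i ∈ s, (a i ⊗ₜ[R] b i) = (∏ i ∈ s, a i) ⊗ₜ[R] ∏ i ∈ s, b i := by
  classical
  induction s using Finset.induction_on with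
  | empty => rfl
  | insert i s hi ih =>
    rw [Finset.prod_insert hi, Finset.prod_insert hi, Finset.prod_insert hi, ih,
      Algebra.TensorProduct.tmul_mul_tmul]

theorem coproduct_ofComponents (hq : A.IsQuartic) (hA : IsDivergent A.allEdges) :
    coproduct K (ofComponents K A) = ∑ F ∈ A.divergentSets,
      ofComponents K (A.cutOutside F) ⊗ₜ[K] ofComponents K (A.shrink F) := by
  classical
  rw [isDivergent_iff hq, cutOutside_allEdges] at hA
  have hcomponent (c : A.EdgeComponent) := coproduct_ofGraph_of_isPrimitivelyDivergent K
    (isFeynman1PI_component hq hA.1 c) (hA.2 c.1)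
  rw [ofComponents, map_prod, Finset.prod_congr rfl fun c _ => hcomponent c,
    Finset.prod_univ_sum]
  symm
  refine Finset.sum_bij (fun F _ c => componentEdges F c.1) (fun F hF => ?mem)
    (fun F _ F' _ h => eq_of_componentEdges_eq fun c => congrFun h c) (fun p hp => ?surjective)
    (fun F _ => ?term)
  case mem =>
    exact Fintype.mem_piFinset.2 fun c => mem_divergentSets.2
      (isDivergent_iff_componentEdges.1 (mem_divergentSets.1 hF) c)
  case surjective =>
    refine ⟨unionComponents p, mem_divergentSets.2 (isDivergent_iff_componentEdges.2 fun c => ?_),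
      funext fun c => componentEdges_unionComponents p c⟩
    rw [componentEdges_unionComponents]
    exact mem_divergentSets.1 (Fintype.mem_piFinset.1 hp c)
  case term =>
    rw [prod_tmul, ← ofComponents_cutOutside_eq_prod, ← ofComponents_shrink_eq_prod]

theorem coproduct_ofSubgraph (hG : G.IsQuartic) {D : G.EdgeSet} (hD : D ∈ G.divergentSubgraphs)
    {s : Finset G.EdgeSet} (hs : ∀ D', D' ∈ s ↔ D' ∈ G.divergentSubgraphs ∧ D'.1 ⊂ D.1) :
    coproduct K (ofSubgraph K G D) = ofSubgraph K G D ⊗ₜ[K] 1 + 1 ⊗ₜ[K] ofSubgraph K G D +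
      ∑ D' ∈ s, ofSubgraph K G D' ⊗ₜ[K] ofSubgraph K (G.shrink D') (shrinkEdges D' D) := by
  classical
  obtain ⟨⟨x, hx⟩, -, hdiv, -⟩ := mem_divergentSubgraphs.1 hD
  have hcut := (isDivergent_iff hG D).1 hdiv
  have hall : IsDivergent (G.cutOutside D).allEdges := by
    rwa [isDivergent_iff (G := G.cutOutside D) hG, cutOutside_allEdges]
  let t : Finset (G.cutOutside D).EdgeSet := {F ∈ (G.cutOutside D).divergentSets |
    F.1.Nonempty ∧ F.1 ≠ (G.cutOutside D).allEdges.1}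
  have ht (F : (G.cutOutside D).EdgeSet) : F ∈ t ↔
      IsDivergent F ∧ F.1.Nonempty ∧ F.1 ≠ (G.cutOutside D).allEdges.1 := by
    rw [Finset.mem_filter, mem_divergentSets]
  rw [ofSubgraph_eq, coproduct_ofComponents K (A := G.cutOutside D) hG hall,
    sum_divergentSets _ hall ⟨x, (flipOn_ne_iff D x).2 hx⟩ ht,
    cutOutside_allEdges, ofComponents_shrink_allEdges, ofComponents_cutOutside_noEdges,
    ofComponents_shrink_noEdges K (A := G.cutOutside D) hG, ← sum_uncutEdges hG hD hs ht]
  congr 1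
  refine Finset.sum_congr rfl fun F hF => ?_
  have hE : IsDivergent (uncutEdges F) :=
    (isDivergent_cutEdges_iff hG (uncutEdges_subset F)).1 ((ht F).1 hF).1
  have hsat := saturated_contractEdges ((isDivergent_iff hG _).1 hE).2.oneBrokenFace hcut.1
  have hrecut : cutEdges (uncutEdges F) D (uncutEdges_subset F) = F := rfl
  rw [ofSubgraph_eq, ofSubgraph_eq, ← shrink_cutOutside (uncutEdges_subset F) hsat,
    ← cutOutside_cutEdges (uncutEdges F) D (uncutEdges_subset F), hrecut]

/-! ### The bialgebra -/

theorem algHom_ext_ofGraph {C : Type*} [CommSemiring C] [Algebra K C] {f g : HStar K →ₐ[K] C}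
    (h : ∀ G : RibbonGraph, G.IsFeynman1PI → f (ofGraph K G) = g (ofGraph K G)) : f = g := by
  refine MvPolynomial.algHom_ext fun i => ?_
  rw [← ofGraph_out K i]
  exact h _ i.out.2

theorem sum_nested_divergentSubgraphs (hG : G.IsFeynman1PI) {s : G.EdgeSet → Finset G.EdgeSet}
    (hs : ∀ D D', D' ∈ s D ↔ D' ∈ G.divergentSubgraphs ∧ D'.1 ⊂ D.1) :
    ∑ D ∈ G.divergentSubgraphs, ∑ D' ∈ s D, ofSubgraph K G D' ⊗ₜ[K]
        (ofSubgraph K (G.shrink D') (shrinkEdges D' D) ⊗ₜ[K] ofGraph K (G.shrink D)) =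
      ∑ D' ∈ G.divergentSubgraphs, ∑ E ∈ (G.shrink D').divergentSubgraphs,
        ofSubgraph K G D' ⊗ₜ[K] (ofSubgraph K (G.shrink D') E ⊗ₜ[K]
          ofGraph K ((G.shrink D').shrink E)) := by
  classical
  rw [Finset.sum_comm' (t' := G.divergentSubgraphs)
    (s' := fun D' => {D ∈ G.divergentSubgraphs | D'.1 ⊂ D.1})
    (fun D D' => by rw [hs, Finset.mem_filter]; tauto)]
  refine Finset.sum_congr rfl fun D' hD' => ?_
  have hcut' := (isDivergent_iff hG.1 D').1 (mem_divergentSubgraphs.1 hD').2.2.1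
  have hdiv {D : G.EdgeSet} (hD : D ∈ G.divergentSubgraphs) : IsDivergent D :=
    (mem_divergentSubgraphs.1 hD).2.2.1
  refine Finset.sum_bij (fun D _ => shrinkEdges D' D) (fun D hD => ?mem)
    (fun D₁ h₁ D₂ h₂ heq => ?injective) (fun E hE => ?surjective) (fun D hD => ?term)
  case mem =>
    obtain ⟨hD, hlt⟩ := Finset.mem_filter.1 hD
    exact shrinkEdges_mem hG hD' hD hlt
  case injective =>
    obtain ⟨h₁, hlt₁⟩ := Finset.mem_filter.1 h₁
    obtain ⟨h₂, hlt₂⟩ := Finset.mem_filter.1 h₂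
    exact shrinkEdges_injective hG hD' (hdiv h₁) (hdiv h₂) hlt₁.1 hlt₂.1 heq
  case surjective =>
    obtain ⟨D, hD, hlt, h⟩ := exists_shrinkEdges_eq hG hD' hE
    exact ⟨D, Finset.mem_filter.2 ⟨hD, hlt⟩, h⟩
  case term =>
    obtain ⟨hD, hlt⟩ := Finset.mem_filter.1 hD
    have hsat := saturated_contractEdges hcut'.2.oneBrokenFace
      ((isDivergent_iff hG.1 D).1 (hdiv hD)).1
    rw [ofGraph_eq_of_isomorphic K (isomorphic_shrink_shrink hlt.1 hsat)]

theorem assoc_map_coproduct_reducedCoproduct (hG : G.IsQuartic)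
    {s : G.EdgeSet → Finset G.EdgeSet}
    (hs : ∀ D D', D' ∈ s D ↔ D' ∈ G.divergentSubgraphs ∧ D'.1 ⊂ D.1) :
    Algebra.TensorProduct.assoc K K K (HStar K) (HStar K) (HStar K)
        (Algebra.TensorProduct.map (coproduct K) (AlgHom.id K _) (reducedCoproduct K G)) =
      ∑ D ∈ G.divergentSubgraphs, ofSubgraph K G D ⊗ₜ[K] (1 ⊗ₜ[K] ofGraph K (G.shrink D)) +
        1 ⊗ₜ[K] reducedCoproduct K G +
        ∑ D ∈ G.divergentSubgraphs, ∑ D' ∈ s D, ofSubgraph K G D' ⊗ₜ[K]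
          (ofSubgraph K (G.shrink D') (shrinkEdges D' D) ⊗ₜ[K] ofGraph K (G.shrink D)) := by
  simp only [reducedCoproduct, map_sum, TensorProduct.tmul_sum, ← Finset.sum_add_distrib]
  refine Finset.sum_congr rfl fun D hD => ?_
  rw [Algebra.TensorProduct.map_tmul, AlgHom.id_apply, coproduct_ofSubgraph K hG hD (hs D)]
  simp only [TensorProduct.add_tmul, TensorProduct.sum_tmul, map_add, map_sum,
    Algebra.TensorProduct.assoc_tmul]

theorem map_id_coproduct_reducedCoproduct (hG : G.IsFeynman1PI) :
    Algebra.TensorProduct.map (AlgHom.id K _) (coproduct K) (reducedCoproduct K G) =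
      ∑ D ∈ G.divergentSubgraphs, ofSubgraph K G D ⊗ₜ[K] (ofGraph K (G.shrink D) ⊗ₜ[K] 1) +
        ∑ D ∈ G.divergentSubgraphs, ofSubgraph K G D ⊗ₜ[K] (1 ⊗ₜ[K] ofGraph K (G.shrink D)) +
        ∑ D ∈ G.divergentSubgraphs, ∑ E ∈ (G.shrink D).divergentSubgraphs,
          ofSubgraph K G D ⊗ₜ[K] (ofSubgraph K (G.shrink D) E ⊗ₜ[K]
            ofGraph K ((G.shrink D).shrink E)) := by
  rw [reducedCoproduct, map_sum, ← Finset.sum_add_distrib, ← Finset.sum_add_distrib]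
  refine Finset.sum_congr rfl fun D hD => ?_
  obtain ⟨-, hfull, hdiv, hne⟩ := mem_divergentSubgraphs.1 hD
  rw [Algebra.TensorProduct.map_tmul, AlgHom.id_apply,
    coproduct_ofGraph K (isFeynman1PI_shrink hG hfull hdiv hne), reducedCoproduct,
    TensorProduct.tmul_add, TensorProduct.tmul_add, TensorProduct.tmul_sum]

theorem coproduct_coassoc :
    (Algebra.TensorProduct.assoc K K K (HStar K) (HStar K) (HStar K)).toAlgHom.comp
      ((Algebra.TensorProduct.map (coproduct K) (AlgHom.id K _)).comp (coproduct K)) =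
    (Algebra.TensorProduct.map (AlgHom.id K _) (coproduct K)).comp (coproduct K) := by
  classical
  refine algHom_ext_ofGraph K (C := HStar K ⊗[K] (HStar K ⊗[K] HStar K)) fun G hG => ?_
  let s (D : G.EdgeSet) : Finset G.EdgeSet := {D' ∈ G.divergentSubgraphs | D'.1 ⊂ D.1}
  have hs (D D' : G.EdgeSet) : D' ∈ s D ↔ D' ∈ G.divergentSubgraphs ∧ D'.1 ⊂ D.1 :=
    Finset.mem_filter
  change Algebra.TensorProduct.assoc K K K (HStar K) (HStar K) (HStar K)
    (Algebra.TensorProduct.map (coproduct K) (AlgHom.id K _) (coproduct K (ofGraph K G))) =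
    Algebra.TensorProduct.map (AlgHom.id K _) (coproduct K) (coproduct K (ofGraph K G))
  rw [coproduct_ofGraph K hG]
  simp only [map_add]
  rw [assoc_map_coproduct_reducedCoproduct K hG.1 hs, map_id_coproduct_reducedCoproduct K hG,
    sum_nested_divergentSubgraphs K hG hs]
  simp only [Algebra.TensorProduct.map_tmul, AlgHom.id_apply, map_one, map_add,
    coproduct_ofGraph K hG, TensorProduct.add_tmul, TensorProduct.tmul_add,
    Algebra.TensorProduct.assoc_tmul, Algebra.TensorProduct.one_def, reducedCoproduct,
    TensorProduct.sum_tmul, map_sum]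
  abel

theorem counit_coproduct_left :
    (Algebra.TensorProduct.map (counit K) (AlgHom.id K (HStar K))).comp (coproduct K) =
      (Algebra.TensorProduct.lid K (HStar K)).symm := by
  refine algHom_ext_ofGraph K fun G hG => ?_
  have hreduced : Algebra.TensorProduct.map (counit K) (AlgHom.id K _) (reducedCoproduct K G) =
      0 := by
    rw [reducedCoproduct, map_sum]
    refine Finset.sum_eq_zero fun D hD => ?_
    rw [Algebra.TensorProduct.map_tmul, map_ofSubgraph_eq_zero K (counit K)
      (mem_divergentSubgraphs.1 hD).1 fun c => counit_ofGraph K _, TensorProduct.zero_tmul]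
  rw [AlgHom.comp_apply, coproduct_ofGraph K hG, map_add, map_add, hreduced,
    Algebra.TensorProduct.map_tmul, Algebra.TensorProduct.map_tmul, counit_ofGraph,
    TensorProduct.zero_tmul, zero_add, add_zero, map_one]
  rfl

theorem counit_coproduct_right :
    (Algebra.TensorProduct.map (AlgHom.id K (HStar K)) (counit K)).comp (coproduct K) =
      (Algebra.TensorProduct.rid K K (HStar K)).symm := by
  refine algHom_ext_ofGraph K fun G hG => ?_
  have hreduced : Algebra.TensorProduct.map (AlgHom.id K _) (counit K) (reducedCoproduct K G) =
      0 := by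
    simp only [reducedCoproduct, map_sum, Algebra.TensorProduct.map_tmul, counit_ofGraph,
      TensorProduct.tmul_zero, Finset.sum_const_zero]
  rw [AlgHom.comp_apply, coproduct_ofGraph K hG, map_add, map_add, hreduced,
    Algebra.TensorProduct.map_tmul, Algebra.TensorProduct.map_tmul, counit_ofGraph,
    TensorProduct.tmul_zero, add_zero, add_zero, map_one]
  rfl

instance : Bialgebra K (HStar K) :=
  Bialgebra.ofAlgHom (coproduct K) (counit K) (coproduct_coassoc K) (counit_coproduct_left K)
    (counit_coproduct_right K)

/-! ### The antipode -/

open WithConv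

theorem convMul_ofGraph (f g : WithConv (HStar K →ₐ[K] HStar K)) (hG : G.IsFeynman1PI) :
    (f * g) (ofGraph K G) = f (ofGraph K G) + g (ofGraph K G) +
      ∑ D ∈ G.divergentSubgraphs, f (ofSubgraph K G D) * g (ofGraph K (G.shrink D)) := by
  rw [AlgHom.convMul_apply]
  change Algebra.TensorProduct.lift _ _ _ (coproduct K (ofGraph K G)) = _
  rw [coproduct_ofGraph K hG, reducedCoproduct]
  simp

theorem convOne_ofGraph (G : RibbonGraph) :
    (1 : WithConv (HStar K →ₐ[K] HStar K)) (ofGraph K G) = 0 := by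
  rw [AlgHom.convOne_apply]
  exact (congrArg _ (counit_ofGraph K G)).trans (map_zero _)

theorem convMul_antipode_id : toConv (antipode K) * toConv (AlgHom.id K (HStar K)) = 1 := by
  refine WithConv.ext (algHom_ext_ofGraph K fun G hG => ?_)
  refine (convMul_ofGraph K _ _ hG).trans (Eq.trans ?_ (convOne_ofGraph K G).symm)
  change antipode K (ofGraph K G) + ofGraph K G + ∑ D ∈ G.divergentSubgraphs,
    antipode K (ofSubgraph K G D) * ofGraph K (G.shrink D) = 0
  rw [antipode_ofGraph K hG]
  ring

theorem eq_one_of_convMul_id_eq {e : WithConv (HStar K →ₐ[K] HStar K)}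
    (he : e * toConv (AlgHom.id K (HStar K)) = toConv (AlgHom.id K (HStar K))) : e = 1 := by
  have hzero (n : ℕ) : ∀ G : RibbonGraph, G.IsFeynman1PI → G.numInternalHalfEdges = n →
      e.ofConv (ofGraph K G) = 0 := by
    induction n using Nat.strong_induction_on with
    | _ n ih =>
      rintro G hG rfl
      have hconv := convMul_ofGraph K e (toConv (AlgHom.id K _)) hG
      rw [he, Finset.sum_eq_zero, add_zero] at hconv
      · exact left_eq_add.1 (hconv.trans (add_comm _ _))
      · intro D hD
        obtain ⟨hne, -, hdiv, -⟩ := mem_divergentSubgraphs.1 hD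
        refine mul_eq_zero_of_left (map_ofSubgraph_eq_zero K e.ofConv hne fun c => ?_) _
        exact ih _ (numInternalHalfEdges_subComponent_lt G D hD c) _
          (isFeynman1PI_subComponent hG.1 hdiv c) rfl
  exact WithConv.ext (algHom_ext_ofGraph K fun G hG =>
    (hzero _ G hG rfl).trans (convOne_ofGraph K G).symm)

theorem convMul_id_antipode : toConv (AlgHom.id K (HStar K)) * toConv (antipode K) = 1 :=
  eq_one_of_convMul_id_eq K (by rw [mul_assoc, convMul_antipode_id, mul_one])

theorem isHopfAlgebra :
    IsHopfAlgebra K (HStar K) (coproduct K).toLinearMap (counit K).toLinearMap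
      (antipode K).toLinearMap where
  coassoc := congrArg AlgHom.toLinearMap (coproduct_coassoc K)
  counit_left := congrArg AlgHom.toLinearMap (counit_coproduct_left K)
  counit_right := congrArg AlgHom.toLinearMap (counit_coproduct_right K)
  comul_one := map_one (coproduct K)
  comul_mul := map_mul (coproduct K)
  counit_one := map_one (counit K)
  counit_mul := map_mul (counit K)
  antipode_left := congrArg (fun f => f.ofConv.toLinearMap) (convMul_antipode_id K)
  antipode_right := congrArg (fun f => f.ofConv.toLinearMap) (convMul_id_antipode K)

end HStar

end

theorem theorem4p1 (K : Type*) [Field K] :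
    -- components of divergent subgraphs, and cographs, are again 1PI Feynman graphs
    (∀ Γ : RibbonGraph, Γ.IsFeynman1PI → ∀ D ∈ Γ.divergentSubgraphs,
      (∀ c, (Γ.subComponent D c).IsFeynman1PI) ∧ (Γ.shrink D).IsFeynman1PI) ∧
    -- the coproduct, the counit and the antipode of each graph
    (∀ Γ : RibbonGraph, Γ.IsFeynman1PI →
      HStar.coproduct K (HStar.ofGraph K Γ) =
        HStar.ofGraph K Γ ⊗ₜ[K] 1 + 1 ⊗ₜ[K] HStar.ofGraph K Γ +
          ∑ D ∈ Γ.divergentSubgraphs,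
            HStar.ofSubgraph K Γ D ⊗ₜ[K] HStar.ofGraph K (Γ.shrink D)) ∧
    (∀ Γ : RibbonGraph, Γ.IsFeynman1PI → HStar.counit K (HStar.ofGraph K Γ) = 0) ∧
    (∀ Γ : RibbonGraph, Γ.IsFeynman1PI →
      HStar.antipode K (HStar.ofGraph K Γ) =
        - HStar.ofGraph K Γ - ∑ D ∈ Γ.divergentSubgraphs,
          HStar.antipode K (HStar.ofSubgraph K Γ D) * HStar.ofGraph K (Γ.shrink D)) ∧
    -- the Hopf algebra axioms
    IsHopfAlgebra K (HStar K) (HStar.coproduct K).toLinearMap (HStar.counit K).toLinearMap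
      (HStar.antipode K).toLinearMap := by
  refine ⟨fun Γ hΓ D hD => ?_, fun Γ hΓ => HStar.coproduct_ofGraph K hΓ,
    fun Γ _ => HStar.counit_ofGraph K Γ, fun Γ hΓ => HStar.antipode_ofGraph K hΓ,
    HStar.isHopfAlgebra K⟩
  obtain ⟨-, h2, h3, h4⟩ := RibbonGraph.mem_divergentSubgraphs.1 hD
  exact ⟨RibbonGraph.isFeynman1PI_subComponent hΓ.1 h3,
    RibbonGraph.isFeynman1PI_shrink hΓ h2 h3 h4⟩
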